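/- Let $n\ge 1$ and let $M$ be a nonempty smooth manifold of dimension $2n+1$ with an almost contact metric structure $(\phi,\xi,\eta,g)$: $\phi$ is a smooth $(1,1)$-tensor field, $\xi$ a smooth vector field (the Reeb field), $\eta$ a smooth one-form and $g$ a smooth Riemannian metric, with $$\phi^2=-I+\eta\otimes\xi,\quad \eta\circ\phi=0,\quad \phi\xi=0,\quad \eta(\xi)=1,\quad g(\phi X,\phi Y)=g(X,Y)-\eta(X)\eta(Y).$$ Put $\omega(X,Y)=g(\phi X,Y)$. The structure is called normal if $$\phi^2[X,Y]+[\phi X,\phi Y]-\phi[\phi X,Y]-\phi[X,\phi Y]+\big(X\eta(Y)-Y\eta(X)-\eta([X,Y])\big)\xi=0$$ for all vector fields $X,Y$. It is called cosymplectic if it is normal, $d\eta=0$ and $d\omega=0$. For a smooth function $f:M\to\mathbb R$ with $df\wedge\eta=0$, it is called $f$-cosymplectic if it is normal, $d\eta=0$ and $d\omega=2f\,\eta\wedge\omega$. Theorem. Suppose that the structure is $f$-cosymplectic and that $g$ is a Ricci soliton with potential field $\xi$ (a contact Ricci soliton), i.e. for some constant $\lambda\in\mathbb R$ $$\tfrac12\mathcal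 L_\xi g+\mathrm{Ric}-\lambda g=0 .$$ Then $f\equiv 0$, so that $M$ is cosymplectic; moreover $\mathrm{Ric}=0$ and $\lambda=0$. Furthermore, $M$ is locally isometric to the product of a line and a Ricci-flat Kähler (Calabi–Yau) manifold: for every $p\in M$ there are a Ricci-flat Kähler manifold $(N,h,J)$ of real dimension $2n$ and an isometry from an open neighbourhood of $p$ in $(M,g)$ onto an open subset of $(\mathbb R\times N,\ dt^2+h)$. -/

import Mathlib

open scoped Manifold ContDiff

noncomputable section

/-- The model space `ℝ^m`. -/
abbrev Euc (m : ℕ) : Type := EuclideanSpace ℝ (Fin m)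

/-! ### Tensor calculus on an open subset of `ℝ^m`

Tensor fields are written through their values on tangent vectors: a bilinear form field `G` has
components `G y u v`, an endomorphism field `A` sends `u` at `y` to `A y u`. Below, the letters
`u`, `v`, `w` stand for constant (coordinate) vector fields. -/

namespace Coord

variable {m : ℕ}

/-- `X η(Y) - Y η(X) - η([X, Y])` for the constant fields `X = u`, `Y = v`: the exterior derivative
of a one-form (it is `2 dη(X, Y)` for authors who put a factor `1/2` into the definition of `d`). -/
def dOne (η : Euc m → Euc m →L[ℝ] ℝ) (y u v : Euc m) : ℝ :=
  fderiv ℝ η y u v - fderiv ℝ η y v u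

/-- The exterior derivative of a two-form. -/
def dTwo (Ω : Euc m → Euc m →L[ℝ] Euc m →L[ℝ] ℝ) (y u v w : Euc m) : ℝ :=
  fderiv ℝ Ω y u v w + fderiv ℝ Ω y v w u + fderiv ℝ Ω y w u v

/-- The wedge product `η ∧ Ω` of a one-form and a two-form at a point, in the normalization of
`dTwo`. -/
def wedgeOneTwo (η : Euc m →L[ℝ] ℝ) (Ω : Euc m →L[ℝ] Euc m →L[ℝ] ℝ) (u v w : Euc m) : ℝ :=
  η u * Ω v w + η v * Ω w u + η w * Ω u v

/-- `φ²[X, Y] + [φX, φY] - φ[φX, Y] - φ[X, φY]` for the constant fields `X = u`, `Y = v`. -/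
def nijenhuis (φ : Euc m → Euc m →L[ℝ] Euc m) (y u v : Euc m) : Euc m :=
  φ y (φ y (VectorField.lieBracket ℝ (fun _ ↦ u) (fun _ ↦ v) y))
    + VectorField.lieBracket ℝ (fun z ↦ φ z u) (fun z ↦ φ z v) y
    - φ y (VectorField.lieBracket ℝ (fun z ↦ φ z u) (fun _ ↦ v) y)
    - φ y (VectorField.lieBracket ℝ (fun _ ↦ u) (fun z ↦ φ z v) y)

/-- The Lie derivative `(L_V G)(u, v)` of a bilinear form field along a vector field. -/
def lieDeriv (V : Euc m → Euc m) (G : Euc m → Euc m →L[ℝ] Euc m →L[ℝ] ℝ) (y u v : Euc m) : ℝ :=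
  fderiv ℝ G y (V y) u v + G y (fderiv ℝ V y u) v + G y u (fderiv ℝ V y v)

/-- The Christoffel symbols of the first kind: the linear form
`w ↦ (∂_u G(v, w) + ∂_v G(u, w) - ∂_w G(u, v)) / 2`. -/
def christoffelFirst (G : Euc m → Euc m →L[ℝ] Euc m →L[ℝ] ℝ) (y u v : Euc m) : Euc m →L[ℝ] ℝ :=
  (1 / 2 : ℝ) • (fderiv ℝ G y u v + fderiv ℝ G y v u - ((fderiv ℝ G y).flip u).flip v)

/-- The Christoffel symbols: `christoffel G y u v = ∇_u v` for the Levi-Civita connection `∇` of the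
metric `G` and the constant fields `u`, `v`. The index is raised with the inverse of
`G y : ℝ^m → (ℝ^m)*`. -/
def christoffel (G : Euc m → Euc m →L[ℝ] Euc m →L[ℝ] ℝ) (y u v : Euc m) : Euc m :=
  (G y).inverse (christoffelFirst G y u v)

/-- The curvature `R(u, v)w = ∇_u ∇_v w - ∇_v ∇_u w - ∇_[u, v] w`, where `[u, v] = 0`. -/
def curvature (G : Euc m → Euc m →L[ℝ] Euc m →L[ℝ] ℝ) (y u v w : Euc m) : Euc m :=
  (fderiv ℝ (fun z ↦ christoffel G z v w) y u + christoffel G y u (christoffel G y v w))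
    - (fderiv ℝ (fun z ↦ christoffel G z u w) y v + christoffel G y v (christoffel G y u w))

/-- The Ricci curvature `Ric(v, w)`: the trace of `u ↦ R(u, v)w`. -/
def ricci (G : Euc m → Euc m →L[ℝ] Euc m →L[ℝ] ℝ) (y v w : Euc m) : ℝ :=
  ∑ i : Fin m, curvature G y (EuclideanSpace.single i 1) v w i

end Coord

/-! ### Tensor fields on a manifold and their coordinate expressions -/

/-- A smooth Riemannian metric on an `m`-dimensional manifold. -/
abbrev RiemMetric (m : ℕ) (M : Type*) [TopologicalSpace M] [ChartedSpace (Euc m) M]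
    [IsManifold (𝓡 m) ∞ M] : Type _ :=
  Bundle.ContMDiffRiemannianMetric (𝓡 m) ∞ (Euc m) (fun x : M ↦ TangentSpace (𝓡 m) x)

section Charts

variable {m : ℕ} {M : Type*} [TopologicalSpace M] [ChartedSpace (Euc m) M]

/-- Differential at `y` of the parametrization `e⁻¹` belonging to a chart `e`. -/
def dParam (e : OpenPartialHomeomorph M (Euc m)) (y : Euc m) :
    Euc m →L[ℝ] TangentSpace (𝓡 m) (e.symm y) :=
  mfderiv (𝓡 m) (𝓡 m) e.symm y

/-- Differential of a chart `e` at the point with coordinates `y`. -/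
def dChart (e : OpenPartialHomeomorph M (Euc m)) (y : Euc m) :
    TangentSpace (𝓡 m) (e.symm y) →L[ℝ] Euc m :=
  mfderiv (𝓡 m) (𝓡 m) e (e.symm y)

/-- The vector field `V` in the chart `e`. -/
def vecIn (e : OpenPartialHomeomorph M (Euc m)) (V : ∀ x : M, TangentSpace (𝓡 m) x) (y : Euc m) :
    Euc m :=
  dChart e y (V (e.symm y))

/-- The one-form `η` in the chart `e`. -/
def formIn (e : OpenPartialHomeomorph M (Euc m)) (η : ∀ x : M, TangentSpace (𝓡 m) x →L[ℝ] ℝ)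
    (y : Euc m) : Euc m →L[ℝ] ℝ :=
  (η (e.symm y)).comp (dParam e y)

/-- The `(1,1)`-tensor field `φ` in the chart `e`. -/
def endoIn (e : OpenPartialHomeomorph M (Euc m))
    (φ : ∀ x : M, TangentSpace (𝓡 m) x →L[ℝ] TangentSpace (𝓡 m) x) (y : Euc m) :
    Euc m →L[ℝ] Euc m :=
  (dChart e y).comp ((φ (e.symm y)).comp (dParam e y))

/-- The bilinear form field `b` in the chart `e`. -/
def bilinIn (e : OpenPartialHomeomorph M (Euc m))
    (b : ∀ x : M, TangentSpace (𝓡 m) x →L[ℝ] TangentSpace (𝓡 m) x →L[ℝ] ℝ) (y : Euc m) :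
    Euc m →L[ℝ] Euc m →L[ℝ] ℝ :=
  (ContinuousLinearMap.precomp ℝ (dParam e y)).comp ((b (e.symm y)).comp (dParam e y))

/-- Smoothness of a vector field. -/
def IsSmoothVec [IsManifold (𝓡 m) ∞ M] (V : ∀ x : M, TangentSpace (𝓡 m) x) : Prop :=
  ContMDiff (𝓡 m) ((𝓡 m).prod 𝓘(ℝ, Euc m)) ∞
    (fun x ↦ Bundle.TotalSpace.mk' (Euc m) x (V x))

/-- Smoothness of a one-form. -/
def IsSmoothForm [IsManifold (𝓡 m) ∞ M] (η : ∀ x : M, TangentSpace (𝓡 m) x →L[ℝ] ℝ) : Prop :=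
  ContMDiff (𝓡 m) ((𝓡 m).prod 𝓘(ℝ, Euc m →L[ℝ] ℝ)) ∞
    (fun x ↦ Bundle.TotalSpace.mk' (Euc m →L[ℝ] ℝ) x (η x))

/-- Smoothness of a `(1,1)`-tensor field. -/
def IsSmoothEndo [IsManifold (𝓡 m) ∞ M]
    (φ : ∀ x : M, TangentSpace (𝓡 m) x →L[ℝ] TangentSpace (𝓡 m) x) : Prop :=
  ContMDiff (𝓡 m) ((𝓡 m).prod 𝓘(ℝ, Euc m →L[ℝ] Euc m)) ∞
    (fun x ↦ Bundle.TotalSpace.mk' (Euc m →L[ℝ] Euc m) x (φ x))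

/-- The two-form `(X, Y) ↦ b(φX, Y)`. -/
def fundamentalForm (b : ∀ x : M, TangentSpace (𝓡 m) x →L[ℝ] TangentSpace (𝓡 m) x →L[ℝ] ℝ)
    (φ : ∀ x : M, TangentSpace (𝓡 m) x →L[ℝ] TangentSpace (𝓡 m) x) (x : M) :
    TangentSpace (𝓡 m) x →L[ℝ] TangentSpace (𝓡 m) x →L[ℝ] ℝ :=
  (b x).comp (φ x)

end Charts

/-! ### Ricci solitons -/

section Ricci

variable {m : ℕ} {M : Type*} [TopologicalSpace M] [ChartedSpace (Euc m) M]
  [IsManifold (𝓡 m) ∞ M]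

/-- `Ric = 0`, checked in every chart of the atlas. -/
def IsRicciFlat (g : RiemMetric m M) : Prop :=
  ∀ e ∈ atlas (Euc m) M, ∀ y ∈ e.target, ∀ u v : Euc m,
    Coord.ricci (bilinIn e g.inner) y u v = 0

/-- The Ricci soliton equation `½ L_V g + Ric - λ g = 0`, checked in every chart of the atlas. -/
def IsRicciSoliton (g : RiemMetric m M) (V : ∀ x : M, TangentSpace (𝓡 m) x) (lam : ℝ) : Prop :=
  ∀ e ∈ atlas (Euc m) M, ∀ y ∈ e.target, ∀ u v : Euc m,
    (1 / 2 : ℝ) * Coord.lieDeriv (vecIn e V) (bilinIn e g.inner) y u v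
      + Coord.ricci (bilinIn e g.inner) y u v - lam * bilinIn e g.inner y u v = 0

end Ricci

/-! ### Almost contact metric structures -/

/-- An almost contact metric structure `(φ, ξ, η, g)` on a manifold of dimension `2n + 1`. -/
structure AlmostContactMetric (n : ℕ) (M : Type*) [TopologicalSpace M]
    [ChartedSpace (Euc (2 * n + 1)) M] [IsManifold (𝓡 (2 * n + 1)) ∞ M] where
  g : RiemMetric (2 * n + 1) M
  φ : ∀ x : M, TangentSpace (𝓡 (2 * n + 1)) x →L[ℝ] TangentSpace (𝓡 (2 * n + 1)) x
  ξ : ∀ x : M, TangentSpace (𝓡 (2 * n + 1)) x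
  η : ∀ x : M, TangentSpace (𝓡 (2 * n + 1)) x →L[ℝ] ℝ
  smooth_φ : IsSmoothEndo φ
  smooth_ξ : IsSmoothVec ξ
  smooth_η : IsSmoothForm η
  φ_sq : ∀ x v, φ x (φ x v) = -v + η x v • ξ x
  η_φ : ∀ x v, η x (φ x v) = 0
  φ_ξ : ∀ x, φ x (ξ x) = 0
  η_ξ : ∀ x, η x (ξ x) = 1
  compat : ∀ x v w, g.inner x (φ x v) (φ x w) = g.inner x v w - η x v * η x w

namespace AlmostContactMetric

variable {n : ℕ} {M : Type*} [TopologicalSpace M]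
  [ChartedSpace (Euc (2 * n + 1)) M] [IsManifold (𝓡 (2 * n + 1)) ∞ M]

/-- The fundamental two-form `ω(X, Y) = g(φX, Y)`. -/
def fundForm (S : AlmostContactMetric n M) (x : M) :
    TangentSpace (𝓡 (2 * n + 1)) x →L[ℝ] TangentSpace (𝓡 (2 * n + 1)) x →L[ℝ] ℝ :=
  fundamentalForm S.g.inner S.φ x

/-- Normality: `φ²[X, Y] + [φX, φY] - φ[φX, Y] - φ[X, φY] + dη(X, Y)ξ = 0`
(with `dη` normalized without the factor `1/2`). -/
def IsNormal (S : AlmostContactMetric n M) : Prop :=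
  ∀ e ∈ atlas (Euc (2 * n + 1)) M, ∀ y ∈ e.target, ∀ u v : Euc (2 * n + 1),
    Coord.nijenhuis (endoIn e S.φ) y u v
      + Coord.dOne (formIn e S.η) y u v • vecIn e S.ξ y = 0

/-- `dη = 0`. -/
def EtaClosed (S : AlmostContactMetric n M) : Prop :=
  ∀ e ∈ atlas (Euc (2 * n + 1)) M, ∀ y ∈ e.target, ∀ u v : Euc (2 * n + 1),
    Coord.dOne (formIn e S.η) y u v = 0

/-- `dω = 0`. -/
def OmegaClosed (S : AlmostContactMetric n M) : Prop :=
  ∀ e ∈ atlas (Euc (2 * n + 1)) M, ∀ y ∈ e.target, ∀ u v w : Euc (2 * n + 1),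
    Coord.dTwo (bilinIn e S.fundForm) y u v w = 0

/-- Almost cosymplectic: `η` and `ω` are closed. Cosymplectic: moreover normal. -/
structure IsCosymplectic (S : AlmostContactMetric n M) : Prop where
  eta_closed : S.EtaClosed
  omega_closed : S.OmegaClosed
  normal : S.IsNormal

/-- `f`-cosymplectic: normal, `dη = 0` and `dω = 2f η ∧ ω`, for a smooth function `f` with
`df ∧ η = 0`. -/
structure IsFCosymplectic (S : AlmostContactMetric n M) (f : M → ℝ) : Prop where
  smooth : ContMDiff (𝓡 (2 * n + 1)) 𝓘(ℝ, ℝ) ∞ f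
  df_wedge_eta : ∀ x (v w : TangentSpace (𝓡 (2 * n + 1)) x),
    mvfderiv (𝓡 (2 * n + 1)) f x v * S.η x w - mvfderiv (𝓡 (2 * n + 1)) f x w * S.η x v = 0
  eta_closed : S.EtaClosed
  d_omega : ∀ e ∈ atlas (Euc (2 * n + 1)) M, ∀ y ∈ e.target, ∀ u v w : Euc (2 * n + 1),
    Coord.dTwo (bilinIn e S.fundForm) y u v w
      = 2 * f (e.symm y) * Coord.wedgeOneTwo (formIn e S.η y) (bilinIn e S.fundForm y) u v w
  normal : S.IsNormal

end AlmostContactMetric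

/-! ### Kähler manifolds and products with a line -/

/-- A Kähler structure `(h, J)` on a manifold of real dimension `2n`: a Riemannian metric and a
compatible almost complex structure which is integrable (vanishing Nijenhuis tensor) and whose
fundamental two-form `h(JX, Y)` is closed. -/
structure KahlerStructure (n : ℕ) (N : Type*) [TopologicalSpace N]
    [ChartedSpace (Euc (2 * n)) N] [IsManifold (𝓡 (2 * n)) ∞ N] where
  h : RiemMetric (2 * n) N
  J : ∀ x : N, TangentSpace (𝓡 (2 * n)) x →L[ℝ] TangentSpace (𝓡 (2 * n)) x
  smooth_J : IsSmoothEndo J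
  J_sq : ∀ x v, J x (J x v) = -v
  compat : ∀ x v w, h.inner x (J x v) (J x w) = h.inner x v w
  integrable : ∀ e ∈ atlas (Euc (2 * n)) N, ∀ y ∈ e.target, ∀ u v : Euc (2 * n),
    Coord.nijenhuis (endoIn e J) y u v = 0
  closed : ∀ e ∈ atlas (Euc (2 * n)) N, ∀ y ∈ e.target, ∀ u v w : Euc (2 * n),
    Coord.dTwo (bilinIn e (fundamentalForm h.inner J)) y u v w = 0

/-- The product metric `dt² + h` on `ℝ × N`, evaluated on two tangent vectors. -/
def lineProductMetric {k : ℕ} {N : Type*} [TopologicalSpace N] [ChartedSpace (Euc k) N]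
    [IsManifold (𝓡 k) ∞ N] (h : RiemMetric k N) (q : ℝ × N)
    (a b : TangentSpace (𝓘(ℝ, ℝ).prod (𝓡 k)) q) : ℝ :=
  mvfderiv (𝓘(ℝ, ℝ).prod (𝓡 k)) (Prod.fst : ℝ × N → ℝ) q a
      * mvfderiv (𝓘(ℝ, ℝ).prod (𝓡 k)) (Prod.fst : ℝ × N → ℝ) q b
    + h.inner q.2 (mfderiv (𝓘(ℝ, ℝ).prod (𝓡 k)) (𝓡 k) (Prod.snd : ℝ × N → N) q a)
        (mfderiv (𝓘(ℝ, ℝ).prod (𝓡 k)) (𝓡 k) (Prod.snd : ℝ × N → N) q b)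

/-- Near `p`, the Riemannian manifold `(M, g)` is isometric to an open subset of `(ℝ × N, dt² + h)`:
`Φ` is a diffeomorphism from an open neighbourhood of `p` onto an open subset of `ℝ × N`, and it
pulls the product metric back to `g`. -/
def IsLocallyIsometricToLineProductAt {m k : ℕ} {M : Type*} [TopologicalSpace M]
    [ChartedSpace (Euc m) M] [IsManifold (𝓡 m) ∞ M] (g : RiemMetric m M) (p : M)
    {N : Type*} [TopologicalSpace N] [ChartedSpace (Euc k) N] [IsManifold (𝓡 k) ∞ N]
    (h : RiemMetric k N) : Prop :=
  ∃ Φ : OpenPartialHomeomorph M (ℝ × N), p ∈ Φ.source ∧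
    ContMDiffOn (𝓡 m) (𝓘(ℝ, ℝ).prod (𝓡 k)) ∞ Φ Φ.source ∧
    ContMDiffOn (𝓘(ℝ, ℝ).prod (𝓡 k)) (𝓡 m) ∞ Φ.symm Φ.target ∧
    ∀ x ∈ Φ.source, ∀ v w : TangentSpace (𝓡 m) x,
      lineProductMetric h (Φ x) (mfderiv (𝓡 m) (𝓘(ℝ, ℝ).prod (𝓡 k)) Φ x v)
        (mfderiv (𝓡 m) (𝓘(ℝ, ℝ).prod (𝓡 k)) Φ x w) = g.inner x v w

end

/-! Locally `η = dt` for a function `t`, and `t` extends to coordinates `(t, x)` with `ξ = ∂_t`. In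
these coordinates normality together with `dη = 0` gives `L_ξ φ = 0`. Contracting `dω = 2f η ∧ ω`
with `ξ` then yields `L_ξ g = 2f (g - η ⊗ η)`. Since `df ∧ η = 0`, the function `f` depends on `t`
only. Integrating in `t` shows that `g = dt² + s(t) H` with `s' = 2 f s` and `H` a metric on the
slice `t = 0`: an `f`-cosymplectic manifold is locally a warped product with a line
(`exists_isWarpedOn`).

The Ricci curvature of a warped product is explicit (`IsWarpedOn.ricci_eq`). The `(ξ, ξ)` component
of the soliton equation is the Riccati equation `-d (f' + f²) = λ` with `d = 2n`. A component
tangent to the slice says that `s (λ - f + f' + f² + (d - 1) f²)` is independent of `t`.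
Differentiating the second and inserting the first leaves `f² = -f' - f²`, a constant, whence `f³ =
0` (`eq_zero_of_warped_soliton`). So `f = 0` and `λ = 0`, the soliton equation reduces to `Ric = 0`,
the product is unwarped, and `H` is Ricci-flat. The restriction of `φ` to the slice is a complex
structure, integrable by normality and Kähler because `dω = 0`.

Two supports are needed. Adapted coordinates (`exists_adapted_coordinates`) come from the flow of
`ξ`, whose smooth dependence on initial values is proved by the inverse function theorem on a space
of paths (`exists_smooth_local_flow`). As the hypotheses are expressed in the charts of the atlas,
to which the adapted coordinates need not belong, all the tensors involved must be shown to
transform correctly (`ricci_change`, `lieDeriv_change`, `dTwo_change`, `nijenhuis_change`). The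
results are assembled in `Coord.IsFCosymplecticOn.exists_splitting` and carried back to the
manifold. -/

open scoped Manifold ContDiff
set_option maxSynthPendingDepth 3
noncomputable section

/-! ### Smooth dependence of local flows on initial conditions -/

/-! ### Composition operators on spaces of continuous maps. -/

section Nemytskii

open Filter Topology

variable {K : Type} [TopologicalSpace K] [CompactSpace K]

/-- Pointwise application of a continuous family of operators to a continuous family of vectors. -/
def ContinuousMap.clmApply (K : Type) [TopologicalSpace K] [CompactSpace K]
    (E F : Type) [NormedAddCommGroup E] [NormedSpace ℝ E]
    [NormedAddCommGroup F] [NormedSpace ℝ F] :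
    C(K, E →L[ℝ] F) →L[ℝ] C(K, E) →L[ℝ] C(K, F) :=
  LinearMap.mkContinuous₂ (E := C(K, E →L[ℝ] F)) (F := C(K, E)) (G := C(K, F))
    (LinearMap.mk₂ ℝ (fun (A : C(K, E →L[ℝ] F)) (γ : C(K, E)) ↦
        (⟨fun t ↦ A t (γ t), A.continuous.clm_apply γ.continuous⟩ : C(K, F)))
      (fun _ _ _ ↦ by ext; simp) (fun _ _ _ ↦ by ext; simp) (fun _ _ _ ↦ by ext; simp)
      (fun _ _ _ ↦ by ext; simp)) 1 (by
    intro A γ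
    rw [one_mul, ContinuousMap.norm_le _ (by positivity)]
    intro t
    exact ((A t).le_opNorm _).trans
      (mul_le_mul (A.norm_coe_le_norm t) (γ.norm_coe_le_norm t) (norm_nonneg _)
        (norm_nonneg A)))

/-- Composition with a `C¹` map is differentiable on the space of continuous functions. -/
lemma ContinuousMap.hasFDerivAt_comp_left {E F : Type} [NormedAddCommGroup E] [NormedSpace ℝ E]
    [NormedAddCommGroup F] [NormedSpace ℝ F] (V : C(E, F)) (V' : C(E, E →L[ℝ] F))
    (h : ∀ x, HasFDerivAt V (V' x) x) (γ : C(K, E)) :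
    HasFDerivAt (fun γ : C(K, E) ↦ V.comp γ) (ContinuousMap.clmApply K E F (V'.comp γ)) γ := by
  refine HasFDerivAt.of_isLittleO (Asymptotics.IsLittleO.of_bound fun c hc ↦ ?_)
  have hK : IsCompact (Set.range γ) := isCompact_range γ.continuous
  -- Compactness of the image of `γ` gives one `δ` that serves for all `t`; the mean value
  -- inequality on balls of that radius then yields an estimate in the supremum norm.
  have hu := hK.uniformContinuousAt_of_continuousAt V' (fun a _ ↦ V'.continuous.continuousAt)
    (Metric.dist_mem_uniformity hc)
  obtain ⟨δ, hδ, hu⟩ := Metric.mem_uniformity_dist.1 hu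
  have key : ∀ γ' : C(K, E), dist γ' γ < δ →
      ‖V.comp γ' - V.comp γ - ContinuousMap.clmApply K E F (V'.comp γ) (γ' - γ)‖
        ≤ c * ‖γ' - γ‖ := by
    intro γ' hγ'
    rw [ContinuousMap.norm_le _ (by positivity)]
    intro t
    have h1 : γ' t ∈ Metric.ball (γ t) δ :=
      (ContinuousMap.dist_apply_le_dist t).trans_lt hγ'
    have h2 := (convex_ball (γ t) δ).norm_image_sub_le_of_norm_hasFDerivWithin_le'
      (f := V) (f' := V') (φ := V' (γ t)) (C := c)
      (fun x _ ↦ (h x).hasFDerivWithinAt) (fun x hx ↦ by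
        have := @hu (γ t) x (by rw [dist_comm]; exact hx) ⟨t, rfl⟩
        rw [← dist_eq_norm, dist_comm]; exact le_of_lt this) (Metric.mem_ball_self hδ) h1
    exact h2.trans (mul_le_mul_of_nonneg_left ((γ' - γ).norm_coe_le_norm t) hc.le)
  exact Metric.eventually_nhds_iff.2 ⟨δ, hδ, fun {γ'} h ↦ key γ' h⟩

/-- Composition with a smooth map is smooth on the space of continuous functions. -/
lemma ContinuousMap.contDiff_comp_left (n : ℕ) : ∀ {E F : Type} [NormedAddCommGroup E]
    [NormedSpace ℝ E] [NormedAddCommGroup F] [NormedSpace ℝ F] (V : C(E, F)),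
    ContDiff ℝ n V → ContDiff ℝ n (fun γ : C(K, E) ↦ V.comp γ) := by
  -- The derivative at `γ` is multiplication by `V' ∘ γ`, so it is a composition operator again,
  -- followed by the linear map `clmApply`. The target changes from `F` to `E →L[ℝ] F`, so the
  -- spaces are quantified inside the induction.
  induction n with
  | zero =>
    intro E F _ _ _ _ V _
    exact contDiff_zero.2 (ContinuousMap.continuous_postcomp V)
  | succ n ih =>
    intro E F _ _ _ _ V hV
    push_cast at hV ⊢
    obtain ⟨V', hV', hd⟩ := contDiff_succ_iff_hasFDerivAt.1 hV
    refine contDiff_succ_iff_hasFDerivAt.2 ⟨fun γ ↦ ContinuousMap.clmApply K E F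
      ((⟨V', hV'.continuous⟩ : C(E, E →L[ℝ] F)).comp γ), ?_, ?_⟩
    · exact (ContinuousMap.clmApply K E F).contDiff.comp (ih ⟨V', hV'.continuous⟩ hV')
    · exact ContinuousMap.hasFDerivAt_comp_left V ⟨V', hV'.continuous⟩ hd

end Nemytskii

/-- The inverse function theorem, with smoothness of the inverse on the whole target. -/
lemma exists_openPartialHomeomorph_of_contDiffOn {E F : Type} [NormedAddCommGroup E]
    [NormedSpace ℝ E] [CompleteSpace E] [NormedAddCommGroup F] [NormedSpace ℝ F]
    {f : E → F} {U : Set E} (hU : IsOpen U)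
    (hf : ContDiffOn ℝ ∞ f U) {a : E} (ha : a ∈ U) (f' : E ≃L[ℝ] F)
    (hf' : HasFDerivAt f (f' : E →L[ℝ] F) a) :
    ∃ e : OpenPartialHomeomorph E F, a ∈ e.source ∧ e.source ⊆ U ∧ (e : E → F) = f ∧
      ContDiffOn ℝ ∞ e.symm e.target := by
  have hfa : ContDiffAt ℝ ∞ f a := hf.contDiffAt (hU.mem_nhds ha)
  have hcont : ContinuousOn (fderiv ℝ f) U := (hf.fderiv_of_isOpen hU (m := 0) (by simp)).continuousOn
  -- The local inverse is smooth wherever the derivative is invertible. This is an open condition,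
  -- so restricting to it gives smoothness on the whole target and not only near `f a`.
  let W : Set E := U ∩ fderiv ℝ f ⁻¹' Set.range ((↑) : (E ≃L[ℝ] F) → E →L[ℝ] F)
  have hW : IsOpen W := hcont.isOpen_inter_preimage hU (ContinuousLinearEquiv.isOpen)
  have haW : a ∈ W := ⟨ha, ⟨f', hf'.fderiv.symm⟩⟩
  let e₀ := hfa.toOpenPartialHomeomorph f hf' (by simp)
  have he₀ : (e₀ : E → F) = f := hfa.toOpenPartialHomeomorph_coe hf' (by simp)
  let e := e₀.restrOpen W hW
  have hsrc : e.source = e₀.source ∩ W := e₀.restrOpen_source W hW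
  have hef : (e : E → F) = f := he₀
  refine ⟨e, ?_, ?_, he₀, ?_⟩
  · rw [hsrc]; exact ⟨hfa.mem_toOpenPartialHomeomorph_source hf' (by simp), haW⟩
  · rw [hsrc]; exact fun x hx ↦ hx.2.1
  · intro y hy
    have hx : e.symm y ∈ e.source := e.map_target hy
    have hx2 : e.symm y ∈ W := by rw [hsrc] at hx; exact hx.2
    obtain ⟨L, hL⟩ := hx2.2
    have hd : ContDiffAt ℝ ∞ f (e.symm y) := hf.contDiffAt (hU.mem_nhds hx2.1)
    refine (e.contDiffAt_symm hy (f₀' := L) ?_ ?_).contDiffWithinAt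
    · rw [hef, hL]; exact (hd.differentiableAt (by simp)).hasFDerivAt
    · rw [hef]; exact hd

/-! ### Flows from the inverse function theorem on path space. -/

section Flow

open Set Filter Topology

lemma neg_one_le_one_real : (-1 : ℝ) ≤ 1 := by norm_num

/-- The operator `γ ↦ ∫₀ᵗ γ` on continuous paths defined on `[-1, 1]`. -/
def pathIntegral (E : Type) [NormedAddCommGroup E] [NormedSpace ℝ E] :
    C(Icc (-1 : ℝ) 1, E) →L[ℝ] C(Icc (-1 : ℝ) 1, E) :=
  LinearMap.mkContinuous (E := C(Icc (-1 : ℝ) 1, E)) (F := C(Icc (-1 : ℝ) 1, E)) (σ := .id ℝ)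
    { toFun := fun γ ↦ ⟨fun t ↦ ∫ σ in (0 : ℝ)..t, IccExtend neg_one_le_one_real γ σ,
        (intervalIntegral.continuous_primitive
          (fun _ _ ↦ (γ.continuous.Icc_extend' (h := neg_one_le_one_real)).intervalIntegrable _ _) 0).comp
          continuous_subtype_val⟩
      map_add' := fun γ γ' ↦ by
        ext t
        exact intervalIntegral.integral_add (γ.continuous.Icc_extend'.intervalIntegrable _ _)
          (γ'.continuous.Icc_extend'.intervalIntegrable _ _)
      map_smul' := fun c γ ↦ by
        ext t
        exact intervalIntegral.integral_smul c _ } 1 (by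
    intro γ
    rw [one_mul, ContinuousMap.norm_le _ (norm_nonneg _)]
    intro t
    refine (intervalIntegral.norm_integral_le_of_norm_le_const
      (C := ‖γ‖) fun x _ ↦ γ.norm_coe_le_norm _).trans ?_
    have : |(t : ℝ) - 0| ≤ 1 := by rw [sub_zero]; exact abs_le.2 t.2
    nlinarith [norm_nonneg γ])

lemma pathIntegral_apply {E : Type} [NormedAddCommGroup E] [NormedSpace ℝ E]
    (γ : C(Icc (-1 : ℝ) 1, E)) (t : Icc (-1 : ℝ) 1) :
    pathIntegral E γ t = ∫ σ in (0 : ℝ)..t, IccExtend neg_one_le_one_real γ σ := rfl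

/-- Constant paths. -/
def constPath (E : Type) [NormedAddCommGroup E] [NormedSpace ℝ E] :
    E →L[ℝ] C(Icc (-1 : ℝ) 1, E) :=
  LinearMap.mkContinuous (E := E) (F := C(Icc (-1 : ℝ) 1, E)) (σ := .id ℝ)
    { toFun := fun x ↦ ContinuousMap.const _ x
      map_add' := fun _ _ ↦ rfl
      map_smul' := fun _ _ ↦ rfl } 1 (by
    intro x
    rw [one_mul, ContinuousMap.norm_le _ (norm_nonneg _)]
    exact fun _ ↦ le_rfl)

@[simp] lemma constPath_apply {E : Type} [NormedAddCommGroup E] [NormedSpace ℝ E]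
    (x : E) (t : Icc (-1 : ℝ) 1) : constPath E x t = x := rfl

/-- The path `t ↦ γ (t a)`. -/
def rescalePath {E : Type} [NormedAddCommGroup E] (γ : C(Icc (-1 : ℝ) 1, E))
    (a : Icc (-1 : ℝ) 1) : C(Icc (-1 : ℝ) 1, E) :=
  ⟨fun t ↦ IccExtend neg_one_le_one_real γ (t * a), (γ.continuous.Icc_extend' (h := neg_one_le_one_real)).comp
    (continuous_subtype_val.mul continuous_const)⟩

lemma IccExtend_rescalePath {E : Type} [NormedAddCommGroup E] (γ : C(Icc (-1 : ℝ) 1, E))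
    (a : Icc (-1 : ℝ) 1) {σ : ℝ} (hσ : σ ∈ Icc (-1 : ℝ) 1) :
    IccExtend neg_one_le_one_real (rescalePath γ a) σ = IccExtend neg_one_le_one_real γ (σ * a) := by
  rw [IccExtend_of_mem _ _ hσ]; rfl

/-- Substitution in the integral: a solution run at speed `a` solves the equation with parameter `s
a`. Negative `a` must be allowed, which is why paths live on `[-1, 1]`. -/
lemma rescalePath_solves {E : Type} [NormedAddCommGroup E] [NormedSpace ℝ E] [CompleteSpace E]
    (V : C(E, E)) {x : E} {s : ℝ} {γ : C(Icc (-1 : ℝ) 1, E)}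
    (h : γ = constPath E x + s • pathIntegral E (V.comp γ)) (a : Icc (-1 : ℝ) 1) :
    rescalePath γ a
      = constPath E x + (s * a) • pathIntegral E (V.comp (rescalePath γ a)) := by
  ext t
  have hta : (t : ℝ) * a ∈ Icc (-1 : ℝ) 1 := by
    rw [mem_Icc, ← abs_le, abs_mul]
    exact mul_le_one₀ (abs_le.2 t.2) (abs_nonneg _) (abs_le.2 a.2)
  have h1 : rescalePath γ a t = γ ⟨t * a, hta⟩ := IccExtend_of_mem _ _ hta
  rw [h1, h]
  simp only [ContinuousMap.add_apply, ContinuousMap.smul_apply, constPath_apply,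
    pathIntegral_apply]
  rw [← h, mul_smul]
  congr 2
  have h2 : ∫ σ in (0 : ℝ)..t, (a : ℝ) • IccExtend neg_one_le_one_real (V.comp (rescalePath γ a)) σ
      = ∫ σ in (0 : ℝ)..t, (a : ℝ) • IccExtend neg_one_le_one_real (V.comp γ) (σ * a) := by
    refine intervalIntegral.integral_congr fun σ hσ ↦ ?_
    have hσ' : σ ∈ Icc (-1 : ℝ) 1 := by
      refine (ordConnected_Icc.uIcc_subset ?_ t.2) hσ
      constructor <;> norm_num
    have e1 : ∀ (β : C(Icc (-1 : ℝ) 1, E)) (r : ℝ),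
        IccExtend neg_one_le_one_real (V.comp β) r = V (IccExtend neg_one_le_one_real β r) := fun _ _ ↦ rfl
    simp only [e1, IccExtend_rescalePath γ a hσ']
  rw [← intervalIntegral.integral_smul, h2,
    intervalIntegral.integral_smul, intervalIntegral.smul_integral_comp_mul_right, zero_mul]

/-- Smooth vector fields have smooth local flows. -/
theorem exists_smooth_local_flow {E : Type} [NormedAddCommGroup E] [NormedSpace ℝ E]
    [CompleteSpace E] {V : E → E} (hV : ContDiff ℝ ∞ V) (x₀ : E) :
    ∃ δ > 0, ∃ Φ : ℝ × E → E, ContDiffOn ℝ ∞ Φ (Ioo (-δ) δ ×ˢ Metric.ball x₀ δ) ∧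
      (∀ x ∈ Metric.ball x₀ δ, Φ (0, x) = x) ∧
      ∀ s ∈ Ioo (-δ) δ, ∀ x ∈ Metric.ball x₀ δ,
        HasDerivAt (fun s ↦ Φ (s, x)) (V (Φ (s, x))) s := by
  -- The path equation `γ = x + s ∫₀ᵗ V(γ)` means `γ' = s V(γ)`, so `γ t` is the flow of `x` at time
  -- `s t`. For `s = 0` its solution is constant and its linearization in `γ` is the identity. The
  -- inverse function theorem for `H` therefore solves it smoothly in `(x, s)`.
  let Vc : C(E, E) := ⟨V, hV.continuous⟩
  let X := C(Icc (-1 : ℝ) 1, E)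
  let N : X → X := fun γ ↦ pathIntegral E (Vc.comp γ)
  have hN : ContDiff ℝ ∞ N := (pathIntegral E).contDiff.comp
    (contDiff_infty.2 fun n ↦ ContinuousMap.contDiff_comp_left n Vc (contDiff_infty.1 hV n))
  let H : (E × ℝ) × X → (E × ℝ) × X := fun z ↦
    (z.1, z.2 + -(constPath E z.1.1 + z.1.2 • N z.2))
  have hH : ContDiff ℝ ∞ H := by
    refine contDiff_fst.prodMk (contDiff_snd.add (ContDiff.neg (ContDiff.add ?_ ?_)))
    · exact (constPath E).contDiff.comp (contDiff_fst.comp contDiff_fst)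
    · exact (contDiff_snd.comp contDiff_fst).smul (hN.comp contDiff_snd)
  let c : X := constPath E x₀
  let A : E × ℝ →L[ℝ] X := (constPath E).comp (.fst ℝ E ℝ)
    + (ContinuousLinearMap.snd ℝ E ℝ).smulRight (N c)
  -- The derivative is triangular with identity diagonal blocks, since `s = 0` annihilates the
  -- derivative of `N`.
  let H' : ((E × ℝ) × X) ≃L[ℝ] ((E × ℝ) × X) :=
    (ContinuousLinearEquiv.refl ℝ (E × ℝ)).skewProd (ContinuousLinearEquiv.refl ℝ X) (-A)
  have hH' : HasFDerivAt H (H' : ((E × ℝ) × X) →L[ℝ] ((E × ℝ) × X)) ((x₀, 0), c) := by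
    have d1 : HasFDerivAt (fun z : (E × ℝ) × X ↦ z.1.2)
        ((ContinuousLinearMap.snd ℝ E ℝ).comp (.fst ℝ (E × ℝ) X)) ((x₀, 0), c) :=
      ((ContinuousLinearMap.snd ℝ E ℝ).comp (.fst ℝ (E × ℝ) X)).hasFDerivAt
    have d2 : HasFDerivAt (fun z : (E × ℝ) × X ↦ N z.2)
        ((fderiv ℝ N c).comp (.snd ℝ (E × ℝ) X)) ((x₀, 0), c) :=
      HasFDerivAt.comp (g := N) (f := Prod.snd) ((x₀, 0), c)
        ((hN.differentiable (by simp)) c).hasFDerivAt hasFDerivAt_snd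
    have d3 : HasFDerivAt (fun z : (E × ℝ) × X ↦ constPath E z.1.1)
        ((constPath E).comp ((ContinuousLinearMap.fst ℝ E ℝ).comp (.fst ℝ (E × ℝ) X)))
        ((x₀, 0), c) :=
      ((constPath E).comp ((ContinuousLinearMap.fst ℝ E ℝ).comp (.fst ℝ (E × ℝ) X))).hasFDerivAt
    have d := (hasFDerivAt_fst (𝕜 := ℝ) (p := ((x₀, (0 : ℝ)), c))).prodMk
      ((hasFDerivAt_snd (𝕜 := ℝ) (p := ((x₀, (0 : ℝ)), c))).add (d3.add (d1.smul d2)).neg)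
    refine d.congr_fderiv ?_
    ext z <;> simp [H', A]
  obtain ⟨e, he, -, heH, hes⟩ := exists_openPartialHomeomorph_of_contDiffOn isOpen_univ
    hH.contDiffOn (mem_univ _) H' hH'
  have hHc : H ((x₀, 0), c) = ((x₀, 0), 0) := by simp [H, c]
  have hmem : ((x₀, (0 : ℝ)), (0 : X)) ∈ e.target := by
    rw [← hHc, ← heH]; exact e.map_source he
  let ι : E × ℝ → (E × ℝ) × X := fun p ↦ (p, 0)
  have hι : ContDiff ℝ ∞ ι := contDiff_id.prodMk contDiff_const
  let W : Set (E × ℝ) := ι ⁻¹' e.target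
  have hW : IsOpen W := e.open_target.preimage hι.continuous
  let sol : E × ℝ → X := fun p ↦ (e.symm (ι p)).2
  have hsol : ContDiffOn ℝ ∞ sol W :=
    contDiff_snd.comp_contDiffOn (hes.comp hι.contDiffOn fun _ h ↦ h)
  have hsolve : ∀ p ∈ W, sol p = constPath E p.1 + p.2 • N (sol p) := by
    intro p hp
    have h1 : H (e.symm (ι p)) = ι p := by rw [← heH]; exact e.right_inv hp
    have h2 : (e.symm (ι p)).1 = p := congrArg Prod.fst h1
    have h3 : sol p + -(constPath E (e.symm (ι p)).1.1 + (e.symm (ι p)).1.2 • N (sol p)) = 0 :=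
      congrArg Prod.snd h1
    rw [h2] at h3
    exact add_neg_eq_zero.1 h3
  -- Injectivity on the source of `e`: any solution close enough to the constant path is the one
  -- already found.
  have hunique : ∀ (p : E × ℝ) (γ : X), (p, γ) ∈ e.source →
      γ = constPath E p.1 + p.2 • N γ → γ = sol p := by
    intro p γ hp hγ
    have h1 : e (p, γ) = ι p := by
      rw [heH]
      exact Prod.ext rfl (add_neg_eq_zero.2 hγ)
    have h2 : e.symm (ι p) = (p, γ) := by rw [← h1]; exact e.left_inv hp
    simp only [sol, h2]
  have hsol₀ : sol (x₀, 0) = c := by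
    have := hsolve (x₀, 0) hmem
    simpa using this
  obtain ⟨r, hr, hrs⟩ := Metric.isOpen_iff.1 e.open_source _ he
  have hev : ∀ᶠ p in 𝓝 (x₀, (0 : ℝ)), p ∈ W ∧ dist (sol p) c < r := by
    have hWn : ∀ᶠ p in 𝓝 (x₀, (0 : ℝ)), p ∈ W := hW.mem_nhds hmem
    refine hWn.and ?_
    have := (hsol.continuousOn.continuousAt (hW.mem_nhds hmem)).tendsto
    rw [hsol₀] at this
    exact this.eventually (Metric.ball_mem_nhds c hr)
  obtain ⟨δ₀, hδ₀, hδW⟩ := Metric.eventually_nhds_iff.1 hev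
  let δ := min δ₀ r
  have hδ : 0 < δ := lt_min hδ₀ hr
  have hnear : ∀ x ∈ Metric.ball x₀ δ, ∀ s ∈ Ioo (-δ) δ, (x, s) ∈ W ∧ dist (sol (x, s)) c < r := by
    intro x hx s hs
    refine hδW (max_lt (lt_of_lt_of_le hx (min_le_left _ _)) ?_)
    rw [Real.dist_eq, sub_zero]
    exact lt_of_lt_of_le (abs_lt.2 hs) (min_le_left _ _)
  -- By uniqueness applied to the rescaled path, the point at `a` of the path with parameter `s` is
  -- the endpoint of the path with parameter `s a`.
  have hscale : ∀ x ∈ Metric.ball x₀ δ, ∀ s ∈ Ioo (-δ) δ, ∀ a : Icc (-1 : ℝ) 1,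
      sol (x, s) a = sol (x, s * a) ⟨1, by norm_num, le_rfl⟩ := by
    intro x hx s hs a
    obtain ⟨hw, hd⟩ := hnear x hx s hs
    have hsa : |s * a| < δ := by
      rw [abs_mul]
      exact (mul_le_of_le_one_right (abs_nonneg _) (abs_le.2 a.2)).trans_lt (abs_lt.2 hs)
    have h1 := rescalePath_solves Vc (hsolve (x, s) hw) a
    have h2 : dist (rescalePath (sol (x, s)) a) c < r :=
      lt_of_le_of_lt ((ContinuousMap.dist_le dist_nonneg).2 fun t ↦
        ContinuousMap.dist_apply_le_dist (f := sol (x, s)) (g := c)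
          (projIcc (-1) 1 neg_one_le_one_real (t * a))) hd
    have h3 : ((x, s * (a : ℝ)), rescalePath (sol (x, s)) a) ∈ e.source := by
      refine hrs ?_
      rw [Metric.mem_ball, Prod.dist_eq, Prod.dist_eq]
      refine max_lt (max_lt (lt_of_lt_of_le hx (min_le_right _ _)) ?_) h2
      rw [Real.dist_eq, sub_zero]
      exact lt_of_lt_of_le hsa (min_le_right _ _)
    rw [← hunique (x, s * a) _ h3 h1]
    change sol (x, s) a = IccExtend neg_one_le_one_real (sol (x, s)) (1 * a)
    rw [one_mul, IccExtend_val]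
  -- The flow at time `s` is the endpoint, at `t = 1`, of the path with parameter `s`.
  let ev : X →L[ℝ] E := ContinuousMap.evalCLM ℝ ⟨1, by norm_num, le_rfl⟩
  refine ⟨δ, hδ, fun p ↦ ev (sol (p.2, p.1)), ?_, ?_, ?_⟩
  · refine ev.contDiff.comp_contDiffOn (hsol.comp (contDiff_snd.prodMk contDiff_fst).contDiffOn ?_)
    rintro ⟨s, x⟩ ⟨hs, hx⟩
    exact (hnear x hx s hs).1
  · intro x hx
    have h0 : (0 : ℝ) ∈ Ioo (-δ) δ := by constructor <;> linarith
    have := hsolve (x, 0) (hnear x hx 0 h0).1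
    simp only [zero_smul, add_zero] at this
    change ev (sol (x, 0)) = x
    rw [this]; rfl
  · intro s hs x hx
    -- For `s'` near `s` the endpoints all lie on one path, that with parameter `s₀ > |s|`, at the
    -- positions `s' / s₀`. Its integral equation is then differentiated by the fundamental theorem
    -- of calculus.
    obtain ⟨s₀, hs₀, hs₀δ⟩ := exists_between (abs_lt.2 hs)
    have hs₀pos : 0 < s₀ := (abs_nonneg s).trans_lt hs₀
    have hs₀' : s₀ ∈ Ioo (-δ) δ := ⟨by linarith, hs₀δ⟩
    have hquot : ∀ s' : ℝ, |s'| < s₀ → s' / s₀ ∈ Icc (-1 : ℝ) 1 := by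
      intro s' h
      rw [mem_Icc, ← abs_le, abs_div, abs_of_pos hs₀pos]
      exact (div_le_one hs₀pos).2 h.le
    have hval : ∀ s' : ℝ, |s'| < s₀ →
        ev (sol (x, s')) = IccExtend neg_one_le_one_real (sol (x, s₀)) (s' / s₀) := by
      intro s' h
      rw [IccExtend_of_mem _ _ (hquot s' h), hscale x hx s₀ hs₀' ⟨_, hquot s' h⟩]
      rw [mul_div_cancel₀ _ hs₀pos.ne']; rfl
    have hval2 : ∀ s' : ℝ, |s'| < s₀ → ev (sol (x, s'))
        = x + s₀ • ∫ σ in (0 : ℝ)..(s' / s₀), IccExtend neg_one_le_one_real (Vc.comp (sol (x, s₀))) σ := by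
      intro s' h
      rw [hval s' h, IccExtend_of_mem _ _ (hquot s' h)]
      exact DFunLike.congr_fun (hsolve (x, s₀) (hnear x hx s₀ hs₀').1) ⟨_, hquot s' h⟩
    have hcts : Continuous (IccExtend neg_one_le_one_real (Vc.comp (sol (x, s₀)))) :=
      (Vc.comp (sol (x, s₀))).continuous.Icc_extend'
    have hder := (intervalIntegral.integral_hasDerivAt_right (hcts.intervalIntegrable 0 (s / s₀))
      (hcts.stronglyMeasurableAtFilter _ _) hcts.continuousAt).scomp s ((hasDerivAt_id s).div_const s₀)
    have hder2 := (hder.const_smul s₀).const_add x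
    have hnb : ∀ᶠ s' in 𝓝 s, |s'| < s₀ := continuous_abs.continuousAt.eventually_lt
      continuousAt_const hs₀
    refine (hder2.congr_of_eventuallyEq (hnb.mono fun s' h ↦ hval2 s' h)).congr_deriv ?_
    rw [smul_smul, mul_one_div_cancel hs₀pos.ne', one_smul]
    change V (IccExtend neg_one_le_one_real (sol (x, s₀)) (s / s₀)) = V (ev (sol (x, s)))
    rw [hval s hs₀]

end Flow

/-! ### Levi-Civita calculus in coordinates and its behaviour under coordinate changes -/

namespace Coord

open Set

variable {m : ℕ}

/-- `G` is a smooth Riemannian metric on the open set `W`. -/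
structure IsMetricOn (G : Euc m → Euc m →L[ℝ] Euc m →L[ℝ] ℝ) (W : Set (Euc m)) : Prop where
  isOpen : IsOpen W
  smooth : ContDiffOn ℝ ∞ G W
  symm : ∀ y ∈ W, ∀ u v, G y u v = G y v u
  pos : ∀ y ∈ W, ∀ v, v ≠ 0 → 0 < G y v v

/-! ### Smooth dependence of Christoffel symbols on the metric. -/

section Koszul

variable {E : Type} [NormedAddCommGroup E] [NormedSpace ℝ E]

/-- The operator turning the derivative of a metric into the Christoffel symbols of the first
kind. -/
def koszul (E : Type) [NormedAddCommGroup E] [NormedSpace ℝ E] :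
    (E →L[ℝ] E →L[ℝ] E →L[ℝ] ℝ) →L[ℝ] (E →L[ℝ] E →L[ℝ] E →L[ℝ] ℝ) :=
  let F : (E →L[ℝ] E →L[ℝ] E →L[ℝ] ℝ) →L[ℝ] (E →L[ℝ] E →L[ℝ] E →L[ℝ] ℝ) :=
    (ContinuousLinearMap.flipₗᵢ ℝ E E (E →L[ℝ] ℝ)).toContinuousLinearEquiv
  let P : (E →L[ℝ] E →L[ℝ] E →L[ℝ] ℝ) →L[ℝ] (E →L[ℝ] E →L[ℝ] E →L[ℝ] ℝ) :=
    ContinuousLinearMap.compL ℝ E (E →L[ℝ] E →L[ℝ] ℝ) (E →L[ℝ] E →L[ℝ] ℝ)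
      ((ContinuousLinearMap.flipₗᵢ ℝ E E ℝ).toContinuousLinearEquiv :
        (E →L[ℝ] E →L[ℝ] ℝ) →L[ℝ] (E →L[ℝ] E →L[ℝ] ℝ))
  (1 / 2 : ℝ) • (ContinuousLinearMap.id ℝ _ + F - P.comp F)

lemma koszul_apply (T : E →L[ℝ] E →L[ℝ] E →L[ℝ] ℝ) (u v w : E) :
    koszul E T u v w = (1 / 2 : ℝ) * (T u v w + T v u w - T w u v) := by
  simp [koszul]

/-- Raising the last index of a trilinear form by means of a bilinear form. -/
def raise (B : E →L[ℝ] E →L[ℝ] ℝ) (T : E →L[ℝ] E →L[ℝ] E →L[ℝ] ℝ) : E →L[ℝ] E →L[ℝ] E :=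
  (ContinuousLinearMap.compL ℝ E (E →L[ℝ] ℝ) E B.inverse).comp T

lemma raise_apply (B : E →L[ℝ] E →L[ℝ] ℝ) (T : E →L[ℝ] E →L[ℝ] E →L[ℝ] ℝ) (u v : E) :
    raise B T u v = B.inverse (T u v) := rfl

/-- Inversion of operators is smooth at invertible ones, and `e` witnesses that `G y` is invertible.
-/
lemma contDiffAt_raise_koszul [CompleteSpace E] {G : E → E →L[ℝ] E →L[ℝ] ℝ} {y : E}
    (hG : ContDiffAt ℝ ∞ G y)
    (e : E ≃L[ℝ] (E →L[ℝ] ℝ)) (he : (e : E →L[ℝ] E →L[ℝ] ℝ) = G y) :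
    ContDiffAt ℝ ∞ (fun z ↦ raise (G z) (koszul E (fderiv ℝ G z))) y := by
  have h1 : ContDiffAt ℝ ∞ (fun z ↦ (G z).inverse) y := by
    refine ContDiffAt.comp y (g := ContinuousLinearMap.inverse) ?_ hG
    rw [← he]
    exact contDiffAt_map_inverse e
  have h2 : ContDiffAt ℝ ∞ (fun z ↦ koszul E (fderiv ℝ G z)) y :=
    (koszul E).contDiff.contDiffAt.comp y (hG.fderiv_right (by simp))
  have h3 : ContDiffAt ℝ ∞ (fun z ↦ ContinuousLinearMap.compL ℝ E (E →L[ℝ] ℝ) E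
      (G z).inverse) y :=
    (ContinuousLinearMap.compL ℝ E (E →L[ℝ] ℝ) E).contDiff.contDiffAt.comp y h1
  exact h3.clm_comp h2

end Koszul

lemma christoffelFirst_apply (G : Euc m → Euc m →L[ℝ] Euc m →L[ℝ] ℝ) (y u v w : Euc m) :
    christoffelFirst G y u v w
      = (1 / 2 : ℝ) * (fderiv ℝ G y u v w + fderiv ℝ G y v u w - fderiv ℝ G y w u v) := by
  simp [christoffelFirst]

/-- The Christoffel symbols as a continuous bilinear map. -/
def christoffelBilin (G : Euc m → Euc m →L[ℝ] Euc m →L[ℝ] ℝ) (y : Euc m) :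
    Euc m →L[ℝ] Euc m →L[ℝ] Euc m :=
  raise (G y) (koszul (Euc m) (fderiv ℝ G y))

lemma christoffelBilin_apply (G : Euc m → Euc m →L[ℝ] Euc m →L[ℝ] ℝ) (y u v : Euc m) :
    christoffelBilin G y u v = christoffel G y u v := by
  rw [christoffelBilin, raise_apply, christoffel]
  refine congrArg _ (ContinuousLinearMap.ext fun w ↦ ?_)
  rw [koszul_apply, christoffelFirst_apply]

/-- A positive definite form on `ℝ^m` as an isomorphism onto the dual space. -/
lemma exists_equiv_of_pos {B : Euc m →L[ℝ] Euc m →L[ℝ] ℝ} (hB : ∀ v, v ≠ 0 → 0 < B v v) :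
    ∃ e : Euc m ≃L[ℝ] (Euc m →L[ℝ] ℝ), (e : Euc m →L[ℝ] Euc m →L[ℝ] ℝ) = B := by
  have hinj : Function.Injective (B : Euc m →ₗ[ℝ] (Euc m →L[ℝ] ℝ)) := by
    refine (injective_iff_map_eq_zero _).2 fun v hv ↦ ?_
    by_contra hne
    have := hB v hne
    have h0 : B v = 0 := hv
    simp [h0] at this
  have hdim : Module.finrank ℝ (Euc m) = Module.finrank ℝ (Euc m →L[ℝ] ℝ) :=
    (InnerProductSpace.toDual ℝ (Euc m)).toLinearEquiv.finrank_eq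
  refine ⟨(LinearEquiv.ofInjectiveOfFinrankEq _ hinj hdim).toContinuousLinearEquiv, ?_⟩
  ext v w
  rfl

namespace IsMetricOn

variable {G : Euc m → Euc m →L[ℝ] Euc m →L[ℝ] ℝ} {W : Set (Euc m)}

lemma differentiableAt (hG : IsMetricOn G W) {y : Euc m} (hy : y ∈ W) : DifferentiableAt ℝ G y :=
  (hG.smooth.contDiffAt (hG.isOpen.mem_nhds hy)).differentiableAt (by simp)

/-- Nondegeneracy replaces the inverse metric by a test against all vectors. Christoffel symbols are
later found by guessing `X` and checking this identity. -/
lemma christoffel_eq_iff (hG : IsMetricOn G W) {y : Euc m} (hy : y ∈ W) (u v X : Euc m) :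
    christoffel G y u v = X ↔ ∀ w, G y X w = christoffelFirst G y u v w := by
  obtain ⟨e, he⟩ := exists_equiv_of_pos (hG.pos y hy)
  rw [christoffel, ← he, ContinuousLinearMap.inverse_equiv]
  change e.symm _ = X ↔ _
  rw [ContinuousLinearEquiv.symm_apply_eq, eq_comm]
  exact ContinuousLinearMap.ext_iff

lemma contDiffOn_christoffelBilin (hG : IsMetricOn G W) :
    ContDiffOn ℝ ∞ (christoffelBilin G) W := by
  intro y hy
  have hGy := hG.smooth.contDiffAt (hG.isOpen.mem_nhds hy)
  obtain ⟨e, he⟩ := exists_equiv_of_pos (hG.pos y hy)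
  exact (contDiffAt_raise_koszul hGy e he).contDiffWithinAt

lemma differentiableAt_christoffelBilin (hG : IsMetricOn G W) {y : Euc m} (hy : y ∈ W) :
    DifferentiableAt ℝ (christoffelBilin G) y :=
  (hG.contDiffOn_christoffelBilin.contDiffAt (hG.isOpen.mem_nhds hy)).differentiableAt (by simp)

/-- Differentiating the whole bilinear field, instead of its values on fixed vectors, makes
linearity visible and lets the chain rule act. -/
lemma curvature_eq (hG : IsMetricOn G W) {y : Euc m} (hy : y ∈ W) (u v w : Euc m) :
    curvature G y u v w
      = (fderiv ℝ (christoffelBilin G) y u v w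
          + christoffelBilin G y u (christoffelBilin G y v w))
        - (fderiv ℝ (christoffelBilin G) y v u w
          + christoffelBilin G y v (christoffelBilin G y u w)) := by
  have key : ∀ a b c : Euc m, fderiv ℝ (fun z ↦ christoffel G z a b) y c
      = fderiv ℝ (christoffelBilin G) y c a b := by
    intro a b c
    have h := ((hG.differentiableAt_christoffelBilin hy).hasFDerivAt.clm_apply
      (hasFDerivAt_const a y)).clm_apply (hasFDerivAt_const b y)
    simp only [christoffelBilin_apply] at h
    rw [h.fderiv]
    simp
  simp only [curvature, key, christoffelBilin_apply]

lemma christoffelFirst_symm (hG : IsMetricOn G W) {y : Euc m} (hy : y ∈ W) (u v : Euc m) :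
    christoffelFirst G y u v = christoffelFirst G y v u := by
  have hs : ∀ a b c : Euc m, fderiv ℝ G y c a b = fderiv ℝ G y c b a := by
    intro a b c
    have h1 := ((hG.differentiableAt hy).hasFDerivAt.clm_apply
      (hasFDerivAt_const a y)).clm_apply (hasFDerivAt_const b y)
    have h2 := ((hG.differentiableAt hy).hasFDerivAt.clm_apply
      (hasFDerivAt_const b y)).clm_apply (hasFDerivAt_const a y)
    have h3 := h2.congr_of_eventuallyEq (f₁ := fun z ↦ G z a b)
      (Filter.eventually_of_mem (hG.isOpen.mem_nhds hy) fun z hz ↦ hG.symm z hz a b)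
    have := congrArg (fun L ↦ L c) (h1.unique h3)
    simpa using this
  ext w
  rw [christoffelFirst_apply, christoffelFirst_apply, hs u v w]
  ring

lemma christoffel_symm (hG : IsMetricOn G W) {y : Euc m} (hy : y ∈ W) (u v : Euc m) :
    christoffel G y u v = christoffel G y v u := by
  rw [christoffel, christoffel, hG.christoffelFirst_symm hy]

end IsMetricOn

/-- The Ricci curvature as the trace of the endomorphism `u ↦ R(u, v)w`. -/
lemma ricci_eq_trace (G : Euc m → Euc m →L[ℝ] Euc m →L[ℝ] ℝ) (y v w : Euc m)
    (L : Euc m →ₗ[ℝ] Euc m) (hL : ∀ u, L u = curvature G y u v w) :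
    ricci G y v w = LinearMap.trace ℝ _ L := by
  rw [LinearMap.trace_eq_matrix_trace ℝ (EuclideanSpace.basisFun (Fin m) ℝ).toBasis,
    Matrix.trace, ricci]
  refine Finset.sum_congr rfl fun i _ ↦ ?_
  rw [Matrix.diag_apply, LinearMap.toMatrix_apply, ← hL]
  simp

/-! ### Derivatives of tensor fields related by a map. -/

section Derivatives

variable {E : Type} [NormedAddCommGroup E] [NormedSpace ℝ E] {Ψ : E → E} {W : Set E}

lemma two_le_infty : minSmoothness ℝ 2 ≤ (∞ : WithTop ℕ∞) := by
  simp only [minSmoothness_of_isRCLikeNormedField]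
  exact ENat.LEInfty.out

/-- The second derivative of a smooth map is symmetric. -/
lemma fderiv_fderiv_symm (hW : IsOpen W) (hΨ : ContDiffOn ℝ ∞ Ψ W) {y : E} (hy : y ∈ W)
    (u v : E) : fderiv ℝ (fderiv ℝ Ψ) y u v = fderiv ℝ (fderiv ℝ Ψ) y v u :=
  (hΨ.contDiffAt (hW.mem_nhds hy)).isSymmSndFDerivAt two_le_infty u v

lemma hasFDerivAt_fderiv_apply (hW : IsOpen W) (hΨ : ContDiffOn ℝ ∞ Ψ W) {y : E} (hy : y ∈ W)
    (u : E) :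
    HasFDerivAt (fun z ↦ fderiv ℝ Ψ z u) ((fderiv ℝ (fderiv ℝ Ψ) y).flip u) y := by
  have h : DifferentiableAt ℝ (fderiv ℝ Ψ) y :=
    ((hΨ.contDiffAt (hW.mem_nhds hy)).fderiv_right (m := ∞) (by simp)).differentiableAt (by simp)
  refine (h.hasFDerivAt.clm_apply (hasFDerivAt_const u y)).congr_fderiv ?_
  ext w
  simp

lemma hasFDerivAt_of_contDiffOn (hW : IsOpen W) (hΨ : ContDiffOn ℝ ∞ Ψ W) {y : E}
    (hy : y ∈ W) : HasFDerivAt Ψ (fderiv ℝ Ψ y) y :=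
  ((hΨ.contDiffAt (hW.mem_nhds hy)).differentiableAt (by simp)).hasFDerivAt

/-- The pullback relation is differentiated along `w` in two ways, and uniqueness of the derivative
compares the results. The terms with second derivatives of `Ψ` are those that a tensorial
combination has to cancel. -/
lemma fderiv_bilin_change (hW : IsOpen W) (hΨ : ContDiffOn ℝ ∞ Ψ W) {y : E} (hy : y ∈ W)
    {G G' : E → E →L[ℝ] E →L[ℝ] ℝ} (hG : DifferentiableAt ℝ G y)
    (hG' : DifferentiableAt ℝ G' (Ψ y))
    (h : ∀ z ∈ W, ∀ u v, G z u v = G' (Ψ z) (fderiv ℝ Ψ z u) (fderiv ℝ Ψ z v)) (u v w : E) :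
    fderiv ℝ G y w u v
      = fderiv ℝ G' (Ψ y) (fderiv ℝ Ψ y w) (fderiv ℝ Ψ y u) (fderiv ℝ Ψ y v)
        + G' (Ψ y) (fderiv ℝ (fderiv ℝ Ψ) y w u) (fderiv ℝ Ψ y v)
        + G' (Ψ y) (fderiv ℝ Ψ y u) (fderiv ℝ (fderiv ℝ Ψ) y w v) := by
  have h1 := (hG.hasFDerivAt.clm_apply (hasFDerivAt_const u y)).clm_apply (hasFDerivAt_const v y)
  have h2 := (((hG'.hasFDerivAt.comp y (hasFDerivAt_of_contDiffOn hW hΨ hy)).clm_apply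
    (hasFDerivAt_fderiv_apply hW hΨ hy u)).clm_apply (hasFDerivAt_fderiv_apply hW hΨ hy v))
  have h3 := h2.congr_of_eventuallyEq (f₁ := fun z ↦ G z u v)
      (Filter.eventually_of_mem (hW.mem_nhds hy) fun z hz ↦ h z hz u v)
  have := congrArg (fun L ↦ L w) (h1.unique h3)
  simp at this
  rw [this]
  ring

lemma fderiv_form_change (hW : IsOpen W) (hΨ : ContDiffOn ℝ ∞ Ψ W) {y : E} (hy : y ∈ W)
    {α α' : E → E →L[ℝ] ℝ} (hα : DifferentiableAt ℝ α y)
    (hα' : DifferentiableAt ℝ α' (Ψ y))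
    (h : ∀ z ∈ W, ∀ u, α z u = α' (Ψ z) (fderiv ℝ Ψ z u)) (u w : E) :
    fderiv ℝ α y w u
      = fderiv ℝ α' (Ψ y) (fderiv ℝ Ψ y w) (fderiv ℝ Ψ y u)
        + α' (Ψ y) (fderiv ℝ (fderiv ℝ Ψ) y w u) := by
  have h1 := hα.hasFDerivAt.clm_apply (hasFDerivAt_const u y)
  have h2 := (hα'.hasFDerivAt.comp y (hasFDerivAt_of_contDiffOn hW hΨ hy)).clm_apply
    (hasFDerivAt_fderiv_apply hW hΨ hy u)
  have h3 := h2.congr_of_eventuallyEq (f₁ := fun z ↦ α z u)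
      (Filter.eventually_of_mem (hW.mem_nhds hy) fun z hz ↦ h z hz u)
  have := congrArg (fun L ↦ L w) (h1.unique h3)
  simp at this
  rw [this]
  ring

lemma fderiv_vec_change (hW : IsOpen W) (hΨ : ContDiffOn ℝ ∞ Ψ W) {y : E} (hy : y ∈ W)
    {V V' : E → E} (hV : DifferentiableAt ℝ V y)
    (hV' : DifferentiableAt ℝ V' (Ψ y)) (h : ∀ z ∈ W, fderiv ℝ Ψ z (V z) = V' (Ψ z)) (w : E) :
    fderiv ℝ (fderiv ℝ Ψ) y w (V y) + fderiv ℝ Ψ y (fderiv ℝ V y w)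
      = fderiv ℝ V' (Ψ y) (fderiv ℝ Ψ y w) := by
  have hD : DifferentiableAt ℝ (fderiv ℝ Ψ) y :=
    ((hΨ.contDiffAt (hW.mem_nhds hy)).fderiv_right (m := ∞) (by simp)).differentiableAt (by simp)
  have h1 := hD.hasFDerivAt.clm_apply hV.hasFDerivAt
  have h2 := hV'.hasFDerivAt.comp y (hasFDerivAt_of_contDiffOn hW hΨ hy)
  have h3 := h2.congr_of_eventuallyEq (f₁ := fun z ↦ fderiv ℝ Ψ z (V z))
      (Filter.eventually_of_mem (hW.mem_nhds hy) fun z hz ↦ h z hz)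
  have := congrArg (fun L ↦ L w) (h1.unique h3)
  simp at this
  rw [← this]
  abel

lemma fderiv_endo_change (hW : IsOpen W) (hΨ : ContDiffOn ℝ ∞ Ψ W) {y : E} (hy : y ∈ W)
    {A A' : E → E →L[ℝ] E} (hA : DifferentiableAt ℝ A y)
    (hA' : DifferentiableAt ℝ A' (Ψ y))
    (h : ∀ z ∈ W, ∀ u, fderiv ℝ Ψ z (A z u) = A' (Ψ z) (fderiv ℝ Ψ z u)) (u w : E) :
    fderiv ℝ (fderiv ℝ Ψ) y w (A y u) + fderiv ℝ Ψ y (fderiv ℝ A y w u)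
      = fderiv ℝ A' (Ψ y) (fderiv ℝ Ψ y w) (fderiv ℝ Ψ y u)
        + A' (Ψ y) (fderiv ℝ (fderiv ℝ Ψ) y w u) := by
  have hD : DifferentiableAt ℝ (fderiv ℝ Ψ) y :=
    ((hΨ.contDiffAt (hW.mem_nhds hy)).fderiv_right (m := ∞) (by simp)).differentiableAt (by simp)
  have h1 := hD.hasFDerivAt.clm_apply (hA.hasFDerivAt.clm_apply (hasFDerivAt_const u y))
  have h2 := (hA'.hasFDerivAt.comp y (hasFDerivAt_of_contDiffOn hW hΨ hy)).clm_apply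
    (hasFDerivAt_fderiv_apply hW hΨ hy u)
  have h3 := h2.congr_of_eventuallyEq (f₁ := fun z ↦ fderiv ℝ Ψ z (A z u))
      (Filter.eventually_of_mem (hW.mem_nhds hy) fun z hz ↦ h z hz u)
  have := congrArg (fun L ↦ L w) (h1.unique h3)
  simp at this
  rw [add_comm, this, add_comm]

end Derivatives

/-! ### Tensoriality under coordinate changes. -/

section Change

variable {Ψ : Euc m → Euc m} {W : Set (Euc m)}

lemma dOne_change (hW : IsOpen W) (hΨ : ContDiffOn ℝ ∞ Ψ W) {y : Euc m} (hy : y ∈ W)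
    {α α' : Euc m → Euc m →L[ℝ] ℝ} (hα : DifferentiableAt ℝ α y)
    (hα' : DifferentiableAt ℝ α' (Ψ y))
    (h : ∀ z ∈ W, ∀ u, α z u = α' (Ψ z) (fderiv ℝ Ψ z u)) (u v : Euc m) :
    dOne α y u v = dOne α' (Ψ y) (fderiv ℝ Ψ y u) (fderiv ℝ Ψ y v) := by
  rw [dOne, dOne, fderiv_form_change hW hΨ hy hα hα' h, fderiv_form_change hW hΨ hy hα hα' h,
    fderiv_fderiv_symm hW hΨ hy u v]
  ring

/-- The six terms with second derivatives of `Ψ` cancel in pairs, by their symmetry and the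
antisymmetry of `G'`. -/
lemma dTwo_change (hW : IsOpen W) (hΨ : ContDiffOn ℝ ∞ Ψ W) {y : Euc m} (hy : y ∈ W)
    {G G' : Euc m → Euc m →L[ℝ] Euc m →L[ℝ] ℝ} (hG : DifferentiableAt ℝ G y)
    (hG' : DifferentiableAt ℝ G' (Ψ y)) (hanti : ∀ u v, G' (Ψ y) u v = -G' (Ψ y) v u)
    (h : ∀ z ∈ W, ∀ u v, G z u v = G' (Ψ z) (fderiv ℝ Ψ z u) (fderiv ℝ Ψ z v)) (u v w : Euc m) :
    dTwo G y u v w = dTwo G' (Ψ y) (fderiv ℝ Ψ y u) (fderiv ℝ Ψ y v) (fderiv ℝ Ψ y w) := by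
  simp only [dTwo, fderiv_bilin_change hW hΨ hy hG hG' h]
  rw [fderiv_fderiv_symm hW hΨ hy u v, fderiv_fderiv_symm hW hΨ hy v w,
    fderiv_fderiv_symm hW hΨ hy u w, hanti (fderiv ℝ Ψ y v), hanti (fderiv ℝ Ψ y w),
    hanti (fderiv ℝ Ψ y u)]
  ring

lemma lieDeriv_change (hW : IsOpen W) (hΨ : ContDiffOn ℝ ∞ Ψ W) {y : Euc m} (hy : y ∈ W)
    {G G' : Euc m → Euc m →L[ℝ] Euc m →L[ℝ] ℝ} (hG : DifferentiableAt ℝ G y)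
    (hG' : DifferentiableAt ℝ G' (Ψ y))
    (h : ∀ z ∈ W, ∀ u v, G z u v = G' (Ψ z) (fderiv ℝ Ψ z u) (fderiv ℝ Ψ z v))
    {V V' : Euc m → Euc m} (hV : DifferentiableAt ℝ V y) (hV' : DifferentiableAt ℝ V' (Ψ y))
    (hVV' : ∀ z ∈ W, fderiv ℝ Ψ z (V z) = V' (Ψ z)) (u v : Euc m) :
    lieDeriv V G y u v = lieDeriv V' G' (Ψ y) (fderiv ℝ Ψ y u) (fderiv ℝ Ψ y v) := by
  have e := fderiv_vec_change hW hΨ hy hV hV' hVV'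
  simp only [lieDeriv, fderiv_bilin_change hW hΨ hy hG hG' h, h y hy, ← hVV' y hy, ← e,
    map_add, add_apply]
  rw [fderiv_fderiv_symm hW hΨ hy u (V y), fderiv_fderiv_symm hW hΨ hy v (V y)]
  ring

/-- Constant fields commute, so the term with `φ²` drops out. -/
lemma nijenhuis_eq {A : Euc m → Euc m →L[ℝ] Euc m} {y : Euc m} (hA : DifferentiableAt ℝ A y)
    (u v : Euc m) :
    nijenhuis A y u v = fderiv ℝ A y (A y u) v - fderiv ℝ A y (A y v) u
      + A y (fderiv ℝ A y v u) - A y (fderiv ℝ A y u v) := by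
  have key : ∀ a c : Euc m, fderiv ℝ (fun z ↦ A z a) y c = fderiv ℝ A y c a := by
    intro a c
    rw [(hA.hasFDerivAt.clm_apply (hasFDerivAt_const a y)).fderiv]
    simp
  simp [nijenhuis, VectorField.lieBracket, key]

lemma nijenhuis_change (hW : IsOpen W) (hΨ : ContDiffOn ℝ ∞ Ψ W) {y : Euc m} (hy : y ∈ W)
    {A A' : Euc m → Euc m →L[ℝ] Euc m} (hA : DifferentiableAt ℝ A y)
    (hA' : DifferentiableAt ℝ A' (Ψ y))
    (h : ∀ z ∈ W, ∀ u, fderiv ℝ Ψ z (A z u) = A' (Ψ z) (fderiv ℝ Ψ z u)) (u v : Euc m) :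
    fderiv ℝ Ψ y (nijenhuis A y u v)
      = nijenhuis A' (Ψ y) (fderiv ℝ Ψ y u) (fderiv ℝ Ψ y v) := by
  have e : ∀ u w, fderiv ℝ Ψ y (fderiv ℝ A y w u)
      = fderiv ℝ A' (Ψ y) (fderiv ℝ Ψ y w) (fderiv ℝ Ψ y u)
        + A' (Ψ y) (fderiv ℝ (fderiv ℝ Ψ) y w u) - fderiv ℝ (fderiv ℝ Ψ) y w (A y u) := by
    intro u w
    rw [← fderiv_endo_change hW hΨ hy hA hA' h]
    abel
  rw [nijenhuis_eq hA, nijenhuis_eq hA']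
  simp only [map_add, map_sub, h y hy, e]
  rw [fderiv_fderiv_symm hW hΨ hy u v, fderiv_fderiv_symm hW hΨ hy (A y u) v,
    fderiv_fderiv_symm hW hΨ hy (A y v) u, fderiv_fderiv_symm hW hΨ hy (A y u) (A y v)]
  abel

section Metric

variable {W' : Set (Euc m)} {G G' : Euc m → Euc m →L[ℝ] Euc m →L[ℝ] ℝ}

/-- A kernel vector of the differential would have length zero for the positive definite `G`;
injectivity is bijectivity by dimension. Thus no inverse of `Ψ` is needed below. -/
lemma exists_equiv_of_isometry (hG : IsMetricOn G W) {y : Euc m} (hy : y ∈ W)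
    (h : ∀ u v, G y u v = G' (Ψ y) (fderiv ℝ Ψ y u) (fderiv ℝ Ψ y v)) :
    ∃ e : Euc m ≃ₗ[ℝ] Euc m, ∀ v, e v = fderiv ℝ Ψ y v := by
  have hinj : Function.Injective (fderiv ℝ Ψ y : Euc m →ₗ[ℝ] Euc m) := by
    refine (injective_iff_map_eq_zero _).2 fun v hv ↦ ?_
    by_contra hne
    have := hG.pos y hy v hne
    have h0 : fderiv ℝ Ψ y v = 0 := hv
    simp [h, h0] at this
  exact ⟨LinearEquiv.ofInjectiveEndo _ hinj, fun _ ↦ rfl⟩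

lemma christoffel_change (hG : IsMetricOn G W) (hG' : IsMetricOn G' W')
    (hΨ : ContDiffOn ℝ ∞ Ψ W) (hmaps : MapsTo Ψ W W')
    (h : ∀ z ∈ W, ∀ u v, G z u v = G' (Ψ z) (fderiv ℝ Ψ z u) (fderiv ℝ Ψ z v))
    {y : Euc m} (hy : y ∈ W) (u v : Euc m) :
    fderiv ℝ Ψ y (christoffel G y u v) = fderiv ℝ (fderiv ℝ Ψ) y u v
      + christoffel G' (Ψ y) (fderiv ℝ Ψ y u) (fderiv ℝ Ψ y v) := by
  obtain ⟨e, he⟩ := exists_equiv_of_isometry (Ψ := Ψ) hG hy (h y hy)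
  have hW := hG.isOpen
  -- `X` is the preimage of the expected value. It is tested against the Koszul formula of `G`, so
  -- the inverse metric never has to be transformed.
  obtain ⟨X, hX⟩ := e.surjective (fderiv ℝ (fderiv ℝ Ψ) y u v
      + christoffel G' (Ψ y) (fderiv ℝ Ψ y u) (fderiv ℝ Ψ y v))
  rw [he] at hX
  have hc : christoffel G y u v = X := by
    rw [hG.christoffel_eq_iff hy]
    intro w
    have h1 := (hG'.christoffel_eq_iff (hmaps hy) (fderiv ℝ Ψ y u) (fderiv ℝ Ψ y v) _).1 rfl
      (fderiv ℝ Ψ y w)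
    rw [h y hy, hX, map_add, add_apply, h1]
    have hs := hG'.symm _ (hmaps hy)
    simp only [christoffelFirst_apply,
      fderiv_bilin_change hW hΨ hy (hG.differentiableAt hy) (hG'.differentiableAt (hmaps hy)) h]
    rw [fderiv_fderiv_symm hW hΨ hy v u, fderiv_fderiv_symm hW hΨ hy w u,
      fderiv_fderiv_symm hW hΨ hy w v, hs _ (fderiv ℝ (fderiv ℝ Ψ) y v w),
      hs _ (fderiv ℝ (fderiv ℝ Ψ) y u w)]
    rw [hs (fderiv ℝ (fderiv ℝ Ψ) y v w), hs (fderiv ℝ (fderiv ℝ Ψ) y u w)]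
    ring
  rw [hc, hX]

/-- The transformation law of the Christoffel symbols is differentiated once more. Third derivatives
of `Ψ` cancel by symmetry, and second derivatives cancel between the derivative terms and the
quadratic terms of the curvature. -/
lemma curvature_change (hG : IsMetricOn G W) (hG' : IsMetricOn G' W')
    (hΨ : ContDiffOn ℝ ∞ Ψ W) (hmaps : MapsTo Ψ W W')
    (h : ∀ z ∈ W, ∀ u v, G z u v = G' (Ψ z) (fderiv ℝ Ψ z u) (fderiv ℝ Ψ z v))
    {y : Euc m} (hy : y ∈ W) (u v w : Euc m) :
    fderiv ℝ Ψ y (curvature G y u v w)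
      = curvature G' (Ψ y) (fderiv ℝ Ψ y u) (fderiv ℝ Ψ y v) (fderiv ℝ Ψ y w) := by
  have hW := hG.isOpen
  have hc : ∀ z ∈ W, ∀ a b, fderiv ℝ Ψ z (christoffelBilin G z a b)
      = fderiv ℝ (fderiv ℝ Ψ) z a b
        + christoffelBilin G' (Ψ z) (fderiv ℝ Ψ z a) (fderiv ℝ Ψ z b) := by
    intro z hz a b
    simp only [christoffelBilin_apply]
    exact christoffel_change hG hG' hΨ hmaps h hz a b
  have hD1 : ContDiffAt ℝ ∞ (fderiv ℝ Ψ) y :=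
    (hΨ.contDiffAt (hW.mem_nhds hy)).fderiv_right (by simp)
  have hD2 : DifferentiableAt ℝ (fderiv ℝ (fderiv ℝ Ψ)) y :=
    (hD1.fderiv_right (m := ∞) (by simp)).differentiableAt (by simp)
  have hd : ∀ a b c, fderiv ℝ Ψ y (fderiv ℝ (christoffelBilin G) y c a b)
      = fderiv ℝ (fderiv ℝ (fderiv ℝ Ψ)) y c a b
        + fderiv ℝ (christoffelBilin G') (Ψ y) (fderiv ℝ Ψ y c) (fderiv ℝ Ψ y a) (fderiv ℝ Ψ y b)
        + christoffelBilin G' (Ψ y) (fderiv ℝ (fderiv ℝ Ψ) y c a) (fderiv ℝ Ψ y b)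
        + christoffelBilin G' (Ψ y) (fderiv ℝ Ψ y a) (fderiv ℝ (fderiv ℝ Ψ) y c b)
        - fderiv ℝ (fderiv ℝ Ψ) y c (christoffelBilin G y a b) := by
    intro a b c
    have h1 := (hD1.differentiableAt (by simp)).hasFDerivAt.clm_apply
      (((hG.differentiableAt_christoffelBilin hy).hasFDerivAt.clm_apply
        (hasFDerivAt_const a y)).clm_apply (hasFDerivAt_const b y))
    have h2 := ((hD2.hasFDerivAt.clm_apply (hasFDerivAt_const a y)).clm_apply
      (hasFDerivAt_const b y)).add
      ((((hG'.differentiableAt_christoffelBilin (hmaps hy)).hasFDerivAt.comp y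
        (hasFDerivAt_of_contDiffOn hW hΨ hy)).clm_apply
        (hasFDerivAt_fderiv_apply hW hΨ hy a)).clm_apply (hasFDerivAt_fderiv_apply hW hΨ hy b))
    have h3 := h2.congr_of_eventuallyEq (f₁ := fun z ↦ fderiv ℝ Ψ z (christoffelBilin G z a b))
        (Filter.eventually_of_mem (hW.mem_nhds hy) fun z hz ↦ hc z hz a b)
    have := congrArg (fun L ↦ L c) (h1.unique h3)
    simp at this
    rw [eq_sub_iff_add_eq, this]
    abel
  have hsym3 : ∀ a b c, fderiv ℝ (fderiv ℝ (fderiv ℝ Ψ)) y a b c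
      = fderiv ℝ (fderiv ℝ (fderiv ℝ Ψ)) y b a c := by
    intro a b c
    rw [(hD1.isSymmSndFDerivAt two_le_infty) a b]
  have hsym : ∀ z ∈ W', ∀ a b, christoffelBilin G' z a b = christoffelBilin G' z b a := by
    intro z hz a b
    simp only [christoffelBilin_apply]
    exact hG'.christoffel_symm hz a b
  rw [hG.curvature_eq hy, hG'.curvature_eq (hmaps hy)]
  simp only [map_sub, map_add, hd, hc y hy]
  rw [hsym3 u v w, fderiv_fderiv_symm hW hΨ hy u v]
  abel

/-- The two curvature endomorphisms are conjugate by the differential of `Ψ`, so their traces agree.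
-/
lemma ricci_change (hG : IsMetricOn G W) (hG' : IsMetricOn G' W')
    (hΨ : ContDiffOn ℝ ∞ Ψ W) (hmaps : MapsTo Ψ W W')
    (h : ∀ z ∈ W, ∀ u v, G z u v = G' (Ψ z) (fderiv ℝ Ψ z u) (fderiv ℝ Ψ z v))
    {y : Euc m} (hy : y ∈ W) (v w : Euc m) :
    ricci G y v w = ricci G' (Ψ y) (fderiv ℝ Ψ y v) (fderiv ℝ Ψ y w) := by
  obtain ⟨e, he⟩ := exists_equiv_of_isometry (Ψ := Ψ) hG hy (h y hy)
  have hlin : ∀ {G : Euc m → Euc m →L[ℝ] Euc m →L[ℝ] ℝ} {W : Set (Euc m)} (_ : IsMetricOn G W)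
      {y} (_ : y ∈ W) (v w), ∃ L : Euc m →ₗ[ℝ] Euc m, ∀ u, L u = curvature G y u v w := by
    intro G W hG y hy v w
    refine ⟨IsLinearMap.mk' (fun u ↦ curvature G y u v w) ⟨?_, ?_⟩, fun _ ↦ rfl⟩
    · intro a b
      simp only [hG.curvature_eq hy, map_add, add_apply]
      abel
    · intro c a
      simp only [hG.curvature_eq hy, map_smul, smul_apply]
      module
  obtain ⟨L, hL⟩ := hlin hG hy v w
  obtain ⟨L', hL'⟩ := hlin hG' (hmaps hy) (fderiv ℝ Ψ y v) (fderiv ℝ Ψ y w)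
  rw [ricci_eq_trace G y v w L hL, ricci_eq_trace G' (Ψ y) _ _ L' hL',
    ← LinearMap.trace_conj' L e]
  congr 1
  ext1 u
  rw [LinearEquiv.conj_apply_apply, he, hL, hL', curvature_change hG hG' hΨ hmaps h hy, ← he,
    LinearEquiv.apply_symm_apply]

end Metric

end Change

end Coord

/-! ### The splitting `ℝ^(d+1) = ℝ × ℝ^d` and adapted coordinates -/

namespace Euc

/-- The first coordinate. -/
def head (d : ℕ) : Euc (d + 1) →L[ℝ] ℝ := EuclideanSpace.proj 0

/-- The remaining coordinates. -/
def tail (d : ℕ) : Euc (d + 1) →L[ℝ] Euc d :=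
  LinearMap.toContinuousLinearMap
    { toFun := fun y ↦ WithLp.toLp 2 fun i ↦ y i.succ
      map_add' := fun _ _ ↦ rfl
      map_smul' := fun _ _ ↦ rfl }

/-- The inclusion of `ℝ^d` as the hyperplane on which the first coordinate vanishes. -/
def incl (d : ℕ) : Euc d →L[ℝ] Euc (d + 1) :=
  LinearMap.toContinuousLinearMap
    { toFun := fun x ↦ WithLp.toLp 2 (Fin.cons 0 x)
      map_add' := fun x y ↦ by
        ext i
        refine Fin.cases ?_ (fun j ↦ ?_) i <;> simp
      map_smul' := fun c x ↦ by
        ext i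
        refine Fin.cases ?_ (fun j ↦ ?_) i <;> simp }

/-- The first vector of the standard basis. -/
def e₀ (d : ℕ) : Euc (d + 1) := EuclideanSpace.single 0 1

variable {d : ℕ}

lemma head_apply (y : Euc (d + 1)) : head d y = y 0 := rfl

lemma tail_apply (y : Euc (d + 1)) (i : Fin d) : tail d y i = y i.succ := rfl

lemma incl_zero (x : Euc d) : incl d x 0 = 0 := rfl

lemma incl_succ (x : Euc d) (i : Fin d) : incl d x i.succ = x i := rfl

@[simp] lemma head_e₀ : head d (e₀ d) = 1 := by simp [head_apply, e₀]

@[simp] lemma tail_e₀ : tail d (e₀ d) = 0 := by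
  ext i
  simp [tail_apply, e₀]

@[simp] lemma head_incl (x : Euc d) : head d (incl d x) = 0 := rfl

@[simp] lemma tail_incl (x : Euc d) : tail d (incl d x) = x := rfl

lemma head_smul_add_incl_tail (y : Euc (d + 1)) :
    head d y • e₀ d + incl d (tail d y) = y := by
  ext i
  refine Fin.cases ?_ (fun j ↦ ?_) i
  · simp [head_apply, e₀, incl_zero]
  · simp [e₀, incl_succ, tail_apply]

/-- The slab `|y₀| < ε`. -/
def slab (d : ℕ) (ε : ℝ) : Set (Euc (d + 1)) := head d ⁻¹' Set.Ioo (-ε) ε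

lemma isOpen_slab (ε : ℝ) : IsOpen (slab d ε) := isOpen_Ioo.preimage (head d).continuous

end Euc

/-! ### Straightening a vector field together with a closed one-form. -/

open Euc Set Filter Topology

/-- A smooth vector field on a neighbourhood of a point extends to a global one. -/
lemma exists_contDiff_eqOn_ball {m : ℕ} {F : Type} [NormedAddCommGroup F] [NormedSpace ℝ F]
    {V : Euc m → F} {y₀ : Euc m} {r : ℝ} (hr : 0 < r) (hV : ContDiffOn ℝ ∞ V (Metric.ball y₀ r)) :
    ∃ V' : Euc m → F, ContDiff ℝ ∞ V' ∧ ∀ y ∈ Metric.ball y₀ (r / 3), V' y = V y := by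
  let f : ContDiffBump y₀ := ⟨r / 3, r / 2, by linarith, by linarith⟩
  refine ⟨fun y ↦ f y • V y, ?_, ?_⟩
  · refine contDiff_iff_contDiffAt.2 fun y ↦ ?_
    by_cases hy : y ∈ Metric.ball y₀ r
    · exact f.contDiff.contDiffAt.smul (hV.contDiffAt (Metric.isOpen_ball.mem_nhds hy))
    · have hy' : y ∉ tsupport f := by
        rw [f.tsupport_eq]
        intro h
        exact hy (Metric.closedBall_subset_ball (by change r / 2 < r; linarith) h)
      refine (contDiffAt_const (c := (0 : F))).congr_of_eventuallyEq ?_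
      filter_upwards [notMem_tsupport_iff_eventuallyEq.1 hy'] with z hz
      simp [hz]
  · intro y hy
    have : f y = 1 := f.one_of_mem_closedBall (Metric.ball_subset_closedBall hy)
    simp [this]

/-- A closed one-form has a local primitive. -/
lemma exists_primitive_ball {m : ℕ} {α : Euc m → Euc m →L[ℝ] ℝ} {y₀ : Euc m} {r : ℝ}
    (hα : ContDiffOn ℝ ∞ α (Metric.ball y₀ r))
    (hd : ∀ y ∈ Metric.ball y₀ r, ∀ u v, Coord.dOne α y u v = 0) :
    ∃ T : Euc m → ℝ, T y₀ = 0 ∧ ContDiffOn ℝ ∞ T (Metric.ball y₀ r) ∧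
      ∀ y ∈ Metric.ball y₀ r, HasFDerivAt T (α y) y := by
  obtain ⟨T, hT⟩ := (convex_ball y₀ r).exists_forall_hasFDerivAt_of_fderiv_symmetric
    Metric.isOpen_ball (hα.differentiableOn (by simp)) (fun y hy u v ↦ sub_eq_zero.1 (hd y hy u v))
  have hT' : ∀ y ∈ Metric.ball y₀ r, HasFDerivAt (fun y ↦ T y - T y₀) (α y) y :=
    fun y hy ↦ (hT y hy).sub_const _
  refine ⟨fun y ↦ T y - T y₀, sub_self _, ?_, hT'⟩
  rw [contDiffOn_infty_iff_fderiv_of_isOpen Metric.isOpen_ball]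
  exact ⟨fun y hy ↦ (hT' y hy).differentiableAt.differentiableWithinAt,
    hα.congr fun y hy ↦ (hT' y hy).fderiv⟩

/-- The kernel of a nonzero form on `ℝ^(d+1)` is parametrized by `ℝ^d`. -/
lemma exists_slice {d : ℕ} {β : Euc (d + 1) →L[ℝ] ℝ} {V₀ : Euc (d + 1)} (h : β V₀ = 1) :
    ∃ S : Euc d →L[ℝ] Euc (d + 1), (∀ x, β (S x) = 0) ∧
      ∃ L : Euc (d + 1) ≃L[ℝ] Euc (d + 1), ∀ y, L y = head d y • V₀ + S (tail d y) := by
  have hne : (β : Euc (d + 1) →ₗ[ℝ] ℝ) ≠ 0 := by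
    intro h0
    have : β V₀ = 0 := DFunLike.congr_fun h0 V₀
    rw [h] at this
    exact one_ne_zero this
  have hdim : Module.finrank ℝ (Euc d) = Module.finrank ℝ (LinearMap.ker (β : Euc (d + 1) →ₗ[ℝ] ℝ)) := by
    have := Module.Dual.finrank_ker_add_one_of_ne_zero hne
    simp only [finrank_euclideanSpace, Fintype.card_fin] at this ⊢
    omega
  let E := LinearEquiv.ofFinrankEq _ _ hdim
  let S : Euc d →L[ℝ] Euc (d + 1) :=
    LinearMap.toContinuousLinearMap ((LinearMap.ker (β : Euc (d + 1) →ₗ[ℝ] ℝ)).subtype ∘ₗ E)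
  have hS : ∀ x, β (S x) = 0 := fun x ↦ (E x).2
  have hSi : ∀ x, S x = 0 → x = 0 := by
    intro x hx
    have h1 : E x = 0 := Subtype.ext hx
    simpa using h1
  let L₀ : Euc (d + 1) →L[ℝ] Euc (d + 1) := (head d).smulRight V₀ + S.comp (tail d)
  have hL₀ : ∀ y, L₀ y = head d y • V₀ + S (tail d y) := fun _ ↦ rfl
  have hinj : Function.Injective (L₀ : Euc (d + 1) →ₗ[ℝ] Euc (d + 1)) := by
    refine (injective_iff_map_eq_zero _).2 fun y hy ↦ ?_
    have hy' : head d y • V₀ + S (tail d y) = 0 := hy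
    have h1 : head d y = 0 := by
      have := congrArg β hy'
      simpa [h, hS] using this
    have h2 : tail d y = 0 := hSi _ (by simpa [h1] using hy')
    rw [← head_smul_add_incl_tail y, h1, h2]
    simp
  exact ⟨S, hS, (LinearEquiv.ofInjectiveEndo _ hinj).toContinuousLinearEquiv, hL₀⟩

/-- The local flow of a vector field `V`, together with a primitive `T` of a closed one-form `α`
with `α(V) = 1`. -/
lemma exists_flow_with_time {m : ℕ} {U : Set (Euc m)} (hU : IsOpen U)
    {V : Euc m → Euc m} {α : Euc m → Euc m →L[ℝ] ℝ}
    (hV : ContDiffOn ℝ ∞ V U) (hα : ContDiffOn ℝ ∞ α U) (hαV : ∀ y ∈ U, α y (V y) = 1)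
    (hd : ∀ y ∈ U, ∀ u v, Coord.dOne α y u v = 0) {y₀ : Euc m} (hy₀ : y₀ ∈ U) :
    ∃ δ > 0, ∃ (Φ : ℝ × Euc m → Euc m) (T : Euc m → ℝ), T y₀ = 0 ∧
      ContDiffOn ℝ ∞ T (Metric.ball y₀ δ) ∧
      ContDiffOn ℝ ∞ Φ (Ioo (-δ) δ ×ˢ Metric.ball y₀ δ) ∧
      (∀ x ∈ Metric.ball y₀ δ, Φ (0, x) = x) ∧
      ∀ s ∈ Ioo (-δ) δ, ∀ x ∈ Metric.ball y₀ δ, Φ (s, x) ∈ U ∧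
        HasDerivAt (fun s ↦ Φ (s, x)) (V (Φ (s, x))) s ∧
        HasFDerivAt T (α (Φ (s, x))) (Φ (s, x)) ∧ T (Φ (s, x)) = T x + s := by
  obtain ⟨r, hr, hrU⟩ := Metric.isOpen_iff.1 hU y₀ hy₀
  obtain ⟨T, hT₀, hTs, hT⟩ := exists_primitive_ball (hα.mono hrU) (fun y hy ↦ hd y (hrU hy))
  obtain ⟨V', hV', hVV'⟩ := exists_contDiff_eqOn_ball hr (hV.mono hrU)
  obtain ⟨δ₀, hδ₀, Φ, hΦs, hΦ0, hΦ⟩ := exists_smooth_local_flow hV' y₀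
  have hsub : Metric.ball y₀ (r / 3) ⊆ Metric.ball y₀ r := Metric.ball_subset_ball (by linarith)
  have hbox : IsOpen (Ioo (-δ₀) δ₀ ×ˢ Metric.ball y₀ δ₀) := isOpen_Ioo.prod Metric.isOpen_ball
  have hmem₀ : ((0 : ℝ), y₀) ∈ Ioo (-δ₀) δ₀ ×ˢ Metric.ball y₀ δ₀ :=
    ⟨⟨by linarith, hδ₀⟩, Metric.mem_ball_self hδ₀⟩
  obtain ⟨δ, hδ, hδδ₀, hδΦ⟩ : ∃ δ > 0, δ ≤ δ₀ ∧ ∀ s ∈ Ioo (-δ) δ, ∀ x ∈ Metric.ball y₀ δ,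
      x ∈ Metric.ball y₀ (r / 3) ∧ Φ (s, x) ∈ Metric.ball y₀ (r / 3) := by
    have hc : ContinuousAt Φ (0, y₀) := hΦs.continuousOn.continuousAt (hbox.mem_nhds hmem₀)
    have hb : Metric.ball y₀ (r / 3) ∈ 𝓝 y₀ := Metric.ball_mem_nhds y₀ (by linarith)
    have hev1 : ∀ᶠ p : ℝ × Euc m in 𝓝 ((0 : ℝ), y₀), p.2 ∈ Metric.ball y₀ (r / 3) :=
      (continuousAt_snd (p := ((0 : ℝ), y₀))).preimage_mem_nhds hb
    have hev2 : ∀ᶠ p : ℝ × Euc m in 𝓝 ((0 : ℝ), y₀), Φ p ∈ Metric.ball y₀ (r / 3) :=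
      hc.preimage_mem_nhds (by rw [hΦ0 _ hmem₀.2]; exact hb)
    obtain ⟨δ₁, hδ₁, h⟩ := Metric.eventually_nhds_iff.1 (hev1.and hev2)
    refine ⟨min δ₀ δ₁, lt_min hδ₀ hδ₁, min_le_left _ _, fun s hs x hx ↦ h (y := (s, x)) ?_⟩
    refine max_lt ?_ (lt_of_lt_of_le hx (min_le_right _ _))
    rw [Real.dist_eq, sub_zero]
    exact lt_of_lt_of_le (abs_lt.2 hs) (min_le_right _ _)
  have hIoo : Ioo (-δ) δ ⊆ Ioo (-δ₀) δ₀ := Ioo_subset_Ioo (by linarith) hδδ₀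
  have hball : Metric.ball y₀ δ ⊆ Metric.ball y₀ δ₀ := Metric.ball_subset_ball hδδ₀
  have h0δ : (0 : ℝ) ∈ Ioo (-δ) δ := ⟨by linarith, hδ⟩
  have hflow : ∀ s ∈ Ioo (-δ) δ, ∀ x ∈ Metric.ball y₀ δ,
      HasDerivAt (fun s ↦ Φ (s, x)) (V (Φ (s, x))) s := by
    intro s hs x hx
    rw [← hVV' _ (hδΦ s hs x hx).2]
    exact hΦ s (hIoo hs) x (hball hx)
  refine ⟨δ, hδ, Φ, T, hT₀, hTs.mono fun x hx ↦ hsub (hδΦ 0 h0δ x hx).1,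
    hΦs.mono (prod_mono hIoo hball), fun x hx ↦ hΦ0 x (hball hx), fun s hs x hx ↦
    ⟨hrU (hsub (hδΦ s hs x hx).2), hflow s hs x hx, hT _ (hsub (hδΦ s hs x hx).2), ?_⟩⟩
  -- Since `dT = α` and `α(V) = 1`, the primitive `T` grows at unit speed along the flow.
  have hder : ∀ t ∈ Ioo (-δ) δ, HasDerivAt (fun t ↦ T (Φ (t, x)) - t) 0 t := by
    intro t ht
    have hb := hsub (hδΦ t ht x hx).2
    have h1 := (hT _ hb).comp_hasDerivAt t (hflow t ht x hx)
    rw [hαV _ (hrU hb)] at h1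
    exact (h1.sub (hasDerivAt_id t)).congr_deriv (sub_self 1)
  have h2 := isOpen_Ioo.is_const_of_deriv_eq_zero isPreconnected_Ioo
    (fun t ht ↦ (hder t ht).differentiableAt.differentiableWithinAt)
    (fun t ht ↦ (hder t ht).deriv) hs h0δ
  simp only [hΦ0 x (hball hx), sub_zero] at h2
  linarith

/-- The derivative of a flow at time `0`. -/
lemma hasFDerivAt_flow_zero {m : ℕ} {Φ : ℝ × Euc m → Euc m} {y₀ V₀ : Euc m} {δ : ℝ} (hδ : 0 < δ)
    (hΦ : DifferentiableAt ℝ Φ (0, y₀)) (hΦ0 : ∀ x ∈ Metric.ball y₀ δ, Φ (0, x) = x)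
    (hV : HasDerivAt (fun s ↦ Φ (s, y₀)) V₀ 0) :
    HasFDerivAt Φ ((ContinuousLinearMap.fst ℝ ℝ (Euc m)).smulRight V₀
      + ContinuousLinearMap.snd ℝ ℝ (Euc m)) (0, y₀) := by
  have hΦd := hΦ.hasFDerivAt
  have hs : fderiv ℝ Φ (0, y₀) (1, 0) = V₀ :=
    (hΦd.comp_hasDerivAt 0 ((hasDerivAt_id (0 : ℝ)).prodMk (hasDerivAt_const 0 y₀))).unique hV
  have hx : ∀ w, fderiv ℝ Φ (0, y₀) (0, w) = w := by
    intro w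
    have h2 := hΦd.comp y₀ (hasFDerivAt_prodMk_right (𝕜 := ℝ) (0 : ℝ) y₀)
    have h3 := (hasFDerivAt_id (𝕜 := ℝ) y₀).congr_of_eventuallyEq
      (f₁ := Φ ∘ fun x ↦ ((0 : ℝ), x))
      (Filter.eventually_of_mem (Metric.ball_mem_nhds y₀ hδ) fun x hx ↦ hΦ0 x hx)
    exact congrArg (fun A ↦ A w) (h2.unique h3)
  refine hΦd.congr_fderiv (ContinuousLinearMap.ext fun p ↦ ?_)
  have : p = p.1 • (1, 0) + (0, p.2) := by simp
  conv_lhs => rw [this, map_add, map_smul, hs, hx]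
  rfl

/-- A smooth map which is invertible to first order, and which pulls a vector field `V` back to the
first coordinate field and a closed one-form `α` with `α(V) = 1` back to the differential of the
first coordinate. -/
lemma exists_flow_map {d : ℕ} {U : Set (Euc (d + 1))} (hU : IsOpen U)
    {V : Euc (d + 1) → Euc (d + 1)} {α : Euc (d + 1) → Euc (d + 1) →L[ℝ] ℝ}
    (hV : ContDiffOn ℝ ∞ V U) (hα : ContDiffOn ℝ ∞ α U) (hαV : ∀ y ∈ U, α y (V y) = 1)
    (hd : ∀ y ∈ U, ∀ u v, Coord.dOne α y u v = 0) {y₀ : Euc (d + 1)} (hy₀ : y₀ ∈ U) :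
    ∃ O : Set (Euc (d + 1)), IsOpen O ∧ 0 ∈ O ∧ ∃ Ψ₀ : Euc (d + 1) → Euc (d + 1),
      ContDiffOn ℝ ∞ Ψ₀ O ∧ Ψ₀ 0 = y₀ ∧ (∀ y ∈ O, Ψ₀ y ∈ U) ∧
      (∃ L : Euc (d + 1) ≃L[ℝ] Euc (d + 1),
        HasFDerivAt Ψ₀ (L : Euc (d + 1) →L[ℝ] Euc (d + 1)) 0) ∧
      (∀ y ∈ O, fderiv ℝ Ψ₀ y (e₀ d) = V (Ψ₀ y)) ∧
      ∀ y ∈ O, ∀ v, α (Ψ₀ y) (fderiv ℝ Ψ₀ y v) = head d v := by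
  obtain ⟨δ, hδ, Φ, T, hT₀, hTs, hΦs, hΦ0, hΦ⟩ := exists_flow_with_time hU hV hα hαV hd hy₀
  have hbox : IsOpen (Ioo (-δ) δ ×ˢ Metric.ball y₀ δ) := isOpen_Ioo.prod Metric.isOpen_ball
  have h0δ : (0 : ℝ) ∈ Ioo (-δ) δ := ⟨by linarith, hδ⟩
  have hy₀δ : y₀ ∈ Metric.ball y₀ δ := Metric.mem_ball_self hδ
  have hΦdiff : DifferentiableAt ℝ Φ (0, y₀) :=
    (hΦs.contDiffAt (hbox.mem_nhds (mk_mem_prod h0δ hy₀δ))).differentiableAt (by simp)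
  obtain ⟨S, hS, L, hL⟩ := exists_slice (hαV y₀ hy₀)
  -- The affine slice `σ` is tangent to `ker α` at `y₀`, but `T` need not vanish along it. Flowing
  -- from `σ y` for the time `head d y - T (σ y)` compensates for this and gives `T ∘ Ψ₀ = head d`.
  let σ : Euc (d + 1) → Euc (d + 1) := fun y ↦ y₀ + S (tail d y)
  have hσ : ContDiff ℝ ∞ σ := contDiff_const.add (S.comp (tail d)).contDiff
  have hσ₀ : σ 0 = y₀ := by simp [σ]
  let t : Euc (d + 1) → ℝ := fun y ↦ head d y - T (σ y)
  let O₁ : Set (Euc (d + 1)) := σ ⁻¹' Metric.ball y₀ δ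
  have hO₁ : IsOpen O₁ := Metric.isOpen_ball.preimage hσ.continuous
  have ht : ContDiffOn ℝ ∞ t O₁ :=
    (head d).contDiff.contDiffOn.sub (hTs.comp hσ.contDiffOn fun y hy ↦ hy)
  have ht₀ : t 0 = 0 := by simp [t, hσ₀, hT₀]
  let O : Set (Euc (d + 1)) := O₁ ∩ t ⁻¹' Ioo (-δ) δ
  have hO : IsOpen O := ht.continuousOn.isOpen_inter_preimage hO₁ isOpen_Ioo
  have h0O : (0 : Euc (d + 1)) ∈ O := by
    refine ⟨mem_preimage.2 ?_, mem_preimage.2 ?_⟩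
    · rw [hσ₀]; exact hy₀δ
    · rw [ht₀]; exact h0δ
  let Ψ₀ : Euc (d + 1) → Euc (d + 1) := fun y ↦ Φ (t y, σ y)
  have hflow : ∀ y ∈ O, Ψ₀ y ∈ U ∧
        HasDerivAt (fun s ↦ Φ (s, σ y)) (V (Ψ₀ y)) (t y) ∧
        HasFDerivAt T (α (Ψ₀ y)) (Ψ₀ y) ∧ T (Ψ₀ y) = T (σ y) + t y :=
    fun y hy ↦ hΦ _ hy.2 _ hy.1
  have hΨ₀s : ContDiffOn ℝ ∞ Ψ₀ O :=
    hΦs.comp ((ht.mono inter_subset_left).prodMk hσ.contDiffOn) fun y hy ↦ ⟨hy.2, hy.1⟩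
  have hdiff : ∀ y ∈ O, HasFDerivAt Ψ₀ (fderiv ℝ Ψ₀ y) y := fun y hy ↦
    ((hΨ₀s.contDiffAt (hO.mem_nhds hy)).differentiableAt (by simp)).hasFDerivAt
  have hprop1 : ∀ y ∈ O, fderiv ℝ Ψ₀ y (e₀ d) = V (Ψ₀ y) := by
    intro y hy
    have h1 : HasDerivAt (fun s : ℝ ↦ y + s • e₀ d) (e₀ d) 0 := by
      simpa using ((hasDerivAt_id (0 : ℝ)).smul_const (e₀ d)).const_add y
    have hd0 : HasFDerivAt Ψ₀ (fderiv ℝ Ψ₀ y) (y + (0 : ℝ) • e₀ d) := by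
      simpa using hdiff y hy
    have h2 := hd0.comp_hasDerivAt 0 h1
    have h4 : HasDerivAt (fun s : ℝ ↦ s + t y) 1 0 := (hasDerivAt_id (0 : ℝ)).add_const _
    have h3' : HasDerivAt (fun s ↦ Φ (s, σ y)) (V (Ψ₀ y)) (0 + t y) := by
      rw [zero_add]; exact (hflow y hy).2.1
    have h5 := h3'.scomp (0 : ℝ) h4
    rw [one_smul] at h5
    refine h2.unique (h5.congr_of_eventuallyEq (Eventually.of_forall fun s ↦ ?_))
    have hσs : σ (y + s • e₀ d) = σ y := by simp [σ]
    have hts : t (y + s • e₀ d) = s + t y := by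
      simp only [t, hσs, map_add, map_smul, head_e₀, smul_eq_mul, mul_one]
      ring
    simp only [Function.comp, Ψ₀, hσs, hts]
  have hprop2 : ∀ y ∈ O, ∀ v, α (Ψ₀ y) (fderiv ℝ Ψ₀ y v) = head d v := by
    intro y hy v
    have h1 := (hflow y hy).2.2.1.comp y (hdiff y hy)
    have h2 := ((head d).hasFDerivAt (x := y)).congr_of_eventuallyEq (f₁ := T ∘ Ψ₀)
      (Filter.eventually_of_mem (hO.mem_nhds hy) fun z hz ↦ by
        rw [Function.comp, (hflow z hz).2.2.2]
        exact add_sub_cancel _ _)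
    exact congrArg (fun A ↦ A v) (h1.unique h2)
  have hΨ₀0 : Ψ₀ 0 = y₀ := by
    simp only [Ψ₀, ht₀, hσ₀]
    exact hΦ0 _ hy₀δ
  have hder0 : HasFDerivAt Ψ₀ (L : Euc (d + 1) →L[ℝ] Euc (d + 1)) 0 := by
    have hV₀ : HasDerivAt (fun s ↦ Φ (s, y₀)) (V y₀) 0 := by
      have := (hflow 0 h0O).2.1
      rwa [hσ₀, ht₀, hΨ₀0] at this
    have hΦd := hasFDerivAt_flow_zero hδ hΦdiff hΦ0 hV₀
    have hσd : HasFDerivAt σ (S.comp (tail d)) 0 := ((S.comp (tail d)).hasFDerivAt).const_add y₀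
    have hTd : HasFDerivAt T (α y₀) (σ 0) := by
      have := (hflow 0 h0O).2.2.1
      rw [hΨ₀0] at this
      rwa [hσ₀]
    have hin := (((head d).hasFDerivAt (x := (0 : Euc (d + 1)))).sub (hTd.comp 0 hσd)).prodMk hσd
    have hΦd' : HasFDerivAt Φ ((ContinuousLinearMap.fst ℝ ℝ (Euc (d + 1))).smulRight (V y₀)
        + ContinuousLinearMap.snd ℝ ℝ (Euc (d + 1))) (t 0, σ 0) := by
      rw [hσ₀, ht₀]; exact hΦd
    refine (hΦd'.comp (0 : Euc (d + 1)) hin).congr_fderiv ?_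
    ext1 v
    change (head d v - α y₀ (S (tail d v))) • V y₀ + S (tail d v) = L v
    -- `S` takes values in `ker (α y₀)`, so the correction of the time by `T` has no first-order
    -- effect at `0`.
    rw [hS, sub_zero, hL]
  exact ⟨O, hO, h0O, Ψ₀, hΨ₀s, hΨ₀0, fun y hy ↦ (hflow y hy).1, ⟨L, hder0⟩, hprop1, hprop2⟩

/-- Local coordinates in which a vector field `V` becomes the first coordinate field and a closed
one-form `α` with `α(V) = 1` becomes the differential of the first coordinate. -/
lemma exists_flow_box {d : ℕ} {U : Set (Euc (d + 1))} (hU : IsOpen U)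
    {V : Euc (d + 1) → Euc (d + 1)} {α : Euc (d + 1) → Euc (d + 1) →L[ℝ] ℝ}
    (hV : ContDiffOn ℝ ∞ V U) (hα : ContDiffOn ℝ ∞ α U) (hαV : ∀ y ∈ U, α y (V y) = 1)
    (hd : ∀ y ∈ U, ∀ u v, Coord.dOne α y u v = 0) {y₀ : Euc (d + 1)} (hy₀ : y₀ ∈ U) :
    ∃ Ψ : OpenPartialHomeomorph (Euc (d + 1)) (Euc (d + 1)), 0 ∈ Ψ.source ∧ Ψ 0 = y₀ ∧
      Ψ.target ⊆ U ∧ ContDiffOn ℝ ∞ Ψ Ψ.source ∧ ContDiffOn ℝ ∞ Ψ.symm Ψ.target ∧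
      ∀ y ∈ Ψ.source, fderiv ℝ Ψ y (e₀ d) = V (Ψ y) ∧
        ∀ v, α (Ψ y) (fderiv ℝ Ψ y v) = head d v := by
  obtain ⟨O, hO, h0O, Ψ₀, hs, h0, hU', ⟨L, hL⟩, h1, h2⟩ := exists_flow_map hU hV hα hαV hd hy₀
  obtain ⟨e, he0, hesub, rfl, hes⟩ := exists_openPartialHomeomorph_of_contDiffOn hO hs h0O L hL
  refine ⟨e, he0, h0, ?_, hs.mono hesub, hes, fun y hy ↦ ⟨h1 y (hesub hy), h2 y (hesub hy)⟩⟩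
  intro z hz
  have := hU' _ (hesub (e.map_target hz))
  rwa [e.right_inv hz] at this

/-- The diffeomorphism from the slab `|y₀| < ε` onto the cylinder `|y₀| < ε`, `‖y'‖ < ε`. -/
lemma exists_slab_cylinder (d : ℕ) {ε : ℝ} (hε : 0 < ε) :
    ∃ b : OpenPartialHomeomorph (Euc (d + 1)) (Euc (d + 1)), b.source = slab d ε ∧
      (∀ y ∈ b.target, |head d y| < ε ∧ ‖tail d y‖ < ε) ∧ b 0 = 0 ∧ ContDiff ℝ ∞ b ∧
      ContDiffOn ℝ ∞ b.symm b.target ∧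
      ∀ y, fderiv ℝ b y (e₀ d) = e₀ d ∧ ∀ v, head d (fderiv ℝ b y v) = head d v := by
  -- The transverse ball is stretched to all of `ℝ^d` while the first coordinate is left alone. A
  -- slice is then a whole copy of `ℝ^d` and can serve as the Kähler factor.
  let β := OpenPartialHomeomorph.univBall (0 : Euc d) ε
  have hβs : β.source = univ := OpenPartialHomeomorph.univBall_source _ _
  have hβt : β.target = Metric.ball 0 ε := OpenPartialHomeomorph.univBall_target _ hε
  have hβ : ContDiff ℝ ∞ β := OpenPartialHomeomorph.contDiff_univBall
  have hβ' : ContDiffOn ℝ ∞ β.symm (Metric.ball 0 ε) :=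
    OpenPartialHomeomorph.contDiffOn_univBall_symm
  let f : Euc (d + 1) → Euc (d + 1) := fun y ↦ head d y • e₀ d + incl d (β (tail d y))
  let g : Euc (d + 1) → Euc (d + 1) := fun y ↦ head d y • e₀ d + incl d (β.symm (tail d y))
  have hf : ContDiff ℝ ∞ f := ((head d).contDiff.smul contDiff_const).add
    ((incl d).contDiff.comp (hβ.comp (tail d).contDiff))
  let C : Set (Euc (d + 1)) := slab d ε ∩ tail d ⁻¹' Metric.ball 0 ε
  have hC : IsOpen C := (isOpen_slab ε).inter (Metric.isOpen_ball.preimage (tail d).continuous)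
  have hg : ContDiffOn ℝ ∞ g C := ((head d).contDiff.smul contDiff_const).contDiffOn.add
    ((incl d).contDiff.comp_contDiffOn
      (hβ'.comp (tail d).contDiff.contDiffOn fun y hy ↦ hy.2))
  have hfh : ∀ y, head d (f y) = head d y := fun y ↦ by simp [f]
  have hft : ∀ y, tail d (f y) = β (tail d y) := fun y ↦ by simp [f]
  have hgh : ∀ y, head d (g y) = head d y := fun y ↦ by simp [g]
  have hgt : ∀ y, tail d (g y) = β.symm (tail d y) := fun y ↦ by simp [g]
  let b : OpenPartialHomeomorph (Euc (d + 1)) (Euc (d + 1)) :=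
    { toFun := f
      invFun := g
      source := slab d ε
      target := C
      map_source' := fun y hy ↦ by
        refine ⟨mem_preimage.2 ?_, mem_preimage.2 ?_⟩
        · rw [hfh]; exact hy
        · rw [hft, ← hβt]; exact β.map_source (by rw [hβs]; trivial)
      map_target' := fun y hy ↦ by
        refine mem_preimage.2 ?_
        rw [hgh]; exact hy.1
      left_inv' := fun y hy ↦ by
        change head d (f y) • e₀ d + incl d (β.symm (tail d (f y))) = y
        rw [hfh, hft, β.left_inv (by rw [hβs]; trivial), head_smul_add_incl_tail]
      right_inv' := fun y hy ↦ by
        change head d (g y) • e₀ d + incl d (β (tail d (g y))) = y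
        rw [hgh, hgt, β.right_inv (by rw [hβt]; exact hy.2), head_smul_add_incl_tail]
      open_source := isOpen_slab ε
      open_target := hC
      continuousOn_toFun := hf.continuous.continuousOn
      continuousOn_invFun := hg.continuousOn }
  have hbf : (b : Euc (d + 1) → Euc (d + 1)) = f := rfl
  refine ⟨b, rfl, ?_, ?_, hf, hg, ?_⟩
  · intro y hy
    exact ⟨abs_lt.2 hy.1, by simpa using hy.2⟩
  · rw [hbf]
    have : β 0 = 0 := OpenPartialHomeomorph.univBall_apply_zero _ _
    simp [f, this]
  · intro y
    have h1 : HasFDerivAt f ((head d).smulRight (e₀ d)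
        + (incl d).comp ((fderiv ℝ β (tail d y)).comp (tail d))) y := by
      refine ((head d).smulRight (e₀ d)).hasFDerivAt.add ((incl d).hasFDerivAt.comp y ?_)
      exact ((hβ.differentiable (by simp)) _).hasFDerivAt.comp y (tail d).hasFDerivAt
    rw [hbf, h1.fderiv]
    simp

/-- Adapted coordinates defined on a slab. -/
theorem exists_adapted_coordinates {d : ℕ} {U : Set (Euc (d + 1))} (hU : IsOpen U)
    {V : Euc (d + 1) → Euc (d + 1)} {α : Euc (d + 1) → Euc (d + 1) →L[ℝ] ℝ}
    (hV : ContDiffOn ℝ ∞ V U) (hα : ContDiffOn ℝ ∞ α U) (hαV : ∀ y ∈ U, α y (V y) = 1)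
    (hd : ∀ y ∈ U, ∀ u v, Coord.dOne α y u v = 0) {y₀ : Euc (d + 1)} (hy₀ : y₀ ∈ U) :
    ∃ ε > 0, ∃ Ψ : OpenPartialHomeomorph (Euc (d + 1)) (Euc (d + 1)),
      Ψ.source = slab d ε ∧ Ψ 0 = y₀ ∧
      Ψ.target ⊆ U ∧ ContDiffOn ℝ ∞ Ψ Ψ.source ∧ ContDiffOn ℝ ∞ Ψ.symm Ψ.target ∧
      ∀ y ∈ Ψ.source, fderiv ℝ Ψ y (e₀ d) = V (Ψ y) ∧
        ∀ v, α (Ψ y) (fderiv ℝ Ψ y v) = head d v := by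
  obtain ⟨Θ, h0, hΘ0, hΘU, hΘs, hΘs', hΘ⟩ := exists_flow_box hU hV hα hαV hd hy₀
  obtain ⟨ε, hε, hεΘ⟩ : ∃ ε > 0, ∀ y, |head d y| < ε → ‖tail d y‖ < ε → y ∈ Θ.source := by
    let j : ℝ × Euc d → Euc (d + 1) := fun p ↦ p.1 • e₀ d + incl d p.2
    have hj : Continuous j := (continuous_fst.smul continuous_const).add
      ((incl d).continuous.comp continuous_snd)
    have hj0 : j ⁻¹' Θ.source ∈ 𝓝 ((0 : ℝ), (0 : Euc d)) := by
      refine hj.continuousAt.preimage_mem_nhds (Θ.open_source.mem_nhds ?_)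
      simpa [j] using h0
    obtain ⟨ε, hε, h⟩ := Metric.mem_nhds_iff.1 hj0
    refine ⟨ε, hε, fun y h1 h2 ↦ ?_⟩
    have : ((head d y, tail d y) : ℝ × Euc d) ∈ Metric.ball ((0 : ℝ), (0 : Euc d)) ε := by
      rw [Metric.mem_ball, Prod.dist_eq, dist_zero_right, dist_zero_right]
      exact max_lt h1 h2
    have h3 : j (head d y, tail d y) ∈ Θ.source := h this
    rwa [show j (head d y, tail d y) = y from head_smul_add_incl_tail y] at h3
  obtain ⟨b, hbs, hbt, hb0, hb, hb', hbd⟩ := exists_slab_cylinder d hε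
  have hbΘ : ∀ y ∈ slab d ε, b y ∈ Θ.source := by
    intro y hy
    have := hbt _ (b.map_source (by rw [hbs]; exact hy))
    exact hεΘ _ this.1 this.2
  have hsrc : (b.trans Θ).source = slab d ε := by
    rw [OpenPartialHomeomorph.trans_source, hbs]
    exact inter_eq_left.2 hbΘ
  refine ⟨ε, hε, b.trans Θ, hsrc, ?_, ?_, ?_, ?_, ?_⟩
  · simp [hb0, hΘ0]
  · exact fun z hz ↦ hΘU hz.1
  · rw [hsrc]
    exact hΘs.comp hb.contDiffOn hbΘ
  · exact hb'.comp (hΘs'.mono inter_subset_left) fun z hz ↦ hz.2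
  · intro y hy
    rw [hsrc] at hy
    have h1 : fderiv ℝ (b.trans Θ) y = (fderiv ℝ Θ (b y)).comp (fderiv ℝ b y) :=
      fderiv_comp y ((hΘs.contDiffAt (Θ.open_source.mem_nhds (hbΘ y hy))).differentiableAt (by simp))
        (hb.differentiable (by simp) y)
    rw [h1]
    refine ⟨?_, fun v ↦ ?_⟩
    · rw [ContinuousLinearMap.comp_apply, (hbd y).1]
      exact (hΘ _ (hbΘ y hy)).1
    · rw [ContinuousLinearMap.comp_apply]
      exact ((hΘ _ (hbΘ y hy)).2 _).trans ((hbd y).2 v)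

/-! ### The Ricci curvature of a warped product with a line -/

namespace Coord

open Euc Set

variable {d : ℕ} {ε : ℝ} {G : Euc (d + 1) → Euc (d + 1) →L[ℝ] Euc (d + 1) →L[ℝ] ℝ}
  {H : Euc d → Euc d →L[ℝ] Euc d →L[ℝ] ℝ} {s k : ℝ → ℝ}

/-- The metric `dt² + s(t) H` on a slab, where `s' = 2ks`. -/
structure IsWarpedOn (ε : ℝ) (G : Euc (d + 1) → Euc (d + 1) →L[ℝ] Euc (d + 1) →L[ℝ] ℝ)
    (H : Euc d → Euc d →L[ℝ] Euc d →L[ℝ] ℝ) (s k : ℝ → ℝ) : Prop where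
  metric : IsMetricOn G (slab d ε)
  base : IsMetricOn H univ
  eq : ∀ y ∈ slab d ε, ∀ u v,
    G y u v = head d u * head d v + s (head d y) * H (tail d y) (tail d u) (tail d v)
  hasDerivAt_s : ∀ t ∈ Ioo (-ε) ε, HasDerivAt s (2 * k t * s t) t
  differentiableAt_k : ∀ t ∈ Ioo (-ε) ε, DifferentiableAt ℝ k t

namespace IsWarpedOn

lemma fderiv_metric (h : IsWarpedOn ε G H s k) {y : Euc (d + 1)} (hy : y ∈ slab d ε)
    (w u v : Euc (d + 1)) :
    fderiv ℝ G y w u v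
      = head d w * (2 * k (head d y) * s (head d y)) * H (tail d y) (tail d u) (tail d v)
        + s (head d y) * fderiv ℝ H (tail d y) (tail d w) (tail d u) (tail d v) := by
  have h1 := ((h.metric.differentiableAt hy).hasFDerivAt.clm_apply
    (hasFDerivAt_const u y)).clm_apply (hasFDerivAt_const v y)
  have hs : HasFDerivAt (fun y ↦ s (head d y))
      ((2 * k (head d y) * s (head d y)) • head d) y :=
    (h.hasDerivAt_s _ hy).comp_hasFDerivAt y (head d).hasFDerivAt
  have hH := ((((h.base.differentiableAt (mem_univ (tail d y))).hasFDerivAt.comp y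
    (tail d).hasFDerivAt).clm_apply (hasFDerivAt_const (tail d u) y)).clm_apply
      (hasFDerivAt_const (tail d v) y))
  have h2 := (hs.mul hH).const_add (head d u * head d v)
  have h3 := h2.congr_of_eventuallyEq (f₁ := fun z ↦ G z u v)
    (Filter.eventually_of_mem ((isOpen_slab ε).mem_nhds hy) fun z hz ↦ h.eq z hz u v)
  have := congrArg (fun L ↦ L w) (h1.unique h3)
  simp at this
  rw [this]
  ring

/-- The Christoffel symbols of a warped product. -/
lemma christoffel_eq (h : IsWarpedOn ε G H s k) {y : Euc (d + 1)} (hy : y ∈ slab d ε)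
    (u v : Euc (d + 1)) :
    christoffel G y u v = incl d (christoffelBilin H (tail d y) (tail d u) (tail d v)
        + k (head d y) • (head d u • tail d v + head d v • tail d u))
      - (k (head d y) * s (head d y) * H (tail d y) (tail d u) (tail d v)) • e₀ d := by
  rw [h.metric.christoffel_eq_iff hy]
  intro w
  have h1 := (h.base.christoffel_eq_iff (mem_univ (tail d y)) (tail d u) (tail d v) _).1 rfl
    (tail d w)
  rw [christoffelFirst_apply] at h1
  rw [h.eq y hy, christoffelFirst_apply, h.fderiv_metric hy, h.fderiv_metric hy,
    h.fderiv_metric hy, christoffelBilin_apply]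
  simp only [map_sub, map_smul, head_incl, tail_incl, head_e₀, tail_e₀, map_add, h1,
    _root_.add_apply, _root_.smul_apply, smul_eq_mul, smul_zero, sub_zero]
  ring

lemma head_christoffel (h : IsWarpedOn ε G H s k) {y : Euc (d + 1)} (hy : y ∈ slab d ε)
    (u v : Euc (d + 1)) :
    head d (christoffel G y u v)
      = -(k (head d y) * s (head d y) * H (tail d y) (tail d u) (tail d v)) := by
  rw [h.christoffel_eq hy]
  simp

lemma tail_christoffel (h : IsWarpedOn ε G H s k) {y : Euc (d + 1)} (hy : y ∈ slab d ε)
    (u v : Euc (d + 1)) :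
    tail d (christoffel G y u v) = christoffelBilin H (tail d y) (tail d u) (tail d v)
        + k (head d y) • (head d u • tail d v + head d v • tail d u) := by
  rw [h.christoffel_eq hy]
  simp

lemma differentiableAt_christoffel (h : IsWarpedOn ε G H s k) {y : Euc (d + 1)}
    (hy : y ∈ slab d ε) (v w : Euc (d + 1)) :
    DifferentiableAt ℝ (fun z ↦ christoffel G z v w) y := by
  have := ((h.metric.differentiableAt_christoffelBilin hy).hasFDerivAt.clm_apply
    (hasFDerivAt_const v y)).clm_apply (hasFDerivAt_const w y)
  simp only [christoffelBilin_apply] at this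
  exact this.differentiableAt

lemma head_fderiv_christoffel (h : IsWarpedOn ε G H s k) {y : Euc (d + 1)} (hy : y ∈ slab d ε)
    (u v w : Euc (d + 1)) :
    head d (fderiv ℝ (fun z ↦ christoffel G z v w) y u)
      = -(head d u * (deriv k (head d y) + 2 * k (head d y) ^ 2) * s (head d y)
            * H (tail d y) (tail d v) (tail d w)
          + k (head d y) * s (head d y)
            * fderiv ℝ H (tail d y) (tail d u) (tail d v) (tail d w)) := by
  have h1 := (head d).hasFDerivAt.comp y (h.differentiableAt_christoffel hy v w).hasFDerivAt
  have hs : HasFDerivAt (fun y ↦ s (head d y))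
      ((2 * k (head d y) * s (head d y)) • head d) y :=
    (h.hasDerivAt_s _ hy).comp_hasFDerivAt y (head d).hasFDerivAt
  have hk : HasFDerivAt (fun y ↦ k (head d y)) ((deriv k (head d y)) • head d) y :=
    (h.differentiableAt_k _ hy).hasDerivAt.comp_hasFDerivAt y (head d).hasFDerivAt
  have hH := ((((h.base.differentiableAt (mem_univ (tail d y))).hasFDerivAt.comp y
    (tail d).hasFDerivAt).clm_apply (hasFDerivAt_const (tail d v) y)).clm_apply
      (hasFDerivAt_const (tail d w) y))
  have h2 := ((hk.mul hs).mul hH).neg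
  have h3 := h2.congr_of_eventuallyEq (f₁ := fun z ↦ head d (christoffel G z v w))
    (Filter.eventually_of_mem ((isOpen_slab ε).mem_nhds hy) fun z hz ↦ h.head_christoffel hz v w)
  have := congrArg (fun L ↦ L u) (h1.unique h3)
  simp at this
  rw [this]
  ring

lemma tail_fderiv_christoffel (h : IsWarpedOn ε G H s k) {y : Euc (d + 1)} (hy : y ∈ slab d ε)
    (u v w : Euc (d + 1)) :
    tail d (fderiv ℝ (fun z ↦ christoffel G z v w) y u)
      = fderiv ℝ (christoffelBilin H) (tail d y) (tail d u) (tail d v) (tail d w)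
        + (head d u * deriv k (head d y)) • (head d v • tail d w + head d w • tail d v) := by
  have h1 := (tail d).hasFDerivAt.comp y (h.differentiableAt_christoffel hy v w).hasFDerivAt
  have hk : HasFDerivAt (fun y ↦ k (head d y)) ((deriv k (head d y)) • head d) y :=
    (h.differentiableAt_k _ hy).hasDerivAt.comp_hasFDerivAt y (head d).hasFDerivAt
  have hH := ((((h.base.differentiableAt_christoffelBilin (mem_univ (tail d y))).hasFDerivAt.comp y
    (tail d).hasFDerivAt).clm_apply (hasFDerivAt_const (tail d v) y)).clm_apply
      (hasFDerivAt_const (tail d w) y))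
  have h2 := hH.add (hk.smul_const (head d v • tail d w + head d w • tail d v))
  have h3 := h2.congr_of_eventuallyEq (f₁ := fun z ↦ tail d (christoffel G z v w))
    (Filter.eventually_of_mem ((isOpen_slab ε).mem_nhds hy) fun z hz ↦ h.tail_christoffel hz v w)
  have := congrArg (fun L ↦ L u) (h1.unique h3)
  simp at this
  rw [this, mul_comm (head d u)]
  simp

/-- Writing `s = a²`, one has `k = a'/a` and `deriv k + k² = a''/a`. Only this component and the
tail of `R(incl a, v)w` enter the trace that defines the Ricci curvature. -/
lemma head_curvature_e₀ (h : IsWarpedOn ε G H s k) {y : Euc (d + 1)} (hy : y ∈ slab d ε)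
    (v w : Euc (d + 1)) :
    head d (curvature G y (e₀ d) v w)
      = -((deriv k (head d y) + k (head d y) ^ 2) * s (head d y)
          * H (tail d y) (tail d v) (tail d w)) := by
  simp only [curvature, map_sub, map_add, h.head_fderiv_christoffel hy, h.head_christoffel hy,
    h.tail_christoffel hy, head_e₀, tail_e₀, map_zero, _root_.zero_apply, map_smul,
    smul_eq_mul]
  simp only [zero_add, add_zero, one_mul, mul_zero, neg_zero]
  ring

lemma tail_curvature_incl (h : IsWarpedOn ε G H s k) {y : Euc (d + 1)} (hy : y ∈ slab d ε)
    (a : Euc d) (v w : Euc (d + 1)) :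
    tail d (curvature G y (incl d a) v w)
      = curvature H (tail d y) a (tail d v) (tail d w)
        - ((deriv k (head d y) + k (head d y) ^ 2) * (head d v * head d w)) • a
        - (k (head d y) ^ 2 * s (head d y)) •
          (H (tail d y) (tail d v) (tail d w) • a - H (tail d y) a (tail d w) • tail d v) := by
  have hsym : ∀ b c, christoffelBilin H (tail d y) b c = christoffelBilin H (tail d y) c b := by
    intro b c
    simp only [christoffelBilin_apply]
    exact h.base.christoffel_symm (mem_univ _) b c
  rw [h.base.curvature_eq (mem_univ _)]
  simp only [curvature, map_sub, map_add, h.tail_fderiv_christoffel hy, h.head_christoffel hy,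
    h.tail_christoffel hy, head_incl, tail_incl, map_smul]
  rw [hsym a (tail d v)]
  module

/-- The Ricci curvature of a warped product. -/
theorem ricci_eq (h : IsWarpedOn ε G H s k) {y : Euc (d + 1)} (hy : y ∈ slab d ε)
    (v w : Euc (d + 1)) :
    ricci G y v w = ricci H (tail d y) (tail d v) (tail d w)
      - ((deriv k (head d y) + k (head d y) ^ 2) + (d - 1) * k (head d y) ^ 2) * s (head d y)
          * H (tail d y) (tail d v) (tail d w)
      - d * (deriv k (head d y) + k (head d y) ^ 2) * (head d v * head d w) := by
  have hi : ∀ i : Fin d, (EuclideanSpace.single i.succ 1 : Euc (d + 1))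
      = incl d (EuclideanSpace.single i 1) := by
    intro i
    ext j
    refine Fin.cases ?_ (fun l ↦ ?_) j
    · simp [incl_zero]
    · simp [incl_succ, Fin.succ_inj]
  have h0 : curvature G y (EuclideanSpace.single 0 1) v w 0
      = head d (curvature G y (e₀ d) v w) := rfl
  have hS : ∀ i : Fin d, curvature G y (EuclideanSpace.single i.succ 1) v w i.succ
      = tail d (curvature G y (incl d (EuclideanSpace.single i 1)) v w) i := by
    intro i
    rw [hi]; rfl
  -- The trace of `a ↦ H(a, w) v` is `H(v, w)`. Subtracted from the trace `d H(v, w)` of `a ↦ H(v,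
  -- w) a`, it produces the factor `d - 1`.
  have hsum : ∑ i : Fin d, H (tail d y) (EuclideanSpace.single i 1) (tail d w) * tail d v i
      = H (tail d y) (tail d v) (tail d w) := by
    have : tail d v = ∑ i : Fin d, tail d v i • (EuclideanSpace.single i 1 : Euc d) := by
      ext j
      simp [Pi.single_apply]
    conv_rhs => rw [this, map_sum]
    simp [mul_comm]
  rw [ricci, Fin.sum_univ_succ, h0, h.head_curvature_e₀ hy]
  simp only [hS, h.tail_curvature_incl hy]
  simp only [PiLp.sub_apply, PiLp.smul_apply, smul_eq_mul, PiLp.single_apply,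
    if_true, mul_one, Finset.sum_sub_distrib, ← Finset.mul_sum, hsum]
  rw [← ricci]
  simp
  ring

end IsWarpedOn

end Coord

/-! ### `f`-cosymplectic structures in coordinates -/

namespace Coord

open Euc Set

/-- The two-form `(X, Y) ↦ G(AX, Y)`. -/
def twoForm {m : ℕ} (G : Euc m → Euc m →L[ℝ] Euc m →L[ℝ] ℝ) (A : Euc m → Euc m →L[ℝ] Euc m)
    (y : Euc m) : Euc m →L[ℝ] Euc m →L[ℝ] ℝ :=
  (G y).comp (A y)

lemma twoForm_apply {m : ℕ} (G : Euc m → Euc m →L[ℝ] Euc m →L[ℝ] ℝ)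
    (A : Euc m → Euc m →L[ℝ] Euc m) (y u v : Euc m) : twoForm G A y u v = G y (A y u) v := rfl

/-- An `f`-cosymplectic structure on an open subset of `ℝ^m`. -/
structure IsFCosymplecticOn {m : ℕ} (G : Euc m → Euc m →L[ℝ] Euc m →L[ℝ] ℝ)
    (A : Euc m → Euc m →L[ℝ] Euc m) (V : Euc m → Euc m) (α : Euc m → Euc m →L[ℝ] ℝ)
    (f : Euc m → ℝ) (W : Set (Euc m)) : Prop where
  metric : IsMetricOn G W
  smooth_A : ContDiffOn ℝ ∞ A W
  smooth_V : ContDiffOn ℝ ∞ V W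
  smooth_α : ContDiffOn ℝ ∞ α W
  smooth_f : ContDiffOn ℝ ∞ f W
  A_sq : ∀ y ∈ W, ∀ v, A y (A y v) = -v + α y v • V y
  α_A : ∀ y ∈ W, ∀ v, α y (A y v) = 0
  A_V : ∀ y ∈ W, A y (V y) = 0
  α_V : ∀ y ∈ W, α y (V y) = 1
  compat : ∀ y ∈ W, ∀ v w, G y (A y v) (A y w) = G y v w - α y v * α y w
  df_wedge : ∀ y ∈ W, ∀ u v, fderiv ℝ f y u * α y v - fderiv ℝ f y v * α y u = 0
  closed : ∀ y ∈ W, ∀ u v, dOne α y u v = 0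
  d_omega : ∀ y ∈ W, ∀ u v w,
    dTwo (twoForm G A) y u v w = 2 * f y * wedgeOneTwo (α y) (twoForm G A y) u v w
  normal : ∀ y ∈ W, ∀ u v, nijenhuis A y u v + dOne α y u v • V y = 0

namespace IsFCosymplecticOn

/-! ### Pointwise identities and transport to new coordinates. -/

section General

variable {m : ℕ} {G : Euc m → Euc m →L[ℝ] Euc m →L[ℝ] ℝ}
    {A : Euc m → Euc m →L[ℝ] Euc m} {V : Euc m → Euc m} {α : Euc m → Euc m →L[ℝ] ℝ}
    {f : Euc m → ℝ} {W : Set (Euc m)}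

lemma differentiableAt_A (h : IsFCosymplecticOn G A V α f W) {y : Euc m} (hy : y ∈ W) :
    DifferentiableAt ℝ A y :=
  (h.smooth_A.contDiffAt (h.metric.isOpen.mem_nhds hy)).differentiableAt (by simp)

lemma differentiableAt_twoForm (h : IsFCosymplecticOn G A V α f W) {y : Euc m} (hy : y ∈ W) :
    DifferentiableAt ℝ (twoForm G A) y :=
  (h.metric.differentiableAt hy).clm_comp (h.differentiableAt_A hy)

lemma fderiv_twoForm (h : IsFCosymplecticOn G A V α f W) {y : Euc m} (hy : y ∈ W)
    (w u v : Euc m) : fderiv ℝ (twoForm G A) y w u v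
      = fderiv ℝ G y w (A y u) v + G y (fderiv ℝ A y w u) v := by
  have h1 := ((h.differentiableAt_twoForm hy).hasFDerivAt.clm_apply
    (hasFDerivAt_const (𝕜 := ℝ) u y)).clm_apply (hasFDerivAt_const (𝕜 := ℝ) v y)
  have h2 := ((h.metric.differentiableAt hy).hasFDerivAt.clm_apply
    ((h.differentiableAt_A hy).hasFDerivAt.clm_apply (hasFDerivAt_const (𝕜 := ℝ) u y))).clm_apply
      (hasFDerivAt_const (𝕜 := ℝ) v y)
  have := congrArg (fun L ↦ L w) (h1.unique h2)
  simp at this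
  rw [this]
  ring

/-- Compatibility with `V` in the second slot, where `A V = 0`: the Reeb field is metrically dual to
`α`. -/
lemma metric_V (h : IsFCosymplecticOn G A V α f W) {y : Euc m} (hy : y ∈ W) (v : Euc m) :
    G y v (V y) = α y v := by
  have := h.compat y hy v (V y)
  rw [h.A_V y hy, map_zero, h.α_V y hy] at this
  linarith

lemma metric_V' (h : IsFCosymplecticOn G A V α f W) {y : Euc m} (hy : y ∈ W) (v : Euc m) :
    G y (V y) v = α y v := by
  rw [h.metric.symm y hy, h.metric_V hy]

lemma twoForm_anti (h : IsFCosymplecticOn G A V α f W) {y : Euc m} (hy : y ∈ W) (u v : Euc m) :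
    twoForm G A y u v = -twoForm G A y v u := by
  rw [twoForm_apply, twoForm_apply]
  have := h.compat y hy u (A y v)
  rw [h.A_sq y hy, h.α_A y hy, map_add, map_neg, map_smul, h.metric_V hy, h.α_A y hy] at this
  rw [h.metric.symm y hy (A y v)]
  simp at this
  linarith

/-- An `f`-cosymplectic structure in new coordinates. -/
lemma change (h : IsFCosymplecticOn G A V α f W) {Ψ : Euc m → Euc m} {W' : Set (Euc m)}
    {G' : Euc m → Euc m →L[ℝ] Euc m →L[ℝ] ℝ}
    {A' : Euc m → Euc m →L[ℝ] Euc m} {V' : Euc m → Euc m} {α' : Euc m → Euc m →L[ℝ] ℝ}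
    (hmaps : MapsTo Ψ W' W) (hΨ : ContDiffOn ℝ ∞ Ψ W') (hG's : IsMetricOn G' W')
    (hA's : ContDiffOn ℝ ∞ A' W') (hV's : ContDiffOn ℝ ∞ V' W') (hα's : ContDiffOn ℝ ∞ α' W')
    (hG : ∀ z ∈ W', ∀ u v, G' z u v = G (Ψ z) (fderiv ℝ Ψ z u) (fderiv ℝ Ψ z v))
    (hA : ∀ z ∈ W', ∀ u, fderiv ℝ Ψ z (A' z u) = A (Ψ z) (fderiv ℝ Ψ z u))
    (hV : ∀ z ∈ W', fderiv ℝ Ψ z (V' z) = V (Ψ z))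
    (hα : ∀ z ∈ W', ∀ u, α' z u = α (Ψ z) (fderiv ℝ Ψ z u)) :
    IsFCosymplecticOn G' A' V' α' (f ∘ Ψ) W' := by
  have hW' := hG's.isOpen
  -- Vector identities for the new tensors are checked after applying the injective differential of
  -- `Ψ`.
  have hinj : ∀ z ∈ W', ∀ u v, fderiv ℝ Ψ z u = fderiv ℝ Ψ z v → u = v := by
    intro z hz u v huv
    obtain ⟨e, he⟩ := exists_equiv_of_isometry (Ψ := Ψ) hG's hz (hG z hz)
    exact e.injective (by rw [he, he, huv])
  have hdf : ∀ {X : Type} [NormedAddCommGroup X] [NormedSpace ℝ X] {F : Euc m → X}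
      {O : Set (Euc m)} (_ : IsOpen O) (_ : ContDiffOn ℝ ∞ F O) {y : Euc m} (_ : y ∈ O),
      DifferentiableAt ℝ F y := fun hO hF y hy ↦
    (hF.contDiffAt (hO.mem_nhds hy)).differentiableAt (by simp)
  have hdOne : ∀ z ∈ W', ∀ u v, dOne α' z u v = 0 := by
    intro z hz u v
    rw [dOne_change hW' hΨ hz (hdf hW' hα's hz) (hdf h.metric.isOpen h.smooth_α (hmaps hz)) hα]
    exact h.closed _ (hmaps hz) _ _
  have h2 : ∀ z ∈ W', ∀ u v, twoForm G' A' z u v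
      = twoForm G A (Ψ z) (fderiv ℝ Ψ z u) (fderiv ℝ Ψ z v) := by
    intro z hz u v
    rw [twoForm_apply, twoForm_apply, hG z hz, hA z hz]
  refine ⟨hG's, hA's, hV's, hα's, h.smooth_f.comp hΨ hmaps, ?_, ?_, ?_, ?_, ?_, ?_, hdOne, ?_, ?_⟩
  · intro z hz v
    apply hinj z hz
    rw [hA z hz, hA z hz, h.A_sq _ (hmaps hz), map_add, map_neg, map_smul, hV z hz, hα z hz]
  · intro z hz v
    rw [hα z hz, hA z hz, h.α_A _ (hmaps hz)]
  · intro z hz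
    apply hinj z hz
    rw [hA z hz, hV z hz, h.A_V _ (hmaps hz), map_zero]
  · intro z hz
    rw [hα z hz, hV z hz, h.α_V _ (hmaps hz)]
  · intro z hz v w
    rw [hG z hz, hG z hz, hA z hz, hA z hz, h.compat _ (hmaps hz), hα z hz, hα z hz]
  · intro z hz u v
    rw [fderiv_comp z (hdf h.metric.isOpen h.smooth_f (hmaps hz)) (hdf hW' hΨ hz), hα z hz,
      hα z hz]
    exact h.df_wedge _ (hmaps hz) _ _
  · intro z hz u v w
    have hd : DifferentiableAt ℝ (twoForm G' A') z :=
      (hG's.differentiableAt hz).clm_comp (hdf hW' hA's hz)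
    rw [dTwo_change hW' hΨ hz hd (h.differentiableAt_twoForm (hmaps hz))
      (h.twoForm_anti (hmaps hz)) h2, h.d_omega _ (hmaps hz)]
    simp only [wedgeOneTwo, hα z hz, h2 z hz, Function.comp]
  · intro z hz u v
    rw [hdOne z hz, zero_smul, add_zero]
    apply hinj z hz
    rw [nijenhuis_change hW' hΨ hz (hdf hW' hA's hz) (h.differentiableAt_A (hmaps hz)) hA, map_zero]
    have := h.normal _ (hmaps hz) (fderiv ℝ Ψ z u) (fderiv ℝ Ψ z v)
    rwa [h.closed _ (hmaps hz), zero_smul, add_zero] at this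

end General

/-! ### Coordinates in which the Reeb field is `e₀` and the contact form is `head`. -/

section Adapted

variable {d : ℕ} {ε : ℝ} {G : Euc (d + 1) → Euc (d + 1) →L[ℝ] Euc (d + 1) →L[ℝ] ℝ}
    {A : Euc (d + 1) → Euc (d + 1) →L[ℝ] Euc (d + 1)} {f : Euc (d + 1) → ℝ}

lemma mem_slab_smul_add {t : ℝ} (ht : t ∈ Ioo (-ε) ε) (x : Euc d) :
    t • e₀ d + incl d x ∈ slab d ε := by
  refine mem_preimage.2 ?_
  simpa using ht

lemma incl_mem_slab (hε : 0 < ε) (x : Euc d) : incl d x ∈ slab d ε := by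
  refine mem_preimage.2 ?_
  simpa using hε

/-- A function on a slab with vanishing derivative in the first direction does not depend on the
first coordinate. -/
lemma eq_of_fderiv_e₀_eq_zero {X : Type} [NormedAddCommGroup X] [NormedSpace ℝ X]
    {F : Euc (d + 1) → X} (hε : 0 < ε) (hF : ∀ y ∈ slab d ε, DifferentiableAt ℝ F y)
    (h0 : ∀ y ∈ slab d ε, fderiv ℝ F y (e₀ d) = 0) {y : Euc (d + 1)} (hy : y ∈ slab d ε) :
    F y = F (incl d (tail d y)) := by
  have hder : ∀ t ∈ Ioo (-ε) ε,
      HasDerivAt (fun t : ℝ ↦ F (t • e₀ d + incl d (tail d y))) 0 t := by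
    intro t ht
    have h1 : HasDerivAt (fun t : ℝ ↦ t • e₀ d + incl d (tail d y)) (e₀ d) t := by
      simpa using ((hasDerivAt_id t).smul_const (e₀ d)).add_const (incl d (tail d y))
    have hmem := mem_slab_smul_add ht (tail d y)
    have h2 := (hF _ hmem).hasFDerivAt.comp_hasDerivAt t h1
    rwa [h0 _ hmem] at h2
  have h := isOpen_Ioo.is_const_of_deriv_eq_zero isPreconnected_Ioo
    (fun t ht ↦ (hder t ht).differentiableAt.differentiableWithinAt)
    (fun t ht ↦ (hder t ht).deriv) (x := head d y) (y := 0) hy ⟨by linarith, hε⟩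
  simpa [head_smul_add_incl_tail] using h

/-- With `dη = 0` and `A e₀ = 0`, normality on the pair `(e₀, v)` reduces to `A ((∂₀A) v) = 0`. As
`A` takes values in `ker η`, so does `(∂₀A) v`, and on `ker η` one has `A² = -1`. -/
lemma fderiv_A_e₀ (h : IsFCosymplecticOn G A (fun _ ↦ e₀ d) (fun _ ↦ head d) f (slab d ε))
    {y : Euc (d + 1)} (hy : y ∈ slab d ε) : fderiv ℝ A y (e₀ d) = 0 := by
  have hA := h.differentiableAt_A hy
  have hnh := (isOpen_slab (d := d) ε).mem_nhds hy
  have h1 : ∀ w, fderiv ℝ A y w (e₀ d) = 0 := by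
    intro w
    have e1 := hA.hasFDerivAt.clm_apply (hasFDerivAt_const (𝕜 := ℝ) (e₀ d) y)
    have e2 := (hasFDerivAt_const (𝕜 := ℝ) (0 : Euc (d + 1)) y).congr_of_eventuallyEq
      (f₁ := fun z ↦ A z (e₀ d)) (Filter.eventually_of_mem hnh fun z hz ↦ h.A_V z hz)
    have := congrArg (fun L ↦ L w) (e1.unique e2)
    simpa using this
  have h2 : ∀ w v, head d (fderiv ℝ A y w v) = 0 := by
    intro w v
    have e1 := (head d).hasFDerivAt.comp y (hA.hasFDerivAt.clm_apply (hasFDerivAt_const (𝕜 := ℝ) v y))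
    have e2 := (hasFDerivAt_const (𝕜 := ℝ) (0 : ℝ) y).congr_of_eventuallyEq
      (f₁ := fun z ↦ head d (A z v)) (Filter.eventually_of_mem hnh fun z hz ↦ h.α_A z hz v)
    have := congrArg (fun L ↦ L w) (e1.unique e2)
    simpa using this
  ext1 v
  have h3 := h.normal y hy (e₀ d) v
  rw [h.closed y hy, zero_smul, add_zero, nijenhuis_eq hA, h.A_V y hy, h1, h1] at h3
  simp only [map_zero, _root_.zero_apply, sub_zero, zero_add, zero_sub, neg_eq_zero] at h3
  have h4 := h.A_sq y hy (fderiv ℝ A y (e₀ d) v)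
  rw [h3, map_zero, h2, zero_smul, add_zero] at h4
  simpa using h4.symm

/-- Contracting `dω = 2f η ∧ ω` with `e₀` gives `∂₀ω = 2f ω`, because `ω` and its derivatives vanish
when `e₀` is an argument. Since `∂₀A = 0`, this reads `(∂₀G)(Av, w) = 2f G(Av, w)`; taking `v = A u`
and using `A² = -1 + η ⊗ ξ` removes `A`. -/
lemma fderiv_G_e₀ (h : IsFCosymplecticOn G A (fun _ ↦ e₀ d) (fun _ ↦ head d) f (slab d ε))
    {y : Euc (d + 1)} (hy : y ∈ slab d ε) (u v : Euc (d + 1)) :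
    fderiv ℝ G y (e₀ d) u v = 2 * f y * (G y u v - head d u * head d v) := by
  have hnh := (isOpen_slab (d := d) ε).mem_nhds hy
  have hΩ := (h.differentiableAt_twoForm hy).hasFDerivAt
  have h1 : ∀ w v, fderiv ℝ (twoForm G A) y w v (e₀ d) = 0 := by
    intro w v
    have e1 := (hΩ.clm_apply (hasFDerivAt_const (𝕜 := ℝ) v y)).clm_apply (hasFDerivAt_const (𝕜 := ℝ) (e₀ d) y)
    have e2 := (hasFDerivAt_const (𝕜 := ℝ) (0 : ℝ) y).congr_of_eventuallyEq
      (f₁ := fun z ↦ twoForm G A z v (e₀ d))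
      (Filter.eventually_of_mem hnh fun z hz ↦ (h.metric_V hz _).trans (h.α_A z hz v))
    have := congrArg (fun L ↦ L w) (e1.unique e2)
    simpa using this
  have h2 : ∀ w v, fderiv ℝ (twoForm G A) y w (e₀ d) v = 0 := by
    intro w v
    have e1 := (hΩ.clm_apply (hasFDerivAt_const (𝕜 := ℝ) (e₀ d) y)).clm_apply (hasFDerivAt_const (𝕜 := ℝ) v y)
    have e2 := (hasFDerivAt_const (𝕜 := ℝ) (0 : ℝ) y).congr_of_eventuallyEq
      (f₁ := fun z ↦ twoForm G A z (e₀ d) v)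
      (Filter.eventually_of_mem hnh fun z hz ↦ by simp [twoForm_apply, h.A_V z hz])
    have := congrArg (fun L ↦ L w) (e1.unique e2)
    simpa using this
  have h3 : ∀ v, fderiv ℝ G y (e₀ d) (e₀ d) v = 0 := by
    intro v
    have e1 := ((h.metric.differentiableAt hy).hasFDerivAt.clm_apply
      (hasFDerivAt_const (𝕜 := ℝ) (e₀ d) y)).clm_apply (hasFDerivAt_const (𝕜 := ℝ) v y)
    have e2 := (hasFDerivAt_const (𝕜 := ℝ) (head d v) y).congr_of_eventuallyEq
      (f₁ := fun z ↦ G z (e₀ d) v)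
      (Filter.eventually_of_mem hnh fun z hz ↦ h.metric_V' hz v)
    have := congrArg (fun L ↦ L (e₀ d)) (e1.unique e2)
    simpa using this
  have h4 : ∀ v w, fderiv ℝ G y (e₀ d) (A y v) w = 2 * f y * G y (A y v) w := by
    intro v w
    have := h.d_omega y hy (e₀ d) v w
    rw [dTwo, h1, h2, wedgeOneTwo, head_e₀, twoForm_apply G A y w, twoForm_apply G A y (e₀ d),
      h.A_V y hy, h.metric_V hy, h.α_A y hy, h.fderiv_twoForm hy, h.fderiv_A_e₀ hy] at this
    simpa [twoForm_apply] using this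
  have h5 := h4 (A y u) v
  rw [h.A_sq y hy] at h5
  simp only [map_add, map_neg, map_smul, _root_.add_apply, _root_.neg_apply, _root_.smul_apply,
    h3, h.metric_V' hy, smul_eq_mul] at h5
  linarith

/-- The function `f` depends on the first coordinate only. -/
lemma f_eq (h : IsFCosymplecticOn G A (fun _ ↦ e₀ d) (fun _ ↦ head d) f (slab d ε))
    {y : Euc (d + 1)} (hy : y ∈ slab d ε) : f y = f (head d y • e₀ d) := by
  have hf : ∀ z ∈ slab d ε, DifferentiableAt ℝ f z := fun z hz ↦
    (h.smooth_f.contDiffAt ((isOpen_slab ε).mem_nhds hz)).differentiableAt (by simp)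
  -- On the pair `(incl a, e₀)` the condition `df ∧ η = 0` kills the derivative along the slice,
  -- which is all of `ℝ^d` and hence connected.
  have hder : ∀ x : Euc d, HasFDerivAt (fun x ↦ f (head d y • e₀ d + incl d x))
      (0 : Euc d →L[ℝ] ℝ) x := by
    intro x
    have hmem := mem_slab_smul_add (t := head d y) hy x
    refine ((hf _ hmem).hasFDerivAt.comp x
      ((incl d).hasFDerivAt.const_add (head d y • e₀ d))).congr_fderiv ?_
    ext1 a
    have := h.df_wedge _ hmem (incl d a) (e₀ d)
    simpa using this
  have := is_const_of_fderiv_eq_zero (fun x ↦ (hder x).differentiableAt)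
    (fun x ↦ (hder x).fderiv) (tail d y) 0
  simpa [head_smul_add_incl_tail] using this

lemma isMetricOn_slice (hG : IsMetricOn G (slab d ε)) (hε : 0 < ε) :
    ∃ H : Euc d → Euc d →L[ℝ] Euc d →L[ℝ] ℝ, IsMetricOn H univ ∧
      ∀ x u v, H x u v = G (incl d x) (incl d u) (incl d v) := by
  refine ⟨fun x ↦ (ContinuousLinearMap.precomp ℝ (incl d)).comp ((G (incl d x)).comp (incl d)),
    ⟨isOpen_univ, ?_, ?_, ?_⟩, fun _ _ _ ↦ rfl⟩
  · have h1 : ContDiff ℝ ∞ (fun x ↦ G (incl d x)) := contDiffOn_univ.1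
      (hG.smooth.comp (incl d).contDiff.contDiffOn fun x _ ↦ incl_mem_slab hε x)
    exact (contDiff_const.clm_comp (h1.clm_comp contDiff_const)).contDiffOn
  · exact fun x _ u v ↦ hG.symm _ (incl_mem_slab hε x) _ _
  · intro x _ v hv
    refine hG.pos _ (incl_mem_slab hε x) _ fun h0 ↦ hv ?_
    have := congrArg (tail d) h0
    simpa using this

/-- In adapted coordinates an `f`-cosymplectic metric is a warped product. -/
lemma exists_isWarpedOn (h : IsFCosymplecticOn G A (fun _ ↦ e₀ d) (fun _ ↦ head d) f (slab d ε))
    (hε : 0 < ε) {H : Euc d → Euc d →L[ℝ] Euc d →L[ℝ] ℝ}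
    (hH : IsMetricOn H univ) (hHG : ∀ x u v, H x u v = G (incl d x) (incl d u) (incl d v)) :
    ∃ s : ℝ → ℝ, (∀ t, 0 < s t) ∧ IsWarpedOn ε G H s (fun t ↦ f (t • e₀ d)) := by
  let k : ℝ → ℝ := fun t ↦ f (t • e₀ d)
  have hmem : ∀ t ∈ Ioo (-ε) ε, t • e₀ d ∈ slab d ε := fun t ht ↦ by
    simpa using mem_slab_smul_add ht (0 : Euc d)
  have hkd : ∀ t ∈ Ioo (-ε) ε, DifferentiableAt ℝ k t := by
    intro t ht
    have h1 : DifferentiableAt ℝ f (t • e₀ d) :=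
      (h.smooth_f.contDiffAt ((isOpen_slab ε).mem_nhds (hmem t ht))).differentiableAt (by simp)
    exact h1.comp t (differentiableAt_id.smul_const (e₀ d))
  -- `B = G - dt²` solves the linear equation `∂_t B = 2 k(t) B`. The integrating factor is the
  -- exponential of `-2 (K t - K 0)` with `K' = k`; subtracting `K 0` normalizes `s 0 = 1`, so that
  -- `H` is the metric of the slice `t = 0`.
  obtain ⟨K, hK⟩ := (convex_Ioo (-ε) ε).exists_forall_hasDerivWithinAt
    (fun t ht ↦ (hkd t ht).differentiableWithinAt)
  have hK' : ∀ t ∈ Ioo (-ε) ε, HasDerivAt K (k t) t :=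
    fun t ht ↦ (hK t ht).hasDerivAt (isOpen_Ioo.mem_nhds ht)
  have hs : ∀ t ∈ Ioo (-ε) ε, HasDerivAt (fun t ↦ Real.exp (2 * (K t - K 0)))
      (2 * k t * Real.exp (2 * (K t - K 0))) t := by
    intro t ht
    refine ((((hK' t ht).sub_const (K 0)).const_mul 2).exp).congr_deriv ?_
    ring
  refine ⟨fun t ↦ Real.exp (2 * (K t - K 0)), fun t ↦ Real.exp_pos _, h.metric, hH, ?_, hs, hkd⟩
  intro y hy u v
  let F : Euc (d + 1) → ℝ := fun z ↦
    Real.exp (-(2 * (K (head d z) - K 0))) * (G z u v - head d u * head d v)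
  have hF : ∀ z ∈ slab d ε, HasFDerivAt F
      (Real.exp (-(2 * (K (head d z) - K 0))) • ((fderiv ℝ G z).flip u).flip v
        + (G z u v - head d u * head d v) • ((Real.exp (-(2 * (K (head d z) - K 0)))
          * -(2 * k (head d z))) • head d)) z := by
    intro z hz
    have h1 : HasFDerivAt (fun z ↦ Real.exp (-(2 * (K (head d z) - K 0))))
        ((Real.exp (-(2 * (K (head d z) - K 0))) * -(2 * k (head d z))) • head d) z :=
      ((((hK' _ hz).sub_const (K 0)).const_mul 2).neg.exp).comp_hasFDerivAt z (head d).hasFDerivAt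
    have h2 := (((h.metric.differentiableAt hz).hasFDerivAt.clm_apply
      (hasFDerivAt_const (𝕜 := ℝ) u z)).clm_apply (hasFDerivAt_const (𝕜 := ℝ) v z)).sub_const (head d u * head d v)
    refine (h1.mul h2).congr_fderiv ?_
    ext1 w
    simp
  have hF0 : F y = F (incl d (tail d y)) := by
    refine eq_of_fderiv_e₀_eq_zero hε (fun z hz ↦ (hF z hz).differentiableAt) (fun z hz ↦ ?_) hy
    rw [(hF z hz).fderiv]
    have hfk : f z = k (head d z) := h.f_eq hz
    simp only [_root_.add_apply, _root_.smul_apply, ContinuousLinearMap.flip_apply, head_e₀,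
      smul_eq_mul, mul_one, h.fderiv_G_e₀ hz, hfk]
    ring
  have hslice : G (incl d (tail d y)) u v - head d u * head d v
      = H (tail d y) (tail d u) (tail d v) := by
    have hm := incl_mem_slab hε (tail d y)
    rw [hHG]
    conv_lhs => rw [← head_smul_add_incl_tail u, ← head_smul_add_incl_tail v]
    simp only [map_add, map_smul, _root_.add_apply, _root_.smul_apply, h.metric_V' hm,
      h.metric_V hm, head_incl, head_e₀, smul_eq_mul]
    ring
  simp only [F, head_incl, sub_self, mul_zero, neg_zero, Real.exp_zero, one_mul, hslice] at hF0
  have hexp : Real.exp (2 * (K (head d y) - K 0)) * Real.exp (-(2 * (K (head d y) - K 0))) = 1 := by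
    rw [← Real.exp_add]; simp
  rw [← hF0, ← mul_assoc, hexp]
  ring

end Adapted

end IsFCosymplecticOn

end Coord

/-! ### Rigidity in adapted coordinates -/

namespace Coord

open Euc Set

/-- The two ordinary differential equations satisfied by the warping function of a soliton only
have the trivial solution. -/
lemma eq_zero_of_warped_soliton {ε d lam c : ℝ} {k s : ℝ → ℝ} (hε : 0 < ε) (hd : d ≠ 0)
    (hk : ∀ t ∈ Ioo (-ε) ε, DifferentiableAt ℝ k t) (hs0 : ∀ t, 0 < s t)
    (hs : ∀ t ∈ Ioo (-ε) ε, HasDerivAt s (2 * k t * s t) t)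
    (h1 : ∀ t ∈ Ioo (-ε) ε, -d * (deriv k t + k t ^ 2) = lam)
    (h2 : ∀ t ∈ Ioo (-ε) ε,
      s t * (lam - k t + ((deriv k t + k t ^ 2) + (d - 1) * k t ^ 2)) = c) :
    lam = 0 ∧ ∀ t ∈ Ioo (-ε) ε, k t = 0 ∧ deriv k t = 0 := by
  -- With `λ = d q` the radial equation becomes the Riccati equation `k' = -k² - q`.
  obtain ⟨q, rfl⟩ : ∃ q, lam = d * q := ⟨lam / d, by field_simp⟩
  have hk' : ∀ t ∈ Ioo (-ε) ε, deriv k t = -k t ^ 2 - q := by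
    intro t ht
    have : d * (deriv k t + k t ^ 2 + q) = 0 := by linarith [h1 t ht]
    rcases mul_eq_zero.1 this with h | h
    · exact absurd h hd
    · linarith
  have hkd : ∀ t ∈ Ioo (-ε) ε, HasDerivAt k (-k t ^ 2 - q) t := fun t ht ↦
    hk' t ht ▸ (hk t ht).hasDerivAt
  have hconst : ∀ {F : ℝ → ℝ} {a F' : ℝ} {t : ℝ}, t ∈ Ioo (-ε) ε → (∀ t ∈ Ioo (-ε) ε, F t = a) →
      HasDerivAt F F' t → F' = 0 := by
    intro F a F' t ht hF hd
    exact hd.unique ((hasDerivAt_const t a).congr_of_eventuallyEq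
      (Filter.eventually_of_mem (isOpen_Ioo.mem_nhds ht) hF))
  -- In the derivative of the tangential equation, `s' = 2ks` and the Riccati equation cancel
  -- everything except `s (q - k²)`.
  have hq : ∀ t ∈ Ioo (-ε) ε, k t ^ 2 = q := by
    intro t ht
    have hder : HasDerivAt (fun t ↦ s t * (d * q - k t - q + (d - 1) * k t ^ 2))
        (s t * (q - k t ^ 2)) t := by
      refine ((hs t ht).mul ((((hkd t ht).const_sub (d * q)).sub_const q).add
        (((hkd t ht).pow 2).const_mul (d - 1)))).congr_deriv ?_
      simp
      ring
    have := hconst ht (a := c) (fun r hr ↦ by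
      rw [← h2 r hr, hk' r hr]; ring) hder
    rcases mul_eq_zero.1 this with h | h
    · exact absurd h (hs0 t).ne'
    · linarith
  -- Now `k²` is constant, so `0 = 2 k k' = -4 k³`.
  have hk0 : ∀ t ∈ Ioo (-ε) ε, k t = 0 := by
    intro t ht
    have := hconst ht hq ((hkd t ht).pow 2)
    rw [← hq t ht] at this
    have h3 : k t ^ 3 = 0 := by
      norm_num at this
      rcases this with h | h
      · rw [h]; ring
      · have h4 : k t ^ 2 = 0 := by linarith
        rw [pow_succ, h4, zero_mul]
    exact pow_eq_zero_iff (three_ne_zero) |>.1 h3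
  have h0 : (0 : ℝ) ∈ Ioo (-ε) ε := ⟨by linarith, hε⟩
  have hq0 : q = 0 := by rw [← hq 0 h0, hk0 0 h0]; ring
  refine ⟨by rw [hq0, mul_zero], fun t ht ↦ ⟨hk0 t ht, ?_⟩⟩
  rw [hk' t ht, hk0 t ht, hq0]; ring

lemma ricci_zero {m : ℕ} (G : Euc m → Euc m →L[ℝ] Euc m →L[ℝ] ℝ) (y : Euc m) :
    ricci G y 0 0 = 0 := by
  have h1 : ∀ z u, christoffel G z u 0 = 0 := by simp [christoffel, christoffelFirst]
  simp [ricci, curvature, h1]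

namespace IsFCosymplecticOn

variable {d : ℕ} {ε lam : ℝ} {G : Euc (d + 1) → Euc (d + 1) →L[ℝ] Euc (d + 1) →L[ℝ] ℝ}
    {A : Euc (d + 1) → Euc (d + 1) →L[ℝ] Euc (d + 1)} {f : Euc (d + 1) → ℝ}
    {H : Euc d → Euc d →L[ℝ] Euc d →L[ℝ] ℝ}

lemma lieDeriv_e₀ (h : IsFCosymplecticOn G A (fun _ ↦ e₀ d) (fun _ ↦ head d) f (slab d ε))
    {y : Euc (d + 1)} (hy : y ∈ slab d ε) (u v : Euc (d + 1)) :
    lieDeriv (fun _ ↦ e₀ d) G y u v = 2 * f y * (G y u v - head d u * head d v) := by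
  simp [lieDeriv, h.fderiv_G_e₀ hy]

/-- A soliton metric in adapted coordinates is Ricci-flat with `f = 0` and `λ = 0`. -/
theorem soliton_rigidity
    (h : IsFCosymplecticOn G A (fun _ ↦ e₀ d) (fun _ ↦ head d) f (slab d ε))
    (hε : 0 < ε) (hd : 1 ≤ d) (hH : IsMetricOn H univ)
    (hHG : ∀ x u v, H x u v = G (incl d x) (incl d u) (incl d v))
    (hsol : ∀ y ∈ slab d ε, ∀ u v,
      (1 / 2 : ℝ) * lieDeriv (fun _ ↦ e₀ d) G y u v + ricci G y u v - lam * G y u v = 0) :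
    lam = 0 ∧ (∀ y ∈ slab d ε, f y = 0) ∧ (∀ y ∈ slab d ε, ∀ u v, ricci G y u v = 0) ∧
      ∀ x u v, ricci H x u v = 0 := by
  obtain ⟨s, hs, hw⟩ := h.exists_isWarpedOn hε hH hHG
  have key : ∀ y ∈ slab d ε, ∀ u v, f y * (G y u v - head d u * head d v) + ricci G y u v
      - lam * G y u v = 0 := by
    intro y hy u v
    have := hsol y hy u v
    rw [h.lieDeriv_e₀ hy] at this
    linarith
  have hmem : ∀ t ∈ Ioo (-ε) ε, t • e₀ d ∈ slab d ε := fun t ht ↦ by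
    simpa using mem_slab_smul_add ht (0 : Euc d)
  have hd0 : (d : ℝ) ≠ 0 := by positivity
  let a : Euc d := EuclideanSpace.single ⟨0, hd⟩ 1
  have ha : 0 < H 0 a a := hH.pos 0 (mem_univ _) a (by
    intro h0
    have := congrArg (fun v : Euc d ↦ v ⟨0, hd⟩) h0
    simp [a] at this)
  -- The two equations are the `(e₀, e₀)` and `(incl a, incl a)` components along the line through
  -- the origin of the slice. On that line the base point in the slice is fixed, so the quotient `c`
  -- does not depend on `t`.
  have hres := eq_zero_of_warped_soliton (lam := lam) (d := d) (c := ricci H 0 a a / H 0 a a) hε hd0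
    hw.differentiableAt_k hs hw.hasDerivAt_s
    (fun t ht ↦ by
      have h1 := key _ (hmem t ht) (e₀ d) (e₀ d)
      rw [hw.ricci_eq (hmem t ht), h.metric_V (hmem t ht)] at h1
      simp [ricci_zero] at h1
      linarith)
    (fun t ht ↦ by
      have h1 := key _ (hmem t ht) (incl d a) (incl d a)
      rw [hw.ricci_eq (hmem t ht), hw.eq _ (hmem t ht)] at h1
      simp only [head_incl, tail_incl, map_smul, tail_e₀, head_e₀, smul_zero, smul_eq_mul,
        mul_one, mul_zero, zero_add, sub_zero] at h1
      rw [eq_div_iff ha.ne']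
      linarith)
  obtain ⟨hlam, hk⟩ := hres
  have hf : ∀ y ∈ slab d ε, f y = 0 := fun y hy ↦ (h.f_eq hy).trans (hk _ hy).1
  have hG : ∀ y ∈ slab d ε, ∀ u v, ricci G y u v = 0 := by
    intro y hy u v
    simpa [hf y hy, hlam] using key y hy u v
  refine ⟨hlam, hf, hG, fun x u v ↦ ?_⟩
  have hx := incl_mem_slab hε x
  have h0 := hk 0 ⟨by linarith, hε⟩
  have h1 := hG _ hx (incl d u) (incl d v)
  rw [hw.ricci_eq hx] at h1
  simp only [head_incl, tail_incl, h0.1, h0.2] at h1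
  simpa using h1

/-- For `f = 0` the metric no longer varies with `t`, by `fderiv_G_e₀`, so the product carries no
warping factor. -/
lemma metric_eq (h : IsFCosymplecticOn G A (fun _ ↦ e₀ d) (fun _ ↦ head d) f (slab d ε))
    (hε : 0 < ε) (hf : ∀ y ∈ slab d ε, f y = 0)
    (hHG : ∀ x u v, H x u v = G (incl d x) (incl d u) (incl d v))
    {y : Euc (d + 1)} (hy : y ∈ slab d ε) (u v : Euc (d + 1)) :
    G y u v = head d u * head d v + H (tail d y) (tail d u) (tail d v) := by
  have h1 : G y = G (incl d (tail d y)) := by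
    refine eq_of_fderiv_e₀_eq_zero hε (fun z hz ↦ h.metric.differentiableAt hz) (fun z hz ↦ ?_) hy
    ext1 u
    ext1 v
    rw [h.fderiv_G_e₀ hz, hf z hz]
    simp
  have hm := incl_mem_slab hε (tail d y)
  rw [hHG, h1]
  conv_lhs => rw [← head_smul_add_incl_tail u, ← head_smul_add_incl_tail v]
  simp only [map_add, map_smul, _root_.add_apply, _root_.smul_apply, h.metric_V' hm,
    h.metric_V hm, head_incl, head_e₀, smul_eq_mul]
  ring

lemma incl_tail_of_head_eq_zero {v : Euc (d + 1)} (hv : head d v = 0) : incl d (tail d v) = v := by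
  simpa [hv] using head_smul_add_incl_tail v

/-- The endomorphism field induced on the slice through the origin. -/
def sliceEndo (A : Euc (d + 1) → Euc (d + 1) →L[ℝ] Euc (d + 1)) (x : Euc d) :
    Euc d →L[ℝ] Euc d :=
  (tail d).comp ((A (incl d x)).comp (incl d))

/-- `A` takes values in `ker η`, the tangent space of the slice, so the projection in `sliceEndo`
loses nothing. -/
lemma incl_sliceEndo (h : IsFCosymplecticOn G A (fun _ ↦ e₀ d) (fun _ ↦ head d) f (slab d ε))
    (hε : 0 < ε) (x u : Euc d) : incl d (sliceEndo A x u) = A (incl d x) (incl d u) :=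
  incl_tail_of_head_eq_zero (h.α_A _ (incl_mem_slab hε x) _)

lemma contDiff_sliceEndo
    (h : IsFCosymplecticOn G A (fun _ ↦ e₀ d) (fun _ ↦ head d) f (slab d ε)) (hε : 0 < ε) :
    ContDiff ℝ ∞ (sliceEndo A) := by
  have h1 : ContDiff ℝ ∞ (fun x ↦ A (incl d x)) := contDiffOn_univ.1
    (h.smooth_A.comp (incl d).contDiff.contDiffOn fun x _ ↦ incl_mem_slab hε x)
  exact contDiff_const.clm_comp (h1.clm_comp contDiff_const)

lemma sliceEndo_sq (h : IsFCosymplecticOn G A (fun _ ↦ e₀ d) (fun _ ↦ head d) f (slab d ε))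
    (hε : 0 < ε) (x u : Euc d) : sliceEndo A x (sliceEndo A x u) = -u := by
  have h1 : sliceEndo A x (sliceEndo A x u) = tail d (A (incl d x) (incl d (sliceEndo A x u))) :=
    rfl
  rw [h1, h.incl_sliceEndo hε, h.A_sq _ (incl_mem_slab hε x)]
  simp

lemma sliceEndo_compat
    (h : IsFCosymplecticOn G A (fun _ ↦ e₀ d) (fun _ ↦ head d) f (slab d ε))
    (hε : 0 < ε) (hHG : ∀ x u v, H x u v = G (incl d x) (incl d u) (incl d v)) (x u v : Euc d) :
    H x (sliceEndo A x u) (sliceEndo A x v) = H x u v := by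
  rw [hHG, hHG, h.incl_sliceEndo hε, h.incl_sliceEndo hε, h.compat _ (incl_mem_slab hε x)]
  simp

lemma head_fderiv_A (h : IsFCosymplecticOn G A (fun _ ↦ e₀ d) (fun _ ↦ head d) f (slab d ε))
    {y : Euc (d + 1)} (hy : y ∈ slab d ε) (w v : Euc (d + 1)) :
    head d (fderiv ℝ A y w v) = 0 := by
  have e1 := (head d).hasFDerivAt.comp y
    ((h.differentiableAt_A hy).hasFDerivAt.clm_apply (hasFDerivAt_const (𝕜 := ℝ) v y))
  have e2 := (hasFDerivAt_const (𝕜 := ℝ) (0 : ℝ) y).congr_of_eventuallyEq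
    (f₁ := fun z ↦ head d (A z v))
    (Filter.eventually_of_mem ((isOpen_slab ε).mem_nhds hy) fun z hz ↦ h.α_A z hz v)
  have := congrArg (fun L ↦ L w) (e1.unique e2)
  simpa using this

lemma fderiv_sliceEndo
    (h : IsFCosymplecticOn G A (fun _ ↦ e₀ d) (fun _ ↦ head d) f (slab d ε))
    (hε : 0 < ε) (x w v : Euc d) :
    incl d (fderiv ℝ (sliceEndo A) x w v) = fderiv ℝ A (incl d x) (incl d w) (incl d v) := by
  have hx := incl_mem_slab hε x
  have h1 := (((h.differentiableAt_A hx).hasFDerivAt.comp x (incl d).hasFDerivAt).clm_apply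
    (hasFDerivAt_const (𝕜 := ℝ) (incl d v) x))
  have h2 := (tail d).hasFDerivAt.comp x h1
  have h3 := (((h.contDiff_sliceEndo hε).differentiable (by simp) x).hasFDerivAt.clm_apply
    (hasFDerivAt_const (𝕜 := ℝ) v x))
  have := congrArg (fun L ↦ L w) (h3.unique h2)
  simp at this
  rw [this]
  exact incl_tail_of_head_eq_zero (h.head_fderiv_A hx _ _)

/-- Closedness of `η` removes the Reeb term from normality. What remains restricts to the slice term
by term, since the derivatives of `A` also take values in `ker η`. -/
lemma nijenhuis_sliceEndo
    (h : IsFCosymplecticOn G A (fun _ ↦ e₀ d) (fun _ ↦ head d) f (slab d ε))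
    (hε : 0 < ε) (x u v : Euc d) : nijenhuis (sliceEndo A) x u v = 0 := by
  have hx := incl_mem_slab hε x
  have hinj : Function.Injective (incl d) := fun a b hab ↦ by
    simpa using congrArg (tail d) hab
  apply hinj
  have h1 := h.normal _ hx (incl d u) (incl d v)
  rw [h.closed _ hx, zero_smul, add_zero, nijenhuis_eq (h.differentiableAt_A hx)] at h1
  rw [map_zero, nijenhuis_eq ((h.contDiff_sliceEndo hε).differentiable (by simp) x), ← h1]
  simp only [map_add, map_sub, h.incl_sliceEndo hε, h.fderiv_sliceEndo hε]

/-- The form `twoForm H (sliceEndo A)` is the pullback of `ω` to the slice, and `dω = 0` once `f =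
0`. -/
lemma dTwo_sliceEndo
    (h : IsFCosymplecticOn G A (fun _ ↦ e₀ d) (fun _ ↦ head d) f (slab d ε))
    (hε : 0 < ε) (hf : ∀ y ∈ slab d ε, f y = 0) (hH : IsMetricOn H univ)
    (hHG : ∀ x u v, H x u v = G (incl d x) (incl d u) (incl d v)) (x u v w : Euc d) :
    dTwo (twoForm H (sliceEndo A)) x u v w = 0 := by
  have hx := incl_mem_slab hε x
  have hd : ∀ a b c, fderiv ℝ (twoForm H (sliceEndo A)) x a b c
      = fderiv ℝ (twoForm G A) (incl d x) (incl d a) (incl d b) (incl d c) := by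
    intro a b c
    have h1 := (((h.differentiableAt_twoForm hx).hasFDerivAt.comp x
      (incl d).hasFDerivAt).clm_apply (hasFDerivAt_const (𝕜 := ℝ) (incl d b) x)).clm_apply
      (hasFDerivAt_const (𝕜 := ℝ) (incl d c) x)
    have hdiff : DifferentiableAt ℝ (twoForm H (sliceEndo A)) x :=
      (hH.differentiableAt (mem_univ x)).clm_comp
        ((h.contDiff_sliceEndo hε).differentiable (by simp) x)
    have h2 := (hdiff.hasFDerivAt.clm_apply (hasFDerivAt_const (𝕜 := ℝ) b x)).clm_apply
      (hasFDerivAt_const (𝕜 := ℝ) c x)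
    have h3 := h2.congr_of_eventuallyEq (f₁ := fun x ↦ twoForm G A (incl d x) (incl d b) (incl d c))
      (Filter.Eventually.of_forall fun z ↦ by
        simp only [twoForm_apply, hHG, h.incl_sliceEndo hε])
    have := congrArg (fun L ↦ L a) (h3.unique h1)
    simpa using this
  have := h.d_omega _ hx (incl d u) (incl d v) (incl d w)
  rw [hf _ hx, mul_zero, zero_mul] at this
  rw [dTwo, hd, hd, hd]
  exact this

end IsFCosymplecticOn

end Coord

/-! ### Local splitting of a soliton in coordinates -/

namespace OpenPartialHomeomorph

variable {E : Type*} [NormedAddCommGroup E] [NormedSpace ℝ E]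

lemma fderiv_symm_fderiv (Ψ : OpenPartialHomeomorph E E) (h : ContDiffOn ℝ ∞ Ψ Ψ.source)
    (h' : ContDiffOn ℝ ∞ Ψ.symm Ψ.target) {y : E} (hy : y ∈ Ψ.source) (v : E) :
    fderiv ℝ Ψ.symm (Ψ y) (fderiv ℝ Ψ y v) = v := by
  have h1 : HasFDerivAt Ψ (fderiv ℝ Ψ y) y :=
    ((h.contDiffAt (Ψ.open_source.mem_nhds hy)).differentiableAt (by simp)).hasFDerivAt
  have h2 : HasFDerivAt Ψ.symm (fderiv ℝ Ψ.symm (Ψ y)) (Ψ y) :=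
    ((h'.contDiffAt (Ψ.open_target.mem_nhds (Ψ.map_source hy))).differentiableAt
      (by simp)).hasFDerivAt
  have h3 := (hasFDerivAt_id (𝕜 := ℝ) y).congr_of_eventuallyEq (f₁ := Ψ.symm ∘ Ψ)
    (Filter.eventually_of_mem (Ψ.open_source.mem_nhds hy) fun z hz ↦ Ψ.left_inv hz)
  exact congrArg (fun L ↦ L v) ((h2.comp y h1).unique h3)

lemma fderiv_fderiv_symm (Ψ : OpenPartialHomeomorph E E) (h : ContDiffOn ℝ ∞ Ψ Ψ.source)
    (h' : ContDiffOn ℝ ∞ Ψ.symm Ψ.target) {y : E} (hy : y ∈ Ψ.source) (v : E) :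
    fderiv ℝ Ψ y (fderiv ℝ Ψ.symm (Ψ y) v) = v := by
  have := Ψ.symm.fderiv_symm_fderiv h' h (Ψ.map_source hy) v
  rwa [Ψ.symm_symm, Ψ.left_inv hy] at this

end OpenPartialHomeomorph

namespace Coord

open Euc Set

namespace IsFCosymplecticOn

variable {d : ℕ} {lam : ℝ} {G : Euc (d + 1) → Euc (d + 1) →L[ℝ] Euc (d + 1) →L[ℝ] ℝ}
    {A : Euc (d + 1) → Euc (d + 1) →L[ℝ] Euc (d + 1)} {V : Euc (d + 1) → Euc (d + 1)}
    {α : Euc (d + 1) → Euc (d + 1) →L[ℝ] ℝ} {f : Euc (d + 1) → ℝ} {W : Set (Euc (d + 1))}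

/-- An `f`-cosymplectic structure can be transported to adapted coordinates. -/
lemma exists_adapted (h : IsFCosymplecticOn G A V α f W) {y₀ : Euc (d + 1)} (hy₀ : y₀ ∈ W) :
    ∃ ε > 0, ∃ Ψ : OpenPartialHomeomorph (Euc (d + 1)) (Euc (d + 1)),
      Ψ.source = slab d ε ∧ Ψ 0 = y₀ ∧ Ψ.target ⊆ W ∧ ContDiffOn ℝ ∞ Ψ Ψ.source ∧
      ContDiffOn ℝ ∞ Ψ.symm Ψ.target ∧ ∃ G' A',
        IsFCosymplecticOn G' A' (fun _ ↦ e₀ d) (fun _ ↦ head d) (f ∘ Ψ) (slab d ε) ∧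
        (∀ z ∈ slab d ε, ∀ u v, G' z u v = G (Ψ z) (fderiv ℝ Ψ z u) (fderiv ℝ Ψ z v)) ∧
        ∀ z ∈ slab d ε, fderiv ℝ Ψ z (e₀ d) = V (Ψ z) := by
  obtain ⟨ε, hε, Ψ, hs, h0, ht, hΨ, hΨ', had⟩ := exists_adapted_coordinates h.metric.isOpen
    h.smooth_V h.smooth_α (fun y hy ↦ h.α_V y hy) h.closed hy₀
  have hmaps : MapsTo Ψ (slab d ε) W := fun z hz ↦ ht (Ψ.map_source (hs ▸ hz))
  have hD : ContDiffOn ℝ ∞ (fderiv ℝ Ψ) Ψ.source :=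
    hΨ.fderiv_of_isOpen Ψ.open_source (by simp)
  have hD' : ContDiffOn ℝ ∞ (fderiv ℝ Ψ.symm) Ψ.target :=
    hΨ'.fderiv_of_isOpen Ψ.open_target (by simp)
  rw [hs] at hD
  have hΨs := hs ▸ hΨ
  have hD'' : ContDiffOn ℝ ∞ (fun z ↦ fderiv ℝ Ψ.symm (Ψ z)) (slab d ε) :=
    hD'.comp hΨs fun z hz ↦ Ψ.map_source (hs ▸ hz)
  let G' : Euc (d + 1) → Euc (d + 1) →L[ℝ] Euc (d + 1) →L[ℝ] ℝ := fun z ↦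
    (ContinuousLinearMap.precomp ℝ (fderiv ℝ Ψ z)).comp ((G (Ψ z)).comp (fderiv ℝ Ψ z))
  let A' : Euc (d + 1) → Euc (d + 1) →L[ℝ] Euc (d + 1) := fun z ↦
    (fderiv ℝ Ψ.symm (Ψ z)).comp ((A (Ψ z)).comp (fderiv ℝ Ψ z))
  have hG's : IsMetricOn G' (slab d ε) := by
    refine ⟨isOpen_slab ε, ?_, ?_, ?_⟩
    · have h1 : ContDiffOn ℝ ∞ (fun z ↦ ContinuousLinearMap.precomp ℝ (fderiv ℝ Ψ z))
          (slab d ε) :=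
        ((ContinuousLinearMap.compL ℝ (Euc (d + 1)) (Euc (d + 1)) ℝ).flip.contDiff).comp_contDiffOn
          hD
      exact h1.clm_comp ((h.metric.smooth.comp hΨs hmaps).clm_comp hD)
    · exact fun z hz u v ↦ h.metric.symm _ (hmaps hz) _ _
    · intro z hz v hv
      refine h.metric.pos _ (hmaps hz) _ fun h1 ↦ hv ?_
      rw [← Ψ.fderiv_symm_fderiv hΨ hΨ' (hs ▸ hz) v]
      exact (congrArg (fderiv ℝ Ψ.symm (Ψ z)) h1).trans (map_zero _)
  have hA's : ContDiffOn ℝ ∞ A' (slab d ε) :=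
    hD''.clm_comp ((h.smooth_A.comp hΨs hmaps).clm_comp hD)
  refine ⟨ε, hε, Ψ, hs, h0, ht, hΨ, hΨ', G', A', ?_, fun _ _ _ _ ↦ rfl,
    fun z hz ↦ (had z (hs ▸ hz)).1⟩
  exact h.change hmaps hΨs hG's hA's contDiffOn_const contDiffOn_const (fun _ _ _ _ ↦ rfl)
    (fun z hz u ↦ Ψ.fderiv_fderiv_symm hΨ hΨ' (hs ▸ hz) _) (fun z hz ↦ (had z (hs ▸ hz)).1)
    (fun z hz u ↦ ((had z (hs ▸ hz)).2 u).symm)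

/-- A soliton splits locally as the product of an interval and a Ricci-flat Kähler metric on
`ℝ^d`. -/
theorem exists_splitting (h : IsFCosymplecticOn G A V α f W) (hd : 1 ≤ d)
    (hsol : ∀ y ∈ W, ∀ u v,
      (1 / 2 : ℝ) * lieDeriv V G y u v + ricci G y u v - lam * G y u v = 0)
    {y₀ : Euc (d + 1)} (hy₀ : y₀ ∈ W) :
    lam = 0 ∧ f y₀ = 0 ∧ (∀ u v, ricci G y₀ u v = 0) ∧
    ∃ (Ψ : OpenPartialHomeomorph (Euc (d + 1)) (Euc (d + 1)))
      (H : Euc d → Euc d →L[ℝ] Euc d →L[ℝ] ℝ) (J : Euc d → Euc d →L[ℝ] Euc d),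
      0 ∈ Ψ.source ∧ Ψ 0 = y₀ ∧ Ψ.target ⊆ W ∧ ContDiffOn ℝ ∞ Ψ Ψ.source ∧
      ContDiffOn ℝ ∞ Ψ.symm Ψ.target ∧
      (∀ z ∈ Ψ.source, ∀ u v, G (Ψ z) (fderiv ℝ Ψ z u) (fderiv ℝ Ψ z v)
        = head d u * head d v + H (tail d z) (tail d u) (tail d v)) ∧
      IsMetricOn H univ ∧ ContDiff ℝ ∞ J ∧ (∀ x u, J x (J x u) = -u) ∧
      (∀ x u v, H x (J x u) (J x v) = H x u v) ∧ (∀ x u v, nijenhuis J x u v = 0) ∧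
      (∀ x u v w, dTwo (twoForm H J) x u v w = 0) ∧ ∀ x u v, ricci H x u v = 0 := by
  obtain ⟨ε, hε, Ψ, hs, h0, ht, hΨ, hΨ', G', A', h', hG', hV⟩ := h.exists_adapted hy₀
  obtain ⟨H, hH, hHG⟩ := isMetricOn_slice h'.metric hε
  have hΨs := hs ▸ hΨ
  have hmaps : MapsTo Ψ (slab d ε) W := fun z hz ↦ ht (Ψ.map_source (hs ▸ hz))
  have hric : ∀ z ∈ slab d ε, ∀ u v, ricci G' z u v
      = ricci G (Ψ z) (fderiv ℝ Ψ z u) (fderiv ℝ Ψ z v) := fun z hz u v ↦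
    ricci_change h'.metric h.metric hΨs hmaps hG' hz u v
  -- The soliton equation is given in the coordinates of `W` only; it reaches the adapted ones by
  -- tensoriality of the Ricci and Lie derivative terms.
  obtain ⟨hlam, hf, hG0, hH0⟩ := h'.soliton_rigidity (lam := lam) hε hd hH hHG (fun z hz u v ↦ by
    rw [hric z hz, hG' z hz, lieDeriv_change (isOpen_slab ε) hΨs hz (h'.metric.differentiableAt hz)
      (h.metric.differentiableAt (hmaps hz)) hG' (differentiableAt_const _)
      ((h.smooth_V.contDiffAt (h.metric.isOpen.mem_nhds (hmaps hz))).differentiableAt (by simp))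
      hV]
    exact hsol _ (hmaps hz) _ _)
  have hz0 : (0 : Euc (d + 1)) ∈ slab d ε := by simpa using incl_mem_slab hε (0 : Euc d)
  refine ⟨hlam, ?_, ?_, Ψ, H, sliceEndo A', hs ▸ hz0, h0, ht, hΨ, hΨ', ?_, hH,
    h'.contDiff_sliceEndo hε, h'.sliceEndo_sq hε, h'.sliceEndo_compat hε hHG,
    h'.nijenhuis_sliceEndo hε, h'.dTwo_sliceEndo hε hf hH hHG, hH0⟩
  · simpa [h0] using hf 0 hz0
  · intro u v
    have h1 := hG0 0 hz0 (fderiv ℝ Ψ.symm (Ψ 0) u) (fderiv ℝ Ψ.symm (Ψ 0) v)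
    rwa [hric 0 hz0, Ψ.fderiv_fderiv_symm hΨ hΨ' (hs ▸ hz0),
      Ψ.fderiv_fderiv_symm hΨ hΨ' (hs ▸ hz0), h0] at h1
  · intro z hz u v
    have hz' : z ∈ slab d ε := hs ▸ hz
    rw [← hG' z hz', h'.metric_eq hε hf hHG hz']

end IsFCosymplecticOn

end Coord

/-! ### Tensor fields in a chart of the atlas -/

section ChartExpressions

open Bundle Set

variable {m : ℕ} {M : Type*} [TopologicalSpace M] [ChartedSpace (Euc m) M]
  {e : OpenPartialHomeomorph M (Euc m)}

lemma bilinIn_apply (b : ∀ x : M, TangentSpace (𝓡 m) x →L[ℝ] TangentSpace (𝓡 m) x →L[ℝ] ℝ)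
    (y u v : Euc m) : bilinIn e b y u v = b (e.symm y) (dParam e y u) (dParam e y v) := rfl

/-- Applying a tensor field to vector fields yields a section of the trivial line bundle; this
returns it to an ordinary function. -/
lemma contDiffOn_of_trivial {s : Set (Euc m)} {b : Euc m → M} {F : Euc m → ℝ}
    (h : ContMDiffOn (𝓡 m) ((𝓡 m).prod 𝓘(ℝ)) ∞
      (fun y ↦ TotalSpace.mk' ℝ (E := Bundle.Trivial M ℝ) (b y) (F y)) s) :
    ContDiffOn ℝ ∞ F s := by
  intro y hy
  have := h y hy
  simp only [contMDiffWithinAt_totalSpace] at this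
  exact this.2.contDiffWithinAt

variable [IsManifold (𝓡 m) ∞ M]

lemma dParam_dChart (he : e ∈ atlas (Euc m) M) {y : Euc m} (hy : y ∈ e.target)
    (v : TangentSpace (𝓡 m) (e.symm y)) : dParam e y (dChart e y v) = v := by
  have h1 := (mdifferentiable_of_mem_atlas (I := 𝓡 m) he).symm_comp_deriv (e.map_target hy)
  rw [e.right_inv hy] at h1
  exact congrArg (fun L ↦ L v) h1

lemma dChart_dParam (he : e ∈ atlas (Euc m) M) {y : Euc m} (hy : y ∈ e.target) (u : Euc m) :
    dChart e y (dParam e y u) = u :=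
  congrArg (fun L ↦ L u)
    ((mdifferentiable_of_mem_atlas (I := 𝓡 m) he).comp_symm_deriv hy)

lemma contMDiffOn_symm_of_mem_atlas (he : e ∈ atlas (Euc m) M) :
    ContMDiffOn (𝓡 m) (𝓡 m) ∞ e.symm e.target :=
  contMDiffOn_symm_of_mem_maximalAtlas (IsManifold.subset_maximalAtlas he)

lemma contMDiffOn_of_mem_atlas (he : e ∈ atlas (Euc m) M) :
    ContMDiffOn (𝓡 m) (𝓡 m) ∞ e e.source :=
  contMDiffOn_of_mem_maximalAtlas (IsManifold.subset_maximalAtlas he)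

/-- The coordinate vector fields are smooth along the parametrization. -/
lemma contMDiffOn_dParam (he : e ∈ atlas (Euc m) M) (u : Euc m) :
    ContMDiffOn (𝓡 m) ((𝓡 m).prod 𝓘(ℝ, Euc m)) ∞
      (fun y ↦ TotalSpace.mk' (Euc m) (E := fun x : M ↦ TangentSpace (𝓡 m) x) (e.symm y)
        (dParam e y u)) e.target := by
  have h1 := (contMDiffOn_symm_of_mem_atlas he).contMDiffOn_tangentMapWithin (m := ∞) (by simp)
    e.open_target.uniqueMDiffOn
  have h2 : ContMDiffOn (𝓡 m) ((𝓡 m).prod 𝓘(ℝ, Euc m)) ∞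
      (fun y ↦ TotalSpace.mk' (Euc m) (E := fun x : Euc m ↦ TangentSpace (𝓡 m) x) y u) e.target :=
    contMDiffOn_vectorSpace_iff_contDiffOn.2 contDiffOn_const
  refine (h1.comp h2 fun y hy ↦ hy).congr fun y hy ↦ ?_
  simp only [Function.comp, tangentMapWithin, dParam]
  rw [mfderivWithin_of_isOpen e.open_target hy]
  rfl

lemma contDiffOn_dChart (he : e ∈ atlas (Euc m) M)
    {X : ∀ y : Euc m, TangentSpace (𝓡 m) (e.symm y)}
    (hX : ContMDiffOn (𝓡 m) ((𝓡 m).prod 𝓘(ℝ, Euc m)) ∞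
      (fun y ↦ TotalSpace.mk' (Euc m) (E := fun x : M ↦ TangentSpace (𝓡 m) x) (e.symm y) (X y))
      e.target) :
    ContDiffOn ℝ ∞ (fun y ↦ dChart e y (X y)) e.target := by
  have h1 := (contMDiffOn_of_mem_atlas he).contMDiffOn_tangentMapWithin (m := ∞) (by simp)
    e.open_source.uniqueMDiffOn
  have h2 := h1.comp hX fun y hy ↦ e.map_target hy
  have h3 := (contMDiff_snd_tangentBundle_modelSpace (n := ∞) (Euc m) (𝓡 m)).comp_contMDiffOn h2
  refine h3.contDiffOn.congr fun y hy ↦ ?_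
  simp only [Function.comp, tangentMapWithin, dChart]
  rw [mfderivWithin_of_isOpen e.open_source (e.map_target hy)]
  rfl

lemma contDiffOn_vecIn (he : e ∈ atlas (Euc m) M) {V : ∀ x : M, TangentSpace (𝓡 m) x}
    (hV : IsSmoothVec V) : ContDiffOn ℝ ∞ (vecIn e V) e.target :=
  contDiffOn_dChart he (ContMDiff.comp_contMDiffOn hV (contMDiffOn_symm_of_mem_atlas he))

lemma contDiffOn_endoIn (he : e ∈ atlas (Euc m) M)
    {φ : ∀ x : M, TangentSpace (𝓡 m) x →L[ℝ] TangentSpace (𝓡 m) x} (hφ : IsSmoothEndo φ) :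
    ContDiffOn ℝ ∞ (endoIn e φ) e.target := by
  -- In finite dimension it suffices to test on constant vectors, that is, on coordinate fields,
  -- which are smooth by `contMDiffOn_dParam`.
  refine contDiffOn_clm_apply.2 fun u ↦ ?_
  exact contDiffOn_dChart he
    ((ContMDiff.comp_contMDiffOn hφ (contMDiffOn_symm_of_mem_atlas he)).clm_bundle_apply
      (contMDiffOn_dParam he u))

lemma contDiffOn_formIn (he : e ∈ atlas (Euc m) M)
    {η : ∀ x : M, TangentSpace (𝓡 m) x →L[ℝ] ℝ} (hη : IsSmoothForm η) :
    ContDiffOn ℝ ∞ (formIn e η) e.target := by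
  refine contDiffOn_clm_apply.2 fun u ↦ ?_
  exact contDiffOn_of_trivial
    (ContMDiffOn.clm_bundle_apply (F₂ := ℝ) (E₂ := Bundle.Trivial M ℝ)
      (ContMDiff.comp_contMDiffOn hη (contMDiffOn_symm_of_mem_atlas he))
      (contMDiffOn_dParam he u))

lemma contDiffOn_bilinIn (he : e ∈ atlas (Euc m) M) (g : RiemMetric m M) :
    ContDiffOn ℝ ∞ (bilinIn e g.inner) e.target := by
  refine contDiffOn_clm_apply.2 fun u ↦ contDiffOn_clm_apply.2 fun v ↦ ?_
  exact contDiffOn_of_trivial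
    (ContMDiffOn.clm_bundle_apply₂ (F₃ := ℝ) (E₃ := Bundle.Trivial M ℝ)
      (ContMDiff.comp_contMDiffOn g.contMDiff (contMDiffOn_symm_of_mem_atlas he))
      (contMDiffOn_dParam he u) (contMDiffOn_dParam he v))

lemma isMetricOn_bilinIn (he : e ∈ atlas (Euc m) M) (g : RiemMetric m M) :
    Coord.IsMetricOn (bilinIn e g.inner) e.target := by
  refine ⟨e.open_target, contDiffOn_bilinIn he g, fun y _ u v ↦ g.symm _ _ _, ?_⟩
  intro y hy v hv
  refine g.pos _ _ fun h0 ↦ hv ?_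
  rw [← dChart_dParam he hy v]
  exact (congrArg (dChart e y) h0).trans (map_zero _)

lemma dParam_endoIn (he : e ∈ atlas (Euc m) M)
    (φ : ∀ x : M, TangentSpace (𝓡 m) x →L[ℝ] TangentSpace (𝓡 m) x) {y : Euc m}
    (hy : y ∈ e.target) (u : Euc m) :
    dParam e y (endoIn e φ y u) = φ (e.symm y) (dParam e y u) :=
  dParam_dChart he hy _

lemma dParam_vecIn (he : e ∈ atlas (Euc m) M) (V : ∀ x : M, TangentSpace (𝓡 m) x) {y : Euc m}
    (hy : y ∈ e.target) : dParam e y (vecIn e V y) = V (e.symm y) :=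
  dParam_dChart he hy _

lemma bilinIn_fundamentalForm (he : e ∈ atlas (Euc m) M)
    (b : ∀ x : M, TangentSpace (𝓡 m) x →L[ℝ] TangentSpace (𝓡 m) x →L[ℝ] ℝ)
    (φ : ∀ x : M, TangentSpace (𝓡 m) x →L[ℝ] TangentSpace (𝓡 m) x) {y : Euc m}
    (hy : y ∈ e.target) :
    bilinIn e (fundamentalForm b φ) y = Coord.twoForm (bilinIn e b) (endoIn e φ) y := by
  ext1 u
  ext1 v
  rw [Coord.twoForm_apply, bilinIn_apply, bilinIn_apply, dParam_endoIn he φ hy]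
  rfl

end ChartExpressions

namespace AlmostContactMetric

open Set

variable {n : ℕ} {M : Type*} [TopologicalSpace M] [ChartedSpace (Euc (2 * n + 1)) M]
  [IsManifold (𝓡 (2 * n + 1)) ∞ M] {e : OpenPartialHomeomorph M (Euc (2 * n + 1))}

/-- The coordinate expression of an `f`-cosymplectic structure. -/
theorem IsFCosymplectic.isFCosymplecticOn {S : AlmostContactMetric n M} {f : M → ℝ}
    (hS : S.IsFCosymplectic f) (he : e ∈ atlas (Euc (2 * n + 1)) M) :
    Coord.IsFCosymplecticOn (bilinIn e S.g.inner) (endoIn e S.φ) (vecIn e S.ξ) (formIn e S.η)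
      (f ∘ e.symm) e.target := by
  have hform : ∀ y ∈ e.target, ∀ u, formIn e S.η y u = S.η (e.symm y) (dParam e y u) :=
    fun _ _ _ ↦ rfl
  have hinj : ∀ y ∈ e.target, ∀ u v, dParam e y u = dParam e y v → u = v := by
    intro y hy u v huv
    rw [← dChart_dParam he hy u, huv, dChart_dParam he hy]
  refine ⟨isMetricOn_bilinIn he S.g, contDiffOn_endoIn he S.smooth_φ,
    contDiffOn_vecIn he S.smooth_ξ, contDiffOn_formIn he S.smooth_η, ?_, ?_, ?_, ?_, ?_, ?_, ?_,
    hS.eta_closed e he, ?_, hS.normal e he⟩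
  · exact (hS.smooth.comp_contMDiffOn (contMDiffOn_symm_of_mem_atlas he)).contDiffOn
  · intro y hy v
    apply hinj y hy
    rw [dParam_endoIn he _ hy, dParam_endoIn he _ hy, S.φ_sq, map_add, map_neg, map_smul,
      dParam_vecIn he _ hy, hform y hy]
  · intro y hy v
    rw [hform y hy, dParam_endoIn he _ hy, S.η_φ]
  · intro y hy
    apply hinj y hy
    rw [dParam_endoIn he _ hy, dParam_vecIn he _ hy, S.φ_ξ, map_zero]
  · intro y hy
    rw [hform y hy, dParam_vecIn he _ hy, S.η_ξ]
  · intro y hy v w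
    rw [bilinIn_apply, bilinIn_apply, dParam_endoIn he _ hy, dParam_endoIn he _ hy, S.compat,
      hform y hy, hform y hy]
  · intro y hy u v
    have h1 : ∀ u, fderiv ℝ (f ∘ e.symm) y u
        = mvfderiv (𝓡 (2 * n + 1)) f (e.symm y) (dParam e y u) := by
      intro u
      have h2 : MDifferentiableAt (𝓡 (2 * n + 1)) (𝓡 (2 * n + 1)) e.symm y :=
        (mdifferentiable_of_mem_atlas he).mdifferentiableAt_symm hy
      have h3 := mfderiv_comp y ((hS.smooth.mdifferentiable (by simp)) (e.symm y)) h2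
      rw [mfderiv_eq_fderiv] at h3
      exact congrArg (fun L ↦ L u) h3
    rw [h1, h1, hform y hy, hform y hy]
    exact hS.df_wedge_eta _ _ _
  · intro y hy u v w
    have h1 := hS.d_omega e he y hy u v w
    have h2 : ∀ z ∈ e.target, bilinIn e S.fundForm z
        = Coord.twoForm (bilinIn e S.g.inner) (endoIn e S.φ) z := fun z hz ↦
      bilinIn_fundamentalForm he _ _ hz
    have h3 : fderiv ℝ (bilinIn e S.fundForm) y
        = fderiv ℝ (Coord.twoForm (bilinIn e S.g.inner) (endoIn e S.φ)) y :=
      Filter.EventuallyEq.fderiv_eq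
      (Filter.eventually_of_mem (e.open_target.mem_nhds hy) h2)
    rw [Coord.dTwo, h3, h2 y hy] at h1
    exact h1

end AlmostContactMetric

/-! ### The model space as a Kähler manifold -/

/-- The unit ball of a scalar product on `ℝ^m` is bounded. -/
lemma isVonNBounded_of_pos {m : ℕ} (B : Euc m →L[ℝ] Euc m →L[ℝ] ℝ)
    (hB : ∀ v, v ≠ 0 → 0 < B v v) : Bornology.IsVonNBounded ℝ {v : Euc m | B v v < 1} := by
  obtain ⟨c, hc, hcB⟩ : ∃ c > 0, ∀ v, c * ‖v‖ ^ 2 ≤ B v v := by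
    by_cases hne : (Metric.sphere (0 : Euc m) 1).Nonempty
    · obtain ⟨v₀, hv₀, hmin⟩ := (isCompact_sphere (0 : Euc m) 1).exists_isMinOn hne
        (f := fun v ↦ B v v) (by fun_prop)
      have h0 : v₀ ≠ 0 := by
        rintro rfl
        simp at hv₀
      refine ⟨B v₀ v₀, hB _ h0, fun v ↦ ?_⟩
      rcases eq_or_ne v 0 with rfl | hv
      · simp
      have hn : ‖v‖ ≠ 0 := norm_ne_zero_iff.2 hv
      have h1 := hmin (show ‖v‖⁻¹ • v ∈ Metric.sphere (0 : Euc m) 1 by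
        simp [norm_smul, hn])
      simp only [Set.mem_ofPred_eq, map_smul, smul_apply, smul_eq_mul] at h1
      calc B v₀ v₀ * ‖v‖ ^ 2 ≤ (‖v‖⁻¹ * (‖v‖⁻¹ * B v v)) * ‖v‖ ^ 2 := by gcongr
        _ = B v v := by field_simp
    -- An empty unit sphere forces every vector to be zero, so any constant works.
    · refine ⟨1, one_pos, fun v ↦ ?_⟩
      rcases eq_or_ne v 0 with rfl | hv
      · simp
      · exact absurd ⟨‖v‖⁻¹ • v, by simp [norm_smul, hv]⟩ hne
  -- The radius `c⁻¹ + 1` exceeds the square root of `c⁻¹`.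
  refine (NormedSpace.isVonNBounded_closedBall ℝ (Euc m) (c⁻¹ + 1)).subset fun v hv ↦ ?_
  have h1 : c * ‖v‖ ^ 2 < 1 := (hcB v).trans_lt hv
  have h2 : ‖v‖ ^ 2 < c⁻¹ := by
    rw [← one_div, lt_div_iff₀ hc]
    linarith
  rw [mem_closedBall_zero_iff]
  have : 0 < c⁻¹ := inv_pos.2 hc
  nlinarith [norm_nonneg v]

section ModelSpace

open Bundle Set

variable {m : ℕ}

/-- The tangent bundle of the model space is trivialized by the identity, so the bundle coordinates
of a tensor field are the field itself. -/
lemma isSmoothEndo_of_contDiff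
    {J : ∀ x : Euc m, TangentSpace (𝓡 m) x →L[ℝ] TangentSpace (𝓡 m) x}
    (hJ : ContDiff ℝ ∞ (E := Euc m) (F := Euc m →L[ℝ] Euc m) J) :
    IsSmoothEndo (M := Euc m) J := by
  intro x
  refine (contMDiffAt_hom_bundle _).2 ⟨contMDiffAt_id, ?_⟩
  refine hJ.contMDiff.contMDiffAt.congr_of_eventuallyEq (Filter.Eventually.of_forall fun y ↦ ?_)
  exact inCoordinates_tangent_bundle_core_model_space _ _ _ _ _

lemma contMDiff_bilin_of_contDiff
    {b : ∀ x : Euc m, TangentSpace (𝓡 m) x →L[ℝ] TangentSpace (𝓡 m) x →L[ℝ] ℝ}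
    (hb : ContDiff ℝ ∞ (E := Euc m) (F := Euc m →L[ℝ] Euc m →L[ℝ] ℝ) b) :
    ContMDiff (𝓡 m) ((𝓡 m).prod 𝓘(ℝ, Euc m →L[ℝ] Euc m →L[ℝ] ℝ)) ∞
      (fun x ↦ TotalSpace.mk' (Euc m →L[ℝ] Euc m →L[ℝ] ℝ)
        (E := fun x : Euc m ↦ TangentSpace (𝓡 m) x →L[ℝ] TangentSpace (𝓡 m) x →L[ℝ] ℝ)
        x (b x)) := by
  intro x
  refine (contMDiffAt_hom_bundle _).2 ⟨contMDiffAt_id, ?_⟩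
  refine hb.contMDiff.contMDiffAt.congr_of_eventuallyEq (Filter.Eventually.of_forall fun y ↦ ?_)
  ext v w
  simp only [ContinuousLinearMap.inCoordinates, ContinuousLinearMap.comp_apply,
    Trivialization.continuousLinearMapAt_apply]
  rw [Trivialization.linearMapAt_apply, if_pos (by
    simp only [hom_trivializationAt_baseSet, TangentBundle.trivializationAt_baseSet,
      Trivial.fiberBundle_trivializationAt', Trivial.trivialization_baseSet, inter_univ]
    exact mem_univ y), hom_trivializationAt_apply]
  simp [ContinuousLinearMap.inCoordinates]
  rfl

/-- A smooth family of scalar products on `ℝ^m` as a Riemannian metric. -/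
def Coord.IsMetricOn.toRiemMetric {H : Euc m → Euc m →L[ℝ] Euc m →L[ℝ] ℝ}
    (hH : Coord.IsMetricOn H univ) : RiemMetric m (Euc m) where
  inner := H
  symm x u v := hH.symm x (mem_univ x) u v
  pos x v hv := hH.pos x (mem_univ x) v hv
  isVonNBounded x := isVonNBounded_of_pos (H x) (hH.pos x (mem_univ x))
  contMDiff := contMDiff_bilin_of_contDiff (contDiffOn_univ.1 hH.smooth)

/-- The model space has only the identity chart, so chartwise conditions on it reduce to the
coordinate ones. -/
lemma eq_refl_of_mem_atlas {e : OpenPartialHomeomorph (Euc m) (Euc m)}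
    (he : e ∈ atlas (Euc m) (Euc m)) : e = OpenPartialHomeomorph.refl (Euc m) :=
  chartedSpaceSelf_atlas.1 he

lemma dParam_refl (y : Euc m) :
    dParam (M := Euc m) (OpenPartialHomeomorph.refl (Euc m)) y = ContinuousLinearMap.id ℝ (Euc m) :=
  mfderiv_id

lemma dChart_refl (y : Euc m) :
    dChart (M := Euc m) (OpenPartialHomeomorph.refl (Euc m)) y = ContinuousLinearMap.id ℝ (Euc m) :=
  mfderiv_id

lemma bilinIn_refl (b : Euc m → Euc m →L[ℝ] Euc m →L[ℝ] ℝ) :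
    bilinIn (M := Euc m) (OpenPartialHomeomorph.refl (Euc m)) b = b := by
  funext y
  ext1 u
  ext1 v
  have h : ∀ u, dParam (M := Euc m) (OpenPartialHomeomorph.refl (Euc m)) y u = u := fun u ↦
    congrArg (fun L ↦ L u) (dParam_refl y)
  exact congrArg₂ (fun a c ↦ b y a c) (h u) (h v)

lemma endoIn_refl (J : Euc m → Euc m →L[ℝ] Euc m) :
    endoIn (M := Euc m) (OpenPartialHomeomorph.refl (Euc m)) J = J := by
  funext y
  ext1 u
  have h : ∀ u, dParam (M := Euc m) (OpenPartialHomeomorph.refl (Euc m)) y u = u := fun u ↦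
    congrArg (fun L ↦ L u) (dParam_refl y)
  have h' : ∀ u, dChart (M := Euc m) (OpenPartialHomeomorph.refl (Euc m)) y u = u := fun u ↦
    congrArg (fun L ↦ L u) (dChart_refl y)
  exact (h' _).trans (congrArg (J y) (h u))

/-- A Kähler structure on `ℝ^(2n)` from its coordinate expression. -/
def kahlerStructureOfCoord {n : ℕ} {H : Euc (2 * n) → Euc (2 * n) →L[ℝ] Euc (2 * n) →L[ℝ] ℝ}
    {J : Euc (2 * n) → Euc (2 * n) →L[ℝ] Euc (2 * n)} (hH : Coord.IsMetricOn H univ)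
    (hJ : ContDiff ℝ ∞ J) (hsq : ∀ x u, J x (J x u) = -u)
    (hHJ : ∀ x u v, H x (J x u) (J x v) = H x u v)
    (hN : ∀ x u v, Coord.nijenhuis J x u v = 0)
    (hd : ∀ x u v w, Coord.dTwo (Coord.twoForm H J) x u v w = 0) :
    KahlerStructure n (Euc (2 * n)) where
  h := hH.toRiemMetric
  J := J
  smooth_J := isSmoothEndo_of_contDiff hJ
  J_sq := hsq
  compat := hHJ
  integrable := by
    intro e he y _ u v
    obtain rfl := eq_refl_of_mem_atlas he
    rw [endoIn_refl]
    exact hN y u v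
  closed := by
    intro e he y _ u v w
    obtain rfl := eq_refl_of_mem_atlas he
    have h1 : bilinIn (M := Euc (2 * n)) (OpenPartialHomeomorph.refl (Euc (2 * n)))
        (fundamentalForm hH.toRiemMetric.inner J) = Coord.twoForm H J := bilinIn_refl _
    rw [h1]
    exact hd y u v w

lemma isRicciFlat_toRiemMetric {H : Euc m → Euc m →L[ℝ] Euc m →L[ℝ] ℝ}
    (hH : Coord.IsMetricOn H univ) (h : ∀ x u v, Coord.ricci H x u v = 0) :
    IsRicciFlat hH.toRiemMetric := by
  intro e he y _ u v
  obtain rfl := eq_refl_of_mem_atlas he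
  have h1 : bilinIn (M := Euc m) (OpenPartialHomeomorph.refl (Euc m)) hH.toRiemMetric.inner = H :=
    bilinIn_refl _
  rw [h1]
  exact h y u v

end ModelSpace

/-! ### From a splitting in coordinates to a local isometry -/

namespace Euc

/-- The splitting `ℝ^(d + 1) = ℝ × ℝ^d`. -/
def splitEquiv (d : ℕ) : Euc (d + 1) ≃L[ℝ] ℝ × Euc d :=
  ContinuousLinearEquiv.equivOfInverse ((head d).prod (tail d))
    ((ContinuousLinearMap.toSpanSingleton ℝ (e₀ d)).coprod (incl d))
    (fun y ↦ by simpa using head_smul_add_incl_tail y)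
    (fun q ↦ by ext1 <;> simp)

lemma splitEquiv_symm_apply (d : ℕ) (q : ℝ × Euc d) :
    (splitEquiv d).symm q = q.1 • e₀ d + incl d q.2 := by
  refine (ContinuousLinearMap.coprod_apply _ _ _).trans ?_
  simp

end Euc

section LocalIsometry

open Euc Set

variable {d : ℕ} {M : Type*} [TopologicalSpace M]
  {e : OpenPartialHomeomorph M (Euc (d + 1))}

/-- The map `M → ℝ × ℝ^d` built from a chart and a splitting of its coordinates. -/
def splitChart (e : OpenPartialHomeomorph M (Euc (d + 1)))
    (Ψ : OpenPartialHomeomorph (Euc (d + 1)) (Euc (d + 1))) :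
    OpenPartialHomeomorph M (ℝ × Euc d) :=
  (e.trans Ψ.symm).transHomeomorph (splitEquiv d).toHomeomorph

lemma splitChart_symm_apply (Ψ : OpenPartialHomeomorph (Euc (d + 1)) (Euc (d + 1)))
    (q : ℝ × Euc d) : (splitChart e Ψ).symm q = e.symm (Ψ (q.1 • e₀ d + incl d q.2)) := by
  rw [← splitEquiv_symm_apply]
  rfl

lemma mem_splitChart_source {Ψ : OpenPartialHomeomorph (Euc (d + 1)) (Euc (d + 1))} {x : M} :
    x ∈ (splitChart e Ψ).source ↔ x ∈ e.source ∧ e x ∈ Ψ.target := by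
  simp [splitChart]

lemma mem_splitChart_target {Ψ : OpenPartialHomeomorph (Euc (d + 1)) (Euc (d + 1))}
    {q : ℝ × Euc d} (hq : q ∈ (splitChart e Ψ).target) :
    q.1 • e₀ d + incl d q.2 ∈ Ψ.source ∧ Ψ (q.1 • e₀ d + incl d q.2) ∈ e.target := by
  rw [← splitEquiv_symm_apply]
  simpa [splitChart] using hq

variable [ChartedSpace (Euc (d + 1)) M] [IsManifold (𝓡 (d + 1)) ∞ M]

/-- The way back from a coordinate expression to the tensor on the manifold, used for the final
isometry. -/
lemma bilinIn_mfderiv (he : e ∈ atlas (Euc (d + 1)) M)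
    (b : ∀ x : M, TangentSpace (𝓡 (d + 1)) x →L[ℝ] TangentSpace (𝓡 (d + 1)) x →L[ℝ] ℝ) {x : M}
    (hx : x ∈ e.source) (v w : TangentSpace (𝓡 (d + 1)) x) :
    bilinIn e b (e x) (mfderiv (𝓡 (d + 1)) (𝓡 (d + 1)) e x v)
      (mfderiv (𝓡 (d + 1)) (𝓡 (d + 1)) e x w) = b x v w := by
  obtain ⟨y, hy, rfl⟩ : ∃ y ∈ e.target, e.symm y = x := ⟨e x, e.map_source hx, e.left_inv hx⟩
  have key : ∀ y', y' = y →
      bilinIn e b y' (dChart e y v) (dChart e y w) = b (e.symm y) v w := by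
    rintro _ rfl
    rw [bilinIn_apply, dParam_dChart he hy, dParam_dChart he hy]
  exact key _ (e.right_inv hy)

lemma contMDiffOn_splitChart (he : e ∈ atlas (Euc (d + 1)) M)
    {Ψ : OpenPartialHomeomorph (Euc (d + 1)) (Euc (d + 1))}
    (hΨ' : ContDiffOn ℝ ∞ Ψ.symm Ψ.target) :
    ContMDiffOn (𝓡 (d + 1)) (𝓘(ℝ, ℝ).prod (𝓡 d)) ∞ (splitChart e Ψ) (splitChart e Ψ).source := by
  have h1 : ContMDiffOn (𝓡 (d + 1)) (𝓡 (d + 1)) ∞ (fun x ↦ Ψ.symm (e x))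
      (splitChart e Ψ).source :=
    hΨ'.contMDiffOn.comp ((contMDiffOn_of_mem_atlas he).mono fun x hx ↦
      (mem_splitChart_source.1 hx).1) fun x hx ↦ (mem_splitChart_source.1 hx).2
  exact ((head d).contMDiff.comp_contMDiffOn h1).prodMk ((tail d).contMDiff.comp_contMDiffOn h1)

lemma contMDiffOn_splitChart_symm (he : e ∈ atlas (Euc (d + 1)) M)
    {Ψ : OpenPartialHomeomorph (Euc (d + 1)) (Euc (d + 1))} (hΨ : ContDiffOn ℝ ∞ Ψ Ψ.source) :
    ContMDiffOn (𝓘(ℝ, ℝ).prod (𝓡 d)) (𝓡 (d + 1)) ∞ (splitChart e Ψ).symm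
      (splitChart e Ψ).target := by
  have h1 : ContMDiff (𝓘(ℝ, ℝ).prod (𝓡 d)) (𝓡 (d + 1)) ∞
      (fun q : ℝ × Euc d ↦ q.1 • e₀ d + incl d q.2) :=
    (contMDiff_fst.smul contMDiff_const).add ((incl d).contMDiff.comp contMDiff_snd)
  have h2 := hΨ.contMDiffOn.comp (h1.contMDiffOn (s := (splitChart e Ψ).target))
    fun q hq ↦ (mem_splitChart_target hq).1
  refine ((contMDiffOn_symm_of_mem_atlas he).comp h2
    fun q hq ↦ (mem_splitChart_target hq).2).congr fun q _ ↦ ?_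
  exact splitChart_symm_apply Ψ q

lemma hasMFDerivAt_chart_symm (he : e ∈ atlas (Euc (d + 1)) M)
    {Ψ : OpenPartialHomeomorph (Euc (d + 1)) (Euc (d + 1))}
    (hΨ' : ContDiffOn ℝ ∞ Ψ.symm Ψ.target) {x : M} (hx : x ∈ (splitChart e Ψ).source) :
    HasMFDerivAt (𝓡 (d + 1)) (𝓡 (d + 1)) (Ψ.symm ∘ e) x
      ((fderiv ℝ Ψ.symm (e x)).comp (mfderiv (𝓡 (d + 1)) (𝓡 (d + 1)) e x)) := by
  obtain ⟨hx1, hx2⟩ := mem_splitChart_source.1 hx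
  have h1 : HasMFDerivAt (𝓡 (d + 1)) (𝓡 (d + 1)) e x
      (mfderiv (𝓡 (d + 1)) (𝓡 (d + 1)) e x) :=
    ((mdifferentiable_of_mem_atlas he).mdifferentiableAt hx1).hasMFDerivAt
  have h2 : HasMFDerivAt (𝓡 (d + 1)) (𝓡 (d + 1)) Ψ.symm (e x) (fderiv ℝ Ψ.symm (e x)) :=
    ((hΨ'.contDiffAt (Ψ.open_target.mem_nhds hx2)).differentiableAt
      (by simp)).hasFDerivAt.hasMFDerivAt
  exact h2.comp x h1

lemma mdifferentiableAt_splitChart (he : e ∈ atlas (Euc (d + 1)) M)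
    {Ψ : OpenPartialHomeomorph (Euc (d + 1)) (Euc (d + 1))}
    (hΨ' : ContDiffOn ℝ ∞ Ψ.symm Ψ.target) {x : M} (hx : x ∈ (splitChart e Ψ).source) :
    MDifferentiableAt (𝓡 (d + 1)) (𝓘(ℝ, ℝ).prod (𝓡 d)) (splitChart e Ψ) x :=
  ((contMDiffOn_splitChart he hΨ').contMDiffAt
    ((splitChart e Ψ).open_source.mem_nhds hx)).mdifferentiableAt (by simp)

/-- The first component of `splitChart` is `head d ∘ Ψ.symm ∘ e`; its derivative is computed in two
ways by the chain rule. -/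
lemma mvfderiv_fst_splitChart (he : e ∈ atlas (Euc (d + 1)) M)
    {Ψ : OpenPartialHomeomorph (Euc (d + 1)) (Euc (d + 1))}
    (hΨ' : ContDiffOn ℝ ∞ Ψ.symm Ψ.target) {x : M} (hx : x ∈ (splitChart e Ψ).source)
    (v : TangentSpace (𝓡 (d + 1)) x) :
    mvfderiv (𝓘(ℝ, ℝ).prod (𝓡 d)) (Prod.fst : ℝ × Euc d → ℝ) (splitChart e Ψ x)
      (mfderiv (𝓡 (d + 1)) (𝓘(ℝ, ℝ).prod (𝓡 d)) (splitChart e Ψ) x v)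
      = head d (fderiv ℝ Ψ.symm (e x) (mfderiv (𝓡 (d + 1)) (𝓡 (d + 1)) e x v)) := by
  have h1 := mfderiv_comp x (mdifferentiableAt_fst (I := 𝓘(ℝ, ℝ)) (I' := 𝓡 d))
    (mdifferentiableAt_splitChart he hΨ' hx)
  have h2 := ((head d).hasFDerivAt.hasMFDerivAt.comp x
    (hasMFDerivAt_chart_symm he hΨ' hx)).mfderiv
  exact congrArg (fun L ↦ L v) (h1.symm.trans h2)

lemma mfderiv_snd_splitChart (he : e ∈ atlas (Euc (d + 1)) M)
    {Ψ : OpenPartialHomeomorph (Euc (d + 1)) (Euc (d + 1))}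
    (hΨ' : ContDiffOn ℝ ∞ Ψ.symm Ψ.target) {x : M} (hx : x ∈ (splitChart e Ψ).source)
    (v : TangentSpace (𝓡 (d + 1)) x) :
    mfderiv (𝓘(ℝ, ℝ).prod (𝓡 d)) (𝓡 d) (Prod.snd : ℝ × Euc d → Euc d) (splitChart e Ψ x)
      (mfderiv (𝓡 (d + 1)) (𝓘(ℝ, ℝ).prod (𝓡 d)) (splitChart e Ψ) x v)
      = tail d (fderiv ℝ Ψ.symm (e x) (mfderiv (𝓡 (d + 1)) (𝓡 (d + 1)) e x v)) := by
  have h1 := mfderiv_comp x (mdifferentiableAt_snd (I := 𝓘(ℝ, ℝ)) (I' := 𝓡 d))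
    (mdifferentiableAt_splitChart he hΨ' hx)
  have h2 := ((tail d).hasFDerivAt.hasMFDerivAt.comp x
    (hasMFDerivAt_chart_symm he hΨ' hx)).mfderiv
  exact congrArg (fun L ↦ L v) (h1.symm.trans h2)

/-- If the metric splits in coordinates adapted to a chart, then the manifold is locally isometric
to a product with a line. -/
theorem isLocallyIsometricToLineProductAt_of_splitting (he : e ∈ atlas (Euc (d + 1)) M)
    (g : RiemMetric (d + 1) M) {p : M} (hp : p ∈ e.source)
    {Ψ : OpenPartialHomeomorph (Euc (d + 1)) (Euc (d + 1))} (hpΨ : e p ∈ Ψ.target)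
    (hΨ : ContDiffOn ℝ ∞ Ψ Ψ.source) (hΨ' : ContDiffOn ℝ ∞ Ψ.symm Ψ.target)
    {H : Euc d → Euc d →L[ℝ] Euc d →L[ℝ] ℝ} (hH : Coord.IsMetricOn H univ)
    (hsplit : ∀ z ∈ Ψ.source, ∀ u v,
      bilinIn e g.inner (Ψ z) (fderiv ℝ Ψ z u) (fderiv ℝ Ψ z v)
        = head d u * head d v + H (tail d z) (tail d u) (tail d v)) :
    IsLocallyIsometricToLineProductAt g p hH.toRiemMetric := by
  refine ⟨splitChart e Ψ, mem_splitChart_source.2 ⟨hp, hpΨ⟩, contMDiffOn_splitChart he hΨ',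
    contMDiffOn_splitChart_symm he hΨ, fun x hx v w ↦ ?_⟩
  obtain ⟨hx1, hx2⟩ := mem_splitChart_source.1 hx
  have hD : ∀ u, fderiv ℝ Ψ (Ψ.symm (e x)) (fderiv ℝ Ψ.symm (e x) u) = u := fun u ↦
    Ψ.symm.fderiv_symm_fderiv hΨ' hΨ hx2 u
  have h1 : ∀ a b, bilinIn e g.inner (e x) a b
      = head d (fderiv ℝ Ψ.symm (e x) a) * head d (fderiv ℝ Ψ.symm (e x) b)
        + H (tail d (Ψ.symm (e x))) (tail d (fderiv ℝ Ψ.symm (e x) a))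
          (tail d (fderiv ℝ Ψ.symm (e x) b)) := by
    intro a b
    rw [← hsplit _ (Ψ.map_target hx2), hD, hD, Ψ.right_inv hx2]
  refine Eq.trans ?_ ((h1 _ _).symm.trans (bilinIn_mfderiv he g.inner hx1 v w))
  exact congrArg₂ (· + ·)
    (congrArg₂ (· * ·) (mvfderiv_fst_splitChart he hΨ' hx v) (mvfderiv_fst_splitChart he hΨ' hx w))
    (congrArg₂ (fun a b ↦ H (tail d (Ψ.symm (e x))) a b) (mfderiv_snd_splitChart he hΨ' hx v)
      (mfderiv_snd_splitChart he hΨ' hx w))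

end LocalIsometry

/-! ### The main theorem -/

theorem mainTheorem1 (n : ℕ) (hn : 1 ≤ n)
    {M : Type*} [TopologicalSpace M] [Nonempty M]
    [ChartedSpace (Euc (2 * n + 1)) M] [IsManifold (𝓡 (2 * n + 1)) ∞ M]
    (S : AlmostContactMetric n M) (f : M → ℝ) (hS : S.IsFCosymplectic f)
    (lam : ℝ) (hsol : IsRicciSoliton S.g S.ξ lam) :
    (∀ x, f x = 0) ∧ S.IsCosymplectic ∧ IsRicciFlat S.g ∧ lam = 0 ∧
      ∀ p : M, ∃ (N : Type) (_ : TopologicalSpace N) (_ : T2Space N)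
        (_ : SecondCountableTopology N) (_ : ChartedSpace (Euc (2 * n)) N)
        (_ : IsManifold (𝓡 (2 * n)) ∞ N) (K : KahlerStructure n N),
        IsRicciFlat K.h ∧ IsLocallyIsometricToLineProductAt S.g p K.h := by
  have hd : 1 ≤ 2 * n := by omega
  have key := fun e he y₀ hy₀ ↦ (hS.isFCosymplecticOn (e := e) he).exists_splitting (y₀ := y₀) hd
    (hsol e he) hy₀
  have hf : ∀ x, f x = 0 := by
    intro x
    have h1 := (key _ (chart_mem_atlas (Euc (2 * n + 1)) x) _ (mem_chart_target _ x)).2.1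
    rwa [Function.comp, OpenPartialHomeomorph.left_inv _ (mem_chart_source _ x)] at h1
  refine ⟨hf, ⟨hS.eta_closed, fun e he y hy u v w ↦ ?_, hS.normal⟩,
    fun e he y hy ↦ (key e he y hy).2.2.1, ?_, fun p ↦ ?_⟩
  · rw [hS.d_omega e he y hy, hf, mul_zero, zero_mul]
  -- `lam` is a single constant, so one chart around one point determines it.
  · obtain ⟨x⟩ := ‹Nonempty M›
    exact (key _ (chart_mem_atlas (Euc (2 * n + 1)) x) _ (mem_chart_target _ x)).1
  -- The Kähler factor is `ℝ^(2n)` itself, with the metric and complex structure induced on the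
  -- slice through `p`.
  · obtain ⟨-, -, -, Ψ, H, J, h0, h1, -, hΨ, hΨ', hsplit, hH, hJ, hsq, hHJ, hN, hdJ, hric⟩ :=
      key _ (chart_mem_atlas (Euc (2 * n + 1)) p) _ (mem_chart_target _ p)
    have hT2 : T2Space (EuclideanSpace ℝ (Fin (2 * n))) := inferInstance
    have hsc : SecondCountableTopology (EuclideanSpace ℝ (Fin (2 * n))) := inferInstance
    refine ⟨Euc (2 * n), inferInstance, hT2, hsc, chartedSpaceSelf _, inferInstance,
      kahlerStructureOfCoord hH hJ hsq hHJ hN hdJ, isRicciFlat_toRiemMetric hH hric, ?_⟩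
    exact isLocallyIsometricToLineProductAt_of_splitting (chart_mem_atlas _ p) S.g
      (mem_chart_source _ p) (h1 ▸ Ψ.map_source h0) hΨ hΨ' hH hsplit

end
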